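/- A plane map $\mathcal M$ is a connected graph drawn in the Euclidean plane (edges are simple polygonal arcs joining two distinct vertices and meeting other edges and the vertex set only at their ends; parallel edges are allowed), locally finite, all of whose faces, i.e. the connected components of the complement of vertices and edges, are bounded. A symmetry of $\mathcal M$ is an isometry of the plane mapping vertices to vertices and edges to edges, and $\mathcal M$ is periodic if it is invariant under translations in two non-parallel directions. A directed edge is a pair $(v,e)$ of an edge $e$ and a vertex $v$ in $e$. A harmonic vector is a real function $w$ on directed edges such that the sums of $w$ over the directed edges originating at any vertex, contained in any edge, and having any given face on the right, all vanish. $Harm^{per}(\mathcal M)$ denotes the harmonic vectors invariant under translations of $\mathcal M$ in two non-parallel directions. A symmetry $f$ of $\mathcal M$ acts on vectors by $(f_*w)(f(d))=w(d)$. Let $\mathcal M$ be a periodic plane map and $0\neq w\in Harm^{per}(\mathcal M)$. The tiling $\mathcal T(\mathcal M,w)$, unique up to translation, is given by heights $y$ of the vertices and abscissas $x$ of the faces with $y(v)-y(v')=w_d$ for each directed edge $d$ from $v$ to $v'$ and $x(F')-x(F)=w_d$, where $F$ and $F'$ are the faces on the right and on the left of $d$. To every $d$ from $v$ to $v'$ with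 $w_d>0$ corresponds the square $[x(F),x(F')]\times[y(v'),y(v)]$. To a vertex $v$ corresponds a horizontal face of the tiling: the union of the horizontal edges at height $y(v)$ of the squares of the edges at $v$. To a face $F$ corresponds a vertical face of the tiling: the union of the vertical edges at abscissa $x(F)$ of the squares of the edges bordering $F$. A symmetry of the tiling is an isometry of the plane that permutes its squares. A symmetry $f$ of $\mathcal M$ induces a symmetry of $\mathcal T(\mathcal M,w)$ if there is a symmetry $g$ of $\mathcal T(\mathcal M,w)$ such that for every edge, vertex and face $c$ of $\mathcal M$, $g$ maps the square, horizontal face or vertical face corresponding to $c$ onto the one corresponding to $f(c)$ (the square of an edge with $w_e=0$ being empty). **Proposition.** Let $\mathcal M$ be a periodic plane map. For every $0\ne w\in Harm^{per}(\mathcal M)$ the tiling $\mathcal T(\mathcal M,w)$ exists, and the following hold. (i) For every symmetry $f$ of $\mathcal M$ and every $0\neq w\in Harm^{per}(\mathcal M)$, $f$ induces a symmetry of $\mathcal T(\mathcal M,w)$ if and only if $f_*(w)=w$ or $f_*(w)=-w$. (ii) If the symmetry group of $\mathcal M$ contains a wallpaper group of type $p2$, then so does the symmetry group of $\mathcal T(\mathcal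 M,w)$ for every $0\neq w\in Harm^{per}(\mathcal M)$. (iii) If $(w^1,w^2)$ is a basis of $Harm^{per}(\mathcal M)$, then for Lebesgue-almost every $(\alpha_1,\alpha_2)\in\mathbb R^2$ the symmetry group of $\mathcal T(\mathcal M,\alpha_1w^1+\alpha_2w^2)$ is a wallpaper group of type $p1$, $p2$ or $p4$. -/

import Mathlib

open Set Filter Topology

noncomputable section

/-! The Euclidean plane is `ℂ`; its isometries are the elements of the group `ℂ ≃ᵢ ℂ`. -/

/-- The translation `z ↦ z + t`. -/
def planeTranslation (t : ℂ) : ℂ ≃ᵢ ℂ := IsometryEquiv.addRight t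

/-- The isometries `g` with `g '' S ∈ 𝒮` for `S ∈ 𝒮`, and conversely: the symmetry group of a
family `𝒮` of subsets of the plane. -/
def familySymmetryGroup (𝒮 : Set (Set ℂ)) : Subgroup (ℂ ≃ᵢ ℂ) where
  carrier := {g | (fun S : Set ℂ => g '' S) '' 𝒮 = 𝒮}
  one_mem' := by
    change (fun S : Set ℂ => id '' S) '' 𝒮 = 𝒮
    simp
  mul_mem' := by
    intro a b ha hb
    change (fun S : Set ℂ => a '' S) '' 𝒮 = 𝒮 at ha
    change (fun S : Set ℂ => b '' S) '' 𝒮 = 𝒮 at hb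
    change (fun S : Set ℂ => (a ∘ b) '' S) '' 𝒮 = 𝒮
    simp only [image_comp]
    rw [← image_image (fun S : Set ℂ => a '' S) (fun S : Set ℂ => b '' S), hb, ha]
  inv_mem' := by
    intro a ha
    change (fun S : Set ℂ => a '' S) '' 𝒮 = 𝒮 at ha
    change (fun S : Set ℂ => a.symm '' S) '' 𝒮 = 𝒮
    conv_lhs => rw [← ha]
    rw [image_image]
    simp [image_image]

/-- `G` contains translations in two non-parallel directions. -/
def HasTwoTranslations (G : Subgroup (ℂ ≃ᵢ ℂ)) : Prop :=
  ∃ t₁ t₂ : ℂ, LinearIndependent ℝ ![t₁, t₂] ∧ planeTranslation t₁ ∈ G ∧ planeTranslation t₂ ∈ G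

/-- `G` is a wallpaper group of type `p k` (for `k = 1, 2, 3, 4, 6`): its translations form a
lattice of rank two and its point group is the group of rotations of order `k`. -/
def IsWallpaperP (k : ℕ) (G : Subgroup (ℂ ≃ᵢ ℂ)) : Prop :=
  (∃ t₁ t₂ : ℂ, LinearIndependent ℝ ![t₁, t₂] ∧
    ∀ t : ℂ, planeTranslation t ∈ G ↔ ∃ m n : ℤ, t = m * t₁ + n * t₂) ∧
  (∀ g ∈ G, ∃ a b : ℂ, a ^ k = 1 ∧ ∀ z, g z = a * z + b) ∧
  (∃ g ∈ G, ∃ a b : ℂ, IsPrimitiveRoot a k ∧ ∀ z, g z = a * z + b)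

/-- `G` has at least the symmetry `p2`. -/
def ContainsP2 (G : Subgroup (ℂ ≃ᵢ ℂ)) : Prop :=
  ∃ H : Subgroup (ℂ ≃ᵢ ℂ), H ≤ G ∧ IsWallpaperP 2 H

/-- `e` is the simple polygonal arc with successive corners `p 0, …, p n`. -/
def IsPolygonalArc (n : ℕ) (p : ℕ → ℂ) (e : Set ℂ) : Prop :=
  0 < n ∧ (∀ i < n, p i ≠ p (i + 1)) ∧
  (∀ i j, i < j → j < n →
    segment ℝ (p i) (p (i + 1)) ∩ segment ℝ (p j) (p (j + 1)) = if j = i + 1 then {p j} else ∅) ∧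
  e = ⋃ i ∈ Iio n, segment ℝ (p i) (p (i + 1))

/-- The faces of a drawing with vertex set `V` and edge set `E`: the connected components of the
plane minus vertices and edges. -/
def facesOf (V : Set ℂ) (E : Set (Set ℂ)) : Set (Set ℂ) :=
  {F | ∃ z ∈ (V ∪ ⋃₀ E)ᶜ, F = connectedComponentIn (V ∪ ⋃₀ E)ᶜ z}

/-- A plane map: a connected graph drawn in the plane, locally finite, with bounded faces. An edge
is given by its point set, so parallel edges are allowed. -/
structure PlaneMap where
  V : Set ℂ
  E : Set (Set ℂ)
  /-- An edge is a polygonal arc that contains its two ends and no other vertex. -/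
  edge_arc : ∀ e ∈ E, ∃ n p, IsPolygonalArc n p e ∧ e ∩ V = {p 0, p n}
  edge_inter : ∀ e ∈ E, ∀ e' ∈ E, e ≠ e' → e ∩ e' ⊆ V
  connected : ∀ u ∈ V, ∀ v ∈ V,
    Relation.ReflTransGen (fun a b : ℂ => a ∈ V ∧ b ∈ V ∧ ∃ e ∈ E, a ∈ e ∧ b ∈ e) u v
  face_bounded : ∀ F ∈ facesOf V E, Bornology.IsBounded F
  locally_finite : ∀ K : Set ℂ, IsCompact K →
    (V ∩ K).Finite ∧ {e ∈ E | (e ∩ K).Nonempty}.Finite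

namespace PlaneMap

variable (M : PlaneMap)

/-- The set `F(M)` of faces. -/
def faces : Set (Set ℂ) := facesOf M.V M.E

/-- A directed edge: a pair `(v, e)` with `v` a vertex and `e` an edge containing `v`. -/
structure DirEdge where
  vertex : ℂ
  edge : Set ℂ
  vertex_mem : vertex ∈ M.V
  edge_mem : edge ∈ M.E
  mem : vertex ∈ edge

/-- The group of the isometries of the plane that map vertices to vertices and edges to edges. -/
def symmetryGroup : Subgroup (ℂ ≃ᵢ ℂ) :=
  familySymmetryGroup M.E ⊓ familySymmetryGroup ((fun v : ℂ => {v}) '' M.V)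

/-- `M` is invariant under translations in two non-parallel directions. -/
def IsPeriodic : Prop := HasTwoTranslations M.symmetryGroup

variable {M}

/-- The face `F` lies on the right of the directed edge `d`: at the midpoint of some segment of the
polygonal arc, run through from `d.vertex`, the points just to the right belong to `F`. -/
def OnRight (d : M.DirEdge) (F : Set ℂ) : Prop :=
  F ∈ M.faces ∧ ∃ (n : ℕ) (p : ℕ → ℂ), IsPolygonalArc n p d.edge ∧ p 0 = d.vertex ∧ ∃ i < n,
    ∀ᶠ s : ℝ in 𝓝[>] 0,
      (p i + p (i + 1)) / 2 - (s : ℂ) * (Complex.I * (p (i + 1) - p i)) ∈ F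

/-- `d'` is `d` with the direction reversed. -/
def IsReverse (d d' : M.DirEdge) : Prop := d.edge = d'.edge ∧ d.vertex ≠ d'.vertex

/-- Harmonic vectors: the sums over the directed edges originating from any vertex, contained in
any edge, or having any face on the right, are zero (these sums are finite). -/
def IsHarmonic (w : M.DirEdge → ℝ) : Prop :=
  (∀ v ∈ M.V, ∑ᶠ d ∈ {d : M.DirEdge | d.vertex = v}, w d = 0) ∧
  (∀ e ∈ M.E, ∑ᶠ d ∈ {d : M.DirEdge | d.edge = e}, w d = 0) ∧
  (∀ F ∈ M.faces, ∑ᶠ d ∈ {d : M.DirEdge | OnRight d F}, w d = 0)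

theorem symm_vertex {f : ℂ ≃ᵢ ℂ} (hf : f ∈ M.symmetryGroup) {v : ℂ} (hv : v ∈ M.V) :
    f v ∈ M.V := by
  have h : (fun S : Set ℂ => f '' S) '' ((fun v : ℂ => {v}) '' M.V) = (fun v : ℂ => {v}) '' M.V :=
    hf.2
  have h1 : f '' {v} ∈ (fun v : ℂ => ({v} : Set ℂ)) '' M.V := by
    rw [← h]
    exact mem_image_of_mem _ (mem_image_of_mem _ hv)
  obtain ⟨u, hu, hu'⟩ := h1
  rw [image_singleton] at hu'
  rwa [← singleton_injective hu']

theorem symm_edge {f : ℂ ≃ᵢ ℂ} (hf : f ∈ M.symmetryGroup) {e : Set ℂ} (he : e ∈ M.E) :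
    f '' e ∈ M.E := by
  have h : (fun S : Set ℂ => f '' S) '' M.E = M.E := hf.1
  have h1 := mem_image_of_mem (fun S : Set ℂ => f '' S) he
  rwa [h] at h1

/-- The action of a symmetry of `M` on directed edges. -/
def mapDir (f : M.symmetryGroup) (d : M.DirEdge) : M.DirEdge where
  vertex := f.1 d.vertex
  edge := f.1 '' d.edge
  vertex_mem := symm_vertex f.2 d.vertex_mem
  edge_mem := symm_edge f.2 d.edge_mem
  mem := mem_image_of_mem _ d.mem

/-- The action `f_*` of a symmetry of `M` on vectors, `(f_* w) (f d) = w d`. -/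
def pushforward (f : M.symmetryGroup) (w : M.DirEdge → ℝ) : M.DirEdge → ℝ :=
  fun d => w (mapDir f⁻¹ d)

variable (M)

/-- The space `Harm^per(M)` of the harmonic vectors that are invariant under translations of `M`
in two non-parallel directions. -/
def harmPer : Set (M.DirEdge → ℝ) :=
  {w | IsHarmonic w ∧ ∃ (f₁ f₂ : M.symmetryGroup) (t₁ t₂ : ℂ),
    f₁.1 = planeTranslation t₁ ∧ f₂.1 = planeTranslation t₂ ∧ LinearIndependent ℝ ![t₁, t₂] ∧
    pushforward f₁ w = w ∧ pushforward f₂ w = w}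

/-- `(w₁, w₂)` is a basis of `Harm^per(M)`. -/
def IsHarmPerBasis (w₁ w₂ : M.DirEdge → ℝ) : Prop :=
  LinearIndependent ℝ ![w₁, w₂] ∧ (Submodule.span ℝ {w₁, w₂} : Set (M.DirEdge → ℝ)) = M.harmPer

/-- The square tiling `T(M, w)`, which is unique up to translations, in a given position. A vertex
`v` of `M` stands for a horizontal face of the tiling, at height `height v`; a face `F` of `M`
stands for a vertical face, at abscissa `abscissa F`; an edge with `w d > 0` stands for a square of
side `w d` between the horizontal faces of the origin of `d` (above) and of its end (below), and
between the vertical faces on the right of `d` (which is the western side, as `d` points down) and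
on the left of `d`. Values off `M.V` and off `M.faces` play no role. -/
structure SquareTiling (w : M.DirEdge → ℝ) where
  height : ℂ → ℝ
  abscissa : Set ℂ → ℝ
  height_sub : ∀ d d' : M.DirEdge, IsReverse d d' → height d.vertex - height d'.vertex = w d
  abscissa_sub : ∀ (d d' : M.DirEdge) (F F' : Set ℂ), IsReverse d d' → OnRight d F →
    OnRight d' F' → abscissa F' - abscissa F = w d

namespace SquareTiling

variable {M} {w : M.DirEdge → ℝ} (T : M.SquareTiling w)

/-- The square that corresponds to the edge `e` (empty if `w` vanishes on `e`). -/
def square (e : Set ℂ) : Set ℂ :=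
  {z | ∃ (d : M.DirEdge) (F : Set ℂ), d.edge = e ∧ 0 < w d ∧ OnRight d F ∧
    z.re ∈ Icc (T.abscissa F) (T.abscissa F + w d) ∧
    z.im ∈ Icc (T.height d.vertex - w d) (T.height d.vertex)}

/-- The set of squares of the tiling. -/
def tiles : Set (Set ℂ) := {S | ∃ e ∈ M.E, S = T.square e ∧ S.Nonempty}

/-- The horizontal face that corresponds to the vertex `v`: the union of the horizontal edges, at
the height of `v`, of the squares whose edge in `M` contains `v`. -/
def horizontalFace (v : ℂ) : Set ℂ :=
  {z | z.im = T.height v ∧ ∃ d : M.DirEdge, d.vertex = v ∧ z ∈ T.square d.edge}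

/-- The vertical face that corresponds to the face `F`: the union of the vertical edges, at the
abscissa of `F`, of the squares whose edge in `M` borders `F`. -/
def verticalFace (F : Set ℂ) : Set ℂ :=
  {z | z.re = T.abscissa F ∧ ∃ d : M.DirEdge, OnRight d F ∧ z ∈ T.square d.edge}

/-- The group of the isometries of the plane that map squares of the tiling to such squares. -/
def symmetryGroup : Subgroup (ℂ ≃ᵢ ℂ) := familySymmetryGroup T.tiles

/-- The symmetry `f` of `M` induces a symmetry of the tiling: some symmetry `g` of the tiling acts
on the squares, horizontal faces and vertical faces in the same way as `f` acts on the edges,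
vertices and faces of `M` to which they correspond. -/
def Induces (f : M.symmetryGroup) : Prop :=
  ∃ g ∈ T.symmetryGroup,
    (∀ e ∈ M.E, g '' T.square e = T.square (f.1 '' e)) ∧
    (∀ v ∈ M.V, g '' T.horizontalFace v = T.horizontalFace (f.1 v)) ∧
    (∀ F ∈ M.faces, g '' T.verticalFace F = T.verticalFace (f.1 '' F))

end SquareTiling

end PlaneMap

end

/-!
The existence of the heights and abscissas is a discrete Poincaré lemma, proved by complex analysis.
Attach to each edge the integral of `dζ / (ζ - z)` along it, a function of `z` that is holomorphic
off the edge, jumps by `2πi` across it, and tends to zero at infinity. For a finite cycle of edges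
the sum of these functions is locally constant off the graph, so it records a finitely supported
function on the faces whose coboundary is the cycle; as `w` sums to zero around every face, it sums
to zero along every cycle, and the heights exist. For the abscissas the functions are weighted with
`w` instead: since `w` sums to zero at every vertex, the result is, up to a holomorphic correction,
locally constant off the graph in any given disc, and its values are the abscissas.

A symmetry of `M` with `f_* w = ± w` changes heights and abscissas by isometries of the line and
therefore permutes the squares. Conversely, an isometry that maps horizontal faces to horizontal
faces acts on the heights by `y ↦ ± y + k`, so that `f_* w = ± w`. For a half-turn `f`, the sum of
the height functions of `w` and of its image under `f` is periodic and discretely harmonic, hence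
constant by the maximum principle: `f_* w = -w`, and `f` induces a half-turn of the tiling.

For (iii), the period lattice of the tiling depends linearly on `α`, so for almost every `α` none of
its nonzero vectors `z` has a real `z ^ 4`, that is, lies on one of the four axes of symmetry of an
axis-parallel square. The linear part of every symmetry of the tiling preserves these squares, and
the reflections among them are excluded by the choice of `α`: rotations of order dividing four
remain.
-/

noncomputable section

/-! ### Segments, arguments and angles -/

theorem eventually_mem_imp_of_isClosed {X : Type*} [TopologicalSpace X] {A : Set X}
    (hA : IsClosed A) (q : X) : ∀ᶠ z in 𝓝 q, z ∈ A → q ∈ A := by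
  by_cases hq : q ∈ A
  · exact Eventually.of_forall fun _ _ => hq
  · filter_upwards [hA.isOpen_compl.mem_nhds hq] with z hz hzA
    exact absurd hzA hz

theorem isCompact_segment {E : Type*} [AddCommGroup E] [Module ℝ E] [TopologicalSpace E]
    [IsTopologicalAddGroup E] [ContinuousSMul ℝ E] (a b : E) : IsCompact (segment ℝ a b) := by
  rw [← convexHull_pair]
  exact (Set.toFinite {a, b}).isCompact_convexHull ℝ

theorem tendsto_const_add_nhds_zero {A : Type*} [AddMonoid A] [TopologicalSpace A]
    [ContinuousAdd A] (q : A) : Tendsto (fun z => q + z) (𝓝 0) (𝓝 q) :=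
  (continuous_const_add q).tendsto' 0 q (add_zero q)

theorem tendsto_ofReal_mul {a : ℂ} (ha : a ≠ 0) :
    Tendsto (fun t : ℝ => (t : ℂ) * a) (𝓝[>] 0) (𝓝[≠] 0) := by
  refine tendsto_nhdsWithin_iff.2 ⟨?_, ?_⟩
  · have hcont : Continuous fun t : ℝ => (t : ℂ) * a := by fun_prop
    exact (hcont.tendsto' 0 0 (by simp)).mono_left nhdsWithin_le_nhds
  · filter_upwards [self_mem_nhdsWithin] with t ht
    exact mul_ne_zero (Complex.ofReal_ne_zero.2 (ne_of_gt ht)) ha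

theorem eventually_add_mem_segment_iff {a b : ℂ} (hab : a ≠ b) :
    ∀ᶠ z : ℂ in 𝓝[≠] 0, (a + z ∈ segment ℝ a b ↔ z.arg = (b - a).arg) := by
  have hsub : b - a ≠ 0 := sub_ne_zero.2 hab.symm
  have hlength : 0 < ‖b - a‖ := norm_pos_iff.2 hsub
  have hshort : ∀ᶠ z : ℂ in 𝓝[≠] 0, ‖z‖ < ‖b - a‖ :=
    (tendsto_norm_zero.eventually_lt_const hlength).filter_mono nhdsWithin_le_nhds
  filter_upwards [hshort, self_mem_nhdsWithin] with z hz hz0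
  rw [segment_eq_image']
  constructor
  · rintro ⟨t, ht, h⟩
    obtain rfl : t • (b - a) = z := add_left_cancel h
    have ht0 : 0 < t := ht.1.lt_of_ne fun h0 => hz0 (by simp [← h0])
    rw [Complex.real_smul, Complex.arg_real_mul _ ht0]
  · intro harg
    have hray : SameRay ℝ (b - a) z := Complex.sameRay_iff.2 (Or.inr (Or.inr harg.symm))
    refine ⟨‖z‖ / ‖b - a‖, ⟨by positivity, (div_le_one hlength).2 hz.le⟩, ?_⟩
    simp only
    rw [div_eq_inv_mul, mul_smul, ← hray.norm_smul_eq, inv_smul_smul₀ hlength.ne']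

theorem arg_ofReal_mul_exp {ρ : ℝ} (hρ : 0 < ρ) (φ : ℝ) :
    ((ρ : ℂ) * Complex.exp (φ * Complex.I)).arg = toIocMod Real.two_pi_pos (-Real.pi) φ := by
  rw [Complex.arg_real_mul _ hρ, Complex.arg_exp_mul_I]

theorem toIocMod_neg_pi_of_mem {θ : ℝ} (hθ : θ ∈ Ioc (-Real.pi) Real.pi) :
    toIocMod Real.two_pi_pos (-Real.pi) θ = θ := by
  rw [toIocMod_eq_self, show -Real.pi + 2 * Real.pi = Real.pi by ring]
  exact hθ

theorem frequently_arg_eq {θ : ℝ} (hθ : θ ∈ Ioc (-Real.pi) Real.pi) :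
    ∃ᶠ z : ℂ in 𝓝[≠] 0, z.arg = θ := by
  refine (tendsto_ofReal_mul (Complex.exp_ne_zero (θ * Complex.I))).frequently
    (Eventually.frequently ?_)
  filter_upwards [self_mem_nhdsWithin] with ρ hρ
  rw [arg_ofReal_mul_exp hρ, toIocMod_neg_pi_of_mem hθ]

/-- The counterclockwise angle from the direction `θ` to the direction `θ'`, in `(0, 2π]`; it is
`2π`, not `0`, when the directions agree. -/
def angularGap (θ θ' : ℝ) : ℝ := toIocMod Real.two_pi_pos 0 (θ' - θ)

theorem angularGap_mem_Ioc (θ θ' : ℝ) : angularGap θ θ' ∈ Ioc 0 (2 * Real.pi) := by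
  simpa only [angularGap, zero_add] using toIocMod_mem_Ioc Real.two_pi_pos 0 (θ' - θ)

theorem exp_add_angularGap (θ θ' : ℝ) :
    Complex.exp ((θ + angularGap θ θ' : ℝ) * Complex.I) = Complex.exp (θ' * Complex.I) := by
  have hgap : θ + angularGap θ θ' = θ' - toIocDiv Real.two_pi_pos 0 (θ' - θ) * (2 * Real.pi) := by
    rw [angularGap, ← self_sub_toIocDiv_zsmul, zsmul_eq_mul]
    ring
  rw [hgap]
  push_cast
  exact Complex.exp_mul_I_periodic.sub_int_mul_eq _

theorem angularGap_toIocMod_add {x : ℝ} (hx : x ∈ Ioc 0 (2 * Real.pi)) (θ : ℝ) :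
    angularGap θ (toIocMod Real.two_pi_pos (-Real.pi) (θ + x)) = x := by
  refine (toIocMod_eq_iff _).2
    ⟨by rwa [zero_add], -toIocDiv Real.two_pi_pos (-Real.pi) (θ + x), ?_⟩
  rw [← self_sub_toIocDiv_zsmul, neg_smul]
  ring

theorem angularGap_eq_ite {θ θ' : ℝ} (hθ : θ ∈ Ioc (-Real.pi) Real.pi)
    (hθ' : θ' ∈ Ioc (-Real.pi) Real.pi) :
    angularGap θ θ' = if θ < θ' then θ' - θ else θ' - θ + 2 * Real.pi := by
  obtain ⟨hθl, hθr⟩ := hθ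
  obtain ⟨hθl', hθr'⟩ := hθ'
  refine (toIocMod_eq_iff _).2 ?_
  split_ifs with h
  · exact ⟨⟨by linarith, by linarith⟩, 0, by simp⟩
  · exact ⟨⟨by linarith, by linarith⟩, -1, by simp⟩

theorem exists_angularGap_le {Θ : Set ℝ} (hΘ : Θ.Finite) (hne : Θ.Nonempty) (θ : ℝ) :
    ∃ θ' ∈ Θ, ∀ ψ ∈ Θ, angularGap θ θ' ≤ angularGap θ ψ :=
  Set.exists_min_image Θ (angularGap θ) hΘ hne

theorem eq_of_angularGap_le {Θ : Set ℝ} (hΘ : Θ ⊆ Ioc (-Real.pi) Real.pi) {θ₁ θ₂ θ' : ℝ}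
    (h₁ : θ₁ ∈ Θ) (h₂ : θ₂ ∈ Θ) (h' : θ' ∈ Θ)
    (hmin₁ : ∀ ψ ∈ Θ, angularGap θ₁ θ' ≤ angularGap θ₁ ψ)
    (hmin₂ : ∀ ψ ∈ Θ, angularGap θ₂ θ' ≤ angularGap θ₂ ψ) : θ₁ = θ₂ := by
  obtain ⟨_, hr₁⟩ := hΘ h₁
  obtain ⟨_, hr₂⟩ := hΘ h₂
  obtain ⟨hl', _⟩ := hΘ h'
  have hle₁ := hmin₁ _ h₂
  have hle₂ := hmin₂ _ h₁
  rw [angularGap_eq_ite (hΘ h₁) (hΘ h'), angularGap_eq_ite (hΘ h₁) (hΘ h₂)] at hle₁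
  rw [angularGap_eq_ite (hΘ h₂) (hΘ h'), angularGap_eq_ite (hΘ h₂) (hΘ h₁)] at hle₂
  by_contra hne
  rcases lt_or_gt_of_ne hne with h | h <;> split_ifs at hle₁ hle₂ <;> linarith

/-! ### Polygonal arcs -/

namespace IsPolygonalArc

variable {n : ℕ} {p : ℕ → ℂ} {e : Set ℂ}

theorem pos (h : IsPolygonalArc n p e) : 0 < n := h.1

theorem ne_succ (h : IsPolygonalArc n p e) {i : ℕ} (hi : i < n) : p i ≠ p (i + 1) := h.2.1 i hi

theorem segment_inter_segment (h : IsPolygonalArc n p e) {i j : ℕ} (hij : i < j) (hj : j < n) :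
    segment ℝ (p i) (p (i + 1)) ∩ segment ℝ (p j) (p (j + 1)) =
      if j = i + 1 then {p j} else ∅ := h.2.2.1 i j hij hj

theorem mem_iff (h : IsPolygonalArc n p e) {z : ℂ} :
    z ∈ e ↔ ∃ i < n, z ∈ segment ℝ (p i) (p (i + 1)) := by
  rw [h.2.2.2]
  simp

theorem isCompact (h : IsPolygonalArc n p e) : IsCompact e := by
  rw [h.2.2.2]
  exact (Set.finite_Iio n).isCompact_biUnion fun i _ => isCompact_segment _ _

theorem eventually_mem_iff (h : IsPolygonalArc n p e) (q : ℂ) :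
    ∀ᶠ z in 𝓝 q, (z ∈ e ↔ ∃ i < n, q ∈ segment ℝ (p i) (p (i + 1)) ∧
      z ∈ segment ℝ (p i) (p (i + 1))) := by
  have hclosed : ∀ᶠ z in 𝓝 q, ∀ i ∈ Finset.range n, z ∈ segment ℝ (p i) (p (i + 1)) →
      q ∈ segment ℝ (p i) (p (i + 1)) := by
    rw [Filter.eventually_all_finset]
    exact fun i _ => eventually_mem_imp_of_isClosed (isCompact_segment _ _).isClosed q
  filter_upwards [hclosed] with z hz
  rw [h.mem_iff]
  constructor
  · rintro ⟨i, hi, hzi⟩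
    exact ⟨i, hi, hz i (Finset.mem_range.2 hi) hzi, hzi⟩
  · rintro ⟨i, hi, _, hzi⟩
    exact ⟨i, hi, hzi⟩

theorem eventually_add_mem_iff (h : IsPolygonalArc n p e) (q : ℂ) :
    ∀ᶠ z : ℂ in 𝓝[≠] 0, (q + z ∈ e ↔ ∃ i < n, q ∈ segment ℝ (p i) (p (i + 1)) ∧
      q + z ∈ segment ℝ (p i) (p (i + 1))) :=
  ((tendsto_const_add_nhds_zero q).eventually (h.eventually_mem_iff q)).filter_mono
    nhdsWithin_le_nhds

theorem eq_of_mem_segment (h : IsPolygonalArc n p e) {i j : ℕ} (hij : i < j) (hj : j < n) {z : ℂ}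
    (hzi : z ∈ segment ℝ (p i) (p (i + 1))) (hzj : z ∈ segment ℝ (p j) (p (j + 1))) :
    j = i + 1 ∧ z = p j := by
  have hz : z ∈ segment ℝ (p i) (p (i + 1)) ∩ segment ℝ (p j) (p (j + 1)) := ⟨hzi, hzj⟩
  rw [h.segment_inter_segment hij hj] at hz
  split_ifs at hz with hsucc
  · exact ⟨hsucc, hz⟩
  · exact absurd hz (notMem_empty _)

theorem corner_mem_segment_iff (h : IsPolygonalArc n p e) {i j : ℕ} (hi : i < n) (hj : j ≤ n) :
    p j ∈ segment ℝ (p i) (p (i + 1)) ↔ j = i ∨ j = i + 1 := by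
  constructor
  · intro hmem
    by_contra! hne
    rcases lt_trichotomy i j with hij | rfl | hij
    · obtain ⟨k, rfl⟩ : ∃ k, j = k + 1 := ⟨j - 1, by omega⟩
      exact h.ne_succ hj (h.eq_of_mem_segment (i := i) (j := k) (by omega) hj hmem
        (right_mem_segment ℝ _ _)).2.symm
    · exact hne.1 rfl
    · obtain ⟨rfl, heq⟩ := h.eq_of_mem_segment hij hi (left_mem_segment ℝ _ _) hmem
      exact h.ne_succ (by omega) heq
  · rintro (rfl | rfl)
    · exact left_mem_segment ℝ _ _
    · exact right_mem_segment ℝ _ _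

theorem eq_of_mem_openSegment (h : IsPolygonalArc n p e) {i k : ℕ} (hi : i < n) (hk : k < n)
    {z : ℂ} (hz : z ∈ openSegment ℝ (p i) (p (i + 1))) (hzk : z ∈ segment ℝ (p k) (p (k + 1))) :
    k = i := by
  have hzi := openSegment_subset_segment ℝ _ _ hz
  rcases lt_trichotomy k i with hki | hki | hki
  · obtain ⟨rfl, rfl⟩ := h.eq_of_mem_segment hki hi hzk hzi
    exact absurd (left_mem_openSegment_iff.1 hz) (h.ne_succ hi)
  · exact hki
  · obtain ⟨rfl, rfl⟩ := h.eq_of_mem_segment hki hk hzi hzk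
    exact absurd (right_mem_openSegment_iff.1 hz) (h.ne_succ hi)

theorem corner_ne (h : IsPolygonalArc n p e) {i j : ℕ} (hij : i < j) (hj : j ≤ n) : p i ≠ p j := by
  intro heq
  rcases (h.corner_mem_segment_iff (hij.trans_le hj) hj).1
    (heq ▸ left_mem_segment ℝ (p i) (p (i + 1))) with rfl | rfl
  · exact lt_irrefl _ hij
  · exact h.ne_succ hj heq

theorem corner_mem (h : IsPolygonalArc n p e) {j : ℕ} (hj : j ≤ n) : p j ∈ e := by
  rw [h.mem_iff]
  cases j with
  | zero => exact ⟨0, h.pos, left_mem_segment ℝ _ _⟩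
  | succ k => exact ⟨k, hj, right_mem_segment ℝ _ _⟩

theorem reverse (h : IsPolygonalArc n p e) : IsPolygonalArc n (fun i => p (n - i)) e := by
  have hsegment : ∀ i < n, segment ℝ (p (n - i)) (p (n - (i + 1))) =
      segment ℝ (p (n - (i + 1))) (p (n - (i + 1) + 1)) := by
    intro i hi
    rw [segment_symm, show n - (i + 1) + 1 = n - i by omega]
  refine ⟨h.pos, fun i hi => ?_, fun i j hij hj => ?_, ?_⟩
  · have hne := h.ne_succ (i := n - (i + 1)) (by omega)
    rw [show n - (i + 1) + 1 = n - i by omega] at hne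
    exact hne.symm
  · simp only
    rw [hsegment i (by omega), hsegment j hj, inter_comm,
      h.segment_inter_segment (by omega) (by omega)]
    by_cases hsucc : j = i + 1
    · rw [if_pos (by omega), if_pos hsucc, hsucc]
    · rw [if_neg (by omega), if_neg hsucc]
  · ext z
    rw [h.mem_iff]
    simp only [mem_iUnion, mem_Iio, exists_prop]
    constructor
    · rintro ⟨i, hi, hz⟩
      refine ⟨n - (i + 1), by omega, ?_⟩
      rw [hsegment _ (by omega), show n - (n - (i + 1) + 1) = i by omega]
      exact hz
    · rintro ⟨i, hi, hz⟩
      rw [hsegment i hi] at hz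
      exact ⟨_, by omega, hz⟩

theorem eventually_mem_iff_start (h : IsPolygonalArc n p e) :
    ∀ᶠ z : ℂ in 𝓝[≠] 0, (p 0 + z ∈ e ↔ z.arg = (p 1 - p 0).arg) := by
  filter_upwards [eventually_add_mem_segment_iff (h.ne_succ h.pos), h.eventually_add_mem_iff (p 0)]
    with z hfirst harc
  rw [harc, ← hfirst]
  constructor
  · rintro ⟨i, hi, hcorner, hz⟩
    rw [h.corner_mem_segment_iff hi (Nat.zero_le _)] at hcorner
    obtain rfl : i = 0 := by omega
    exact hz
  · exact fun hz => ⟨0, h.pos, left_mem_segment ℝ _ _, hz⟩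

theorem eventually_mem_iff_corner (h : IsPolygonalArc n p e) {i : ℕ} (hi : i + 1 < n) :
    ∀ᶠ z : ℂ in 𝓝[≠] 0, (p (i + 1) + z ∈ e ↔
      z.arg = (p i - p (i + 1)).arg ∨ z.arg = (p (i + 2) - p (i + 1)).arg) := by
  filter_upwards [eventually_add_mem_segment_iff (h.ne_succ (i := i) (by omega)).symm,
    eventually_add_mem_segment_iff (h.ne_succ hi), h.eventually_add_mem_iff (p (i + 1))]
    with z hbefore hafter harc
  rw [harc, ← hbefore, ← hafter, segment_symm ℝ (p (i + 1)) (p i)]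
  constructor
  · rintro ⟨k, hk, hcorner, hz⟩
    rw [h.corner_mem_segment_iff hk hi.le] at hcorner
    rcases hcorner with rfl | hcorner
    · exact Or.inr hz
    · obtain rfl : i = k := by omega
      exact Or.inl hz
  · rintro (hz | hz)
    · exact ⟨i, by omega, right_mem_segment ℝ _ _, hz⟩
    · exact ⟨i + 1, hi, left_mem_segment ℝ _ _, hz⟩

theorem corner_arg_ne (h : IsPolygonalArc n p e) {i : ℕ} (hi : i + 1 < n) :
    (p i - p (i + 1)).arg ≠ (p (i + 2) - p (i + 1)).arg := by
  intro harg
  obtain ⟨z, hz, hbefore, hafter, hz0⟩ :=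
    ((frequently_arg_eq (Complex.arg_mem_Ioc (p i - p (i + 1)))).and_eventually
      ((eventually_add_mem_segment_iff (h.ne_succ (i := i) (by omega)).symm).and
        ((eventually_add_mem_segment_iff (h.ne_succ hi)).and self_mem_nhdsWithin))).exists
  rw [segment_symm] at hbefore
  have heq := (h.eq_of_mem_segment (Nat.lt_succ_self i) hi (hbefore.2 hz)
    (hafter.2 (hz.trans harg))).2
  exact hz0 (by simpa using heq)

end IsPolygonalArc

/-! ### Faces and sectors -/

/-- The point with polar coordinates `x = (ρ, φ)` around `q`. -/
def polarPoint (q : ℂ) (x : ℝ × ℝ) : ℂ := q + x.1 * Complex.exp (x.2 * Complex.I)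

theorem continuous_polarPoint (q : ℂ) : Continuous (polarPoint q) := by
  unfold polarPoint
  fun_prop

theorem polarPoint_add_angularGap (q : ℂ) (θ θ' ρ φ : ℝ) :
    polarPoint q (ρ, φ + (θ + angularGap θ θ' - θ')) = polarPoint q (ρ, φ) := by
  have hsplit : ((φ + (θ + angularGap θ θ' - θ') : ℝ) : ℂ) * Complex.I =
      φ * Complex.I + ((θ + angularGap θ θ' : ℝ) * Complex.I - θ' * Complex.I) := by
    push_cast
    ring
  simp only [polarPoint]
  rw [hsplit, Complex.exp_add, Complex.exp_sub, exp_add_angularGap,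
    div_self (Complex.exp_ne_zero _), mul_one]

theorem add_mul_eq_polarPoint (q c u : ℂ) :
    q + c * u = polarPoint q (‖c‖ * ‖u‖, c.arg + u.arg) := by
  conv_lhs => rw [← Complex.norm_mul_exp_arg_mul_I c, ← Complex.norm_mul_exp_arg_mul_I u]
  simp only [polarPoint]
  push_cast
  rw [add_mul, Complex.exp_add]
  ring

namespace PlaneMap

variable (M : PlaneMap)

/-- The point set of the drawing: the union of its vertices and edges. -/
def graph : Set ℂ := M.V ∪ ⋃₀ M.E

variable {M}

theorem isCompact_edge {e : Set ℂ} (he : e ∈ M.E) : IsCompact e := by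
  obtain ⟨n, p, hp, _⟩ := M.edge_arc e he
  exact hp.isCompact

variable (M) in
theorem eventually_mem_edge (q : ℂ) :
    ∀ᶠ z in 𝓝 q, (z ∈ M.V → z = q) ∧ ∀ e ∈ M.E, z ∈ e → q ∈ e := by
  have hfinite := M.locally_finite _ (isCompact_closedBall q 1)
  have hvertices : ∀ᶠ z in 𝓝 q, ∀ v ∈ M.V ∩ Metric.closedBall q 1, z = v → q = v :=
    (Filter.eventually_all_finite hfinite.1).2 fun _ _ =>
      eventually_mem_imp_of_isClosed isClosed_singleton q
  have hedges : ∀ᶠ z in 𝓝 q, ∀ e ∈ {e ∈ M.E | (e ∩ Metric.closedBall q 1).Nonempty},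
      z ∈ e → q ∈ e :=
    (Filter.eventually_all_finite hfinite.2).2 fun _ he =>
      eventually_mem_imp_of_isClosed (isCompact_edge he.1).isClosed q
  filter_upwards [Metric.closedBall_mem_nhds q one_pos, hvertices, hedges] with z hz hzV hzE
  exact ⟨fun hv => (hzV z ⟨hv, hz⟩ rfl).symm, fun e he hze => hzE e ⟨he, z, hze, hz⟩ hze⟩

theorem isClosed_graph : IsClosed M.graph := by
  rw [← isOpen_compl_iff, isOpen_iff_mem_nhds]
  intro q hq
  filter_upwards [M.eventually_mem_edge q] with z hz hzg
  apply hq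
  rcases hzg with hv | ⟨e, he, hze⟩
  · exact hz.1 hv ▸ Or.inl hv
  · exact Or.inr ⟨e, he, hz.2 e he hze⟩

theorem edge_subset_graph {e : Set ℂ} (he : e ∈ M.E) : e ⊆ M.graph :=
  fun _ hz => Or.inr ⟨e, he, hz⟩

theorem face_subset_compl_graph {F : Set ℂ} (hF : F ∈ M.faces) : F ⊆ M.graphᶜ := by
  obtain ⟨_, _, rfl⟩ := hF
  exact connectedComponentIn_subset _ _

theorem isOpen_face {F : Set ℂ} (hF : F ∈ M.faces) : IsOpen F := by
  obtain ⟨_, _, rfl⟩ := hF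
  exact M.isClosed_graph.isOpen_compl.connectedComponentIn

theorem isPreconnected_face {F : Set ℂ} (hF : F ∈ M.faces) : IsPreconnected F := by
  obtain ⟨_, _, rfl⟩ := hF
  exact isPreconnected_connectedComponentIn

theorem face_nonempty {F : Set ℂ} (hF : F ∈ M.faces) : F.Nonempty := by
  obtain ⟨z, hz, rfl⟩ := hF
  exact ⟨z, mem_connectedComponentIn hz⟩

theorem subset_face {F S : Set ℂ} (hF : F ∈ M.faces) (hS : IsPreconnected S)
    (hSg : S ⊆ M.graphᶜ) (hSF : (S ∩ F).Nonempty) : S ⊆ F := by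
  obtain ⟨_, _, rfl⟩ := hF
  obtain ⟨x, hxS, hxF⟩ := hSF
  rw [connectedComponentIn_eq hxF]
  exact hS.subset_connectedComponentIn hxS hSg

theorem face_eq_of_mem {F F' : Set ℂ} (hF : F ∈ M.faces) (hF' : F' ∈ M.faces) {z : ℂ}
    (hz : z ∈ F) (hz' : z ∈ F') : F = F' :=
  (subset_face hF' (isPreconnected_face hF) (face_subset_compl_graph hF) ⟨z, hz, hz'⟩).antisymm
    (subset_face hF (isPreconnected_face hF') (face_subset_compl_graph hF') ⟨z, hz', hz⟩)

theorem exists_face_superset {S : Set ℂ} (hS : IsPreconnected S) (hSg : S ⊆ M.graphᶜ)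
    (hne : S.Nonempty) : ∃ F ∈ M.faces, S ⊆ F := by
  obtain ⟨z, hz⟩ := hne
  exact ⟨_, ⟨z, hSg hz, rfl⟩, hS.subset_connectedComponentIn hz hSg⟩

theorem face_eq_of_eventually {X : Type*} {l : Filter X} [l.NeBot] {u : X → ℂ} {F F' : Set ℂ}
    (hF : F ∈ M.faces) (hF' : F' ∈ M.faces) (h : ∀ᶠ x in l, u x ∈ F) (h' : ∀ᶠ x in l, u x ∈ F') :
    F = F' := by
  obtain ⟨_, hx, hx'⟩ := (h.and h').exists
  exact face_eq_of_mem hF hF' hx hx'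

variable (M) in
/-- `F` is the face just clockwise of the direction `θ` at the point `q`. -/
def FaceCW (q : ℂ) (θ : ℝ) (F : Set ℂ) : Prop :=
  F ∈ M.faces ∧ ∀ᶠ x in 𝓝[>] 0 ×ˢ 𝓝[<] θ, polarPoint q x ∈ F

variable (M) in
/-- `F` is the face just counterclockwise of the direction `θ` at the point `q`. -/
def FaceCCW (q : ℂ) (θ : ℝ) (F : Set ℂ) : Prop :=
  F ∈ M.faces ∧ ∀ᶠ x in 𝓝[>] 0 ×ˢ 𝓝[>] θ, polarPoint q x ∈ F

theorem FaceCW.unique {q : ℂ} {θ : ℝ} {F F' : Set ℂ} (h : M.FaceCW q θ F)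
    (h' : M.FaceCW q θ F') : F = F' :=
  face_eq_of_eventually h.1 h'.1 h.2 h'.2

theorem FaceCCW.unique {q : ℂ} {θ : ℝ} {F F' : Set ℂ} (h : M.FaceCCW q θ F)
    (h' : M.FaceCCW q θ F') : F = F' :=
  face_eq_of_eventually h.1 h'.1 h.2 h'.2

theorem polarPoint_notMem_graph {q : ℂ} {Θ : Set ℝ} {r : ℝ}
    (hq : ∀ z : ℂ, ‖z‖ < r → z ≠ 0 → q + z ∈ M.graph → z.arg ∈ Θ) {θ γ : ℝ}
    (hγ : γ ≤ 2 * Real.pi) (hmin : ∀ ψ ∈ Θ, γ ≤ angularGap θ ψ) {x : ℝ × ℝ}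
    (hx : x ∈ Ioo 0 r ×ˢ Ioo θ (θ + γ)) : polarPoint q x ∉ M.graph := by
  obtain ⟨⟨hρ0, hρr⟩, hφl, hφr⟩ := hx
  intro hmem
  have hnorm : ‖(x.1 : ℂ) * Complex.exp (x.2 * Complex.I)‖ = x.1 := by
    rw [norm_mul, Complex.norm_exp_ofReal_mul_I, mul_one, Complex.norm_of_nonneg hρ0.le]
  have hψ := hq _ (hnorm.trans_lt hρr) (norm_pos_iff.1 (hnorm.symm ▸ hρ0)) hmem
  rw [arg_ofReal_mul_exp hρ0, show x.2 = θ + (x.2 - θ) by ring] at hψ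
  have hle := hmin _ hψ
  rw [angularGap_toIocMod_add ⟨by linarith, by linarith⟩] at hle
  linarith

theorem exists_faceCCW_faceCW {q : ℂ} {Θ : Set ℝ}
    (hq : ∀ᶠ z : ℂ in 𝓝[≠] 0, q + z ∈ M.graph → z.arg ∈ Θ) {θ θ' : ℝ}
    (hmin : ∀ ψ ∈ Θ, angularGap θ θ' ≤ angularGap θ ψ) :
    ∃ F, M.FaceCCW q θ F ∧ M.FaceCW q θ' F := by
  set γ := angularGap θ θ' with hγ
  obtain ⟨hγ0, hγ2⟩ : γ ∈ Ioc 0 (2 * Real.pi) := angularGap_mem_Ioc θ θ'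
  rw [eventually_nhdsWithin_iff, Metric.eventually_nhds_iff] at hq
  obtain ⟨r, hr, hq⟩ := hq
  set sector := polarPoint q '' (Ioo 0 r ×ˢ Ioo θ (θ + γ))
  have hconnected : IsPreconnected sector :=
    (isPreconnected_Ioo.prod isPreconnected_Ioo).image _ (continuous_polarPoint q).continuousOn
  have hdisjoint : sector ⊆ M.graphᶜ := by
    rintro _ ⟨x, hx, rfl⟩
    exact polarPoint_notMem_graph (fun z hz => hq (by simpa using hz)) hγ2 hmin hx
  have hne : sector.Nonempty :=
    ((nonempty_Ioo.2 hr).prod (nonempty_Ioo.2 (by linarith))).image _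
  obtain ⟨F, hF, hsub⟩ := exists_face_superset hconnected hdisjoint hne
  refine ⟨F, ⟨hF, ?_⟩, hF, ?_⟩
  · filter_upwards [prod_mem_prod (Ioo_mem_nhdsGT hr) (Ioo_mem_nhdsGT (by linarith : θ < θ + γ))]
      with x hx
    exact hsub (mem_image_of_mem _ hx)
  · filter_upwards [prod_mem_prod (Ioo_mem_nhdsGT hr) (Ioo_mem_nhdsLT (by linarith : θ' - γ < θ'))]
      with x hx
    obtain ⟨hρ, hφl, hφr⟩ := hx
    rw [← Prod.mk.eta (p := x), ← polarPoint_add_angularGap q θ θ']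
    exact hsub (mem_image_of_mem _ ⟨hρ, by simp only; linarith, by simp only; linarith⟩)

theorem exists_faceCCW {q : ℂ} {Θ : Set ℝ} (hfin : Θ.Finite) (hne : Θ.Nonempty)
    (hq : ∀ᶠ z : ℂ in 𝓝[≠] 0, q + z ∈ M.graph → z.arg ∈ Θ) (θ : ℝ) :
    ∃ F, M.FaceCCW q θ F := by
  obtain ⟨_, _, hmin⟩ := exists_angularGap_le hfin hne θ
  obtain ⟨F, hF, _⟩ := exists_faceCCW_faceCW hq hmin
  exact ⟨F, hF⟩

/-- The map that takes a direction to the next one is injective on a finite set of directions,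
hence surjective: every direction is the end of a sector. -/
theorem exists_faceCW {q : ℂ} {Θ : Set ℝ} (hΘ : Θ ⊆ Ioc (-Real.pi) Real.pi) (hfin : Θ.Finite)
    (hq : ∀ᶠ z : ℂ in 𝓝[≠] 0, q + z ∈ M.graph → z.arg ∈ Θ) {θ : ℝ} (hθ : θ ∈ Θ) :
    ∃ F, M.FaceCW q θ F := by
  choose next hnext hmin using exists_angularGap_le hfin ⟨θ, hθ⟩
  have hinj : InjOn next Θ := fun a ha b hb hab =>
    eq_of_angularGap_le hΘ ha hb (hnext a) (hmin a) (by rw [hab]; exact hmin b)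
  have hsurj : SurjOn next Θ Θ :=
    ((hfin.injOn_iff_bijOn_of_mapsTo fun a _ => hnext a).1 hinj).surjOn
  obtain ⟨ψ, _, rfl⟩ := hsurj hθ
  obtain ⟨F, _, hF⟩ := exists_faceCCW_faceCW hq (hmin ψ)
  exact ⟨F, hF⟩

variable (M) in
/-- `F` is the face to the right of the point at parameter `t` of the segment from `a` to `b`. -/
def FaceRightAt (a b : ℂ) (t : ℝ) (F : Set ℂ) : Prop :=
  F ∈ M.faces ∧ ∀ᶠ s : ℝ in 𝓝[>] 0, a + (b - a) * (t - s * Complex.I) ∈ F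

theorem FaceRightAt.unique {a b : ℂ} {t : ℝ} {F F' : Set ℂ} (h : M.FaceRightAt a b t F)
    (h' : M.FaceRightAt a b t F') : F = F' :=
  face_eq_of_eventually h.1 h'.1 h.2 h'.2

theorem eventually_strip_notMem_graph {a b : ℂ} (hab : a ≠ b)
    (hregular : ∀ z ∈ openSegment ℝ a b, ∀ᶠ w in 𝓝 z, w ∈ M.graph → w ∈ segment ℝ a b)
    {t₁ t₂ : ℝ} (h₁ : t₁ ∈ Ioo (0 : ℝ) 1) (h₂ : t₂ ∈ Ioo (0 : ℝ) 1) :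
    ∀ᶠ s : ℝ in 𝓝[>] 0, ∀ t ∈ uIcc t₁ t₂, a + (b - a) * (t - s * Complex.I) ∉ M.graph := by
  have hsub : b - a ≠ 0 := sub_ne_zero.2 hab.symm
  have huniform : ∀ᶠ s : ℝ in 𝓝 0, ∀ t ∈ uIcc t₁ t₂, 0 < s →
      a + (b - a) * (t - s * Complex.I) ∉ M.graph := by
    apply isCompact_uIcc.eventually_forall_of_forall_eventually
    intro t ht
    have hz : a + (b - a) * t ∈ openSegment ℝ a b := by
      rw [openSegment_eq_image']
      exact ⟨t, (convex_Ioo 0 1).ordConnected.uIcc_subset h₁ h₂ ht, by simp [mul_comm]⟩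
    have hcont : Continuous fun x : ℝ × ℝ => a + (b - a) * (x.2 - x.1 * Complex.I) := by fun_prop
    have hlim : Tendsto (fun x : ℝ × ℝ => a + (b - a) * (x.2 - x.1 * Complex.I)) (𝓝 (0, t))
        (𝓝 (a + (b - a) * t)) := hcont.tendsto' _ _ (by simp)
    filter_upwards [hlim.eventually (hregular _ hz)] with x hx hpos hmem
    obtain ⟨τ, _, hτ⟩ := (segment_eq_image' ℝ a b).le (hx hmem)
    have hreal : (τ : ℂ) = x.2 - x.1 * Complex.I := by
      apply mul_left_cancel₀ hsub
      rw [← add_left_cancel hτ, Complex.real_smul, mul_comm]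
    exact hpos.ne' (by simpa using congrArg Complex.im hreal)
  filter_upwards [huniform.filter_mono nhdsWithin_le_nhds, self_mem_nhdsWithin] with s hs hs0 t ht
  exact hs t ht hs0

theorem FaceRightAt.of_mem_Ioo {a b : ℂ} (hab : a ≠ b)
    (hregular : ∀ z ∈ openSegment ℝ a b, ∀ᶠ w in 𝓝 z, w ∈ M.graph → w ∈ segment ℝ a b)
    {t₁ t₂ : ℝ} (h₁ : t₁ ∈ Ioo (0 : ℝ) 1) (h₂ : t₂ ∈ Ioo (0 : ℝ) 1) {F : Set ℂ}
    (h : M.FaceRightAt a b t₁ F) : M.FaceRightAt a b t₂ F := by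
  refine ⟨h.1, ?_⟩
  filter_upwards [eventually_strip_notMem_graph hab hregular h₁ h₂, h.2] with s hs hF
  let strip : ℝ → ℂ := fun t => a + (b - a) * (t - s * Complex.I)
  have hcont : Continuous strip := by fun_prop
  have hconnected : IsPreconnected (strip '' uIcc t₁ t₂) :=
    isPreconnected_uIcc.image strip hcont.continuousOn
  refine subset_face h.1 hconnected ?_ ⟨_, mem_image_of_mem strip left_mem_uIcc, hF⟩
    (mem_image_of_mem strip right_mem_uIcc)
  rintro _ ⟨t, ht, rfl⟩
  exact hs t ht

end PlaneMap

theorem tendsto_add_mul_ofReal_mul_I (t ε : ℝ) :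
    Tendsto (fun s : ℝ => (t : ℂ) + ε * s * Complex.I) (𝓝[>] 0) (𝓝 t) := by
  have hcont : Continuous fun s : ℝ => (t : ℂ) + ε * s * Complex.I := by fun_prop
  exact (hcont.tendsto' 0 _ (by simp)).mono_left nhdsWithin_le_nhds

theorem tendsto_arg_add_mul_ofReal_mul_I {t : ℝ} (ht : 0 < t) (ε : ℝ) :
    Tendsto (fun s : ℝ => ((t : ℂ) + ε * s * Complex.I).arg) (𝓝[>] 0) (𝓝 0) := by
  have harg := (Complex.continuousAt_arg (Complex.ofReal_mem_slitPlane.2 ht)).tendsto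
  rw [Complex.arg_ofReal_of_nonneg ht.le] at harg
  exact harg.comp (tendsto_add_mul_ofReal_mul_I t ε)

theorem exists_eventually_mem_of_polarPoint {q c : ℂ} (hc : c ≠ 0) {S : Set ℂ} {l : Filter ℝ}
    {ε : ℝ} (hside : ∀ t : ℝ, 0 < t →
      Tendsto (fun s : ℝ => c.arg + ((t : ℂ) + ε * s * Complex.I).arg) (𝓝[>] 0) l)
    (hS : ∀ᶠ x in 𝓝[>] 0 ×ˢ l, polarPoint q x ∈ S) :
    ∃ t ∈ Ioo (0 : ℝ) 1, ∀ᶠ s : ℝ in 𝓝[>] 0, q + c * (t + ε * s * Complex.I) ∈ S := by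
  have hpos : 0 < ‖c‖ := norm_pos_iff.2 hc
  obtain ⟨U, hU, V, hV, hUV⟩ := mem_prod_iff.1 hS
  obtain ⟨r, hr : 0 < r, hrU⟩ := mem_nhdsGT_iff_exists_Ioo_subset.1 hU
  obtain ⟨t, ht0, ht⟩ := exists_between (lt_min (div_pos hr hpos) one_pos)
  obtain ⟨htr, ht1⟩ := lt_min_iff.1 ht
  have hlt : ‖c‖ * t < r := by rwa [lt_div_iff₀' hpos] at htr
  refine ⟨t, ⟨ht0, ht1⟩, ?_⟩
  have hnorm : Tendsto (fun s : ℝ => ‖c‖ * ‖(t : ℂ) + ε * s * Complex.I‖) (𝓝[>] 0)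
      (𝓝 (‖c‖ * t)) := by
    have hlim := (tendsto_add_mul_ofReal_mul_I t ε).norm.const_mul ‖c‖
    rwa [Complex.norm_of_nonneg ht0.le] at hlim
  filter_upwards [(hside t ht0).eventually hV, hnorm.eventually_lt_const hlt,
    hnorm.eventually_const_lt (mul_pos hpos ht0)] with s hsV hsr hs0
  rw [add_mul_eq_polarPoint]
  exact hUV (mk_mem_prod (hrU ⟨hs0, hsr⟩) hsV)

namespace PlaneMap

variable {M : PlaneMap}

theorem FaceCW.exists_faceRightAt {a b : ℂ} (hab : a ≠ b) {F : Set ℂ}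
    (h : M.FaceCW a (b - a).arg F) : ∃ t ∈ Ioo (0 : ℝ) 1, M.FaceRightAt a b t F := by
  have hside : ∀ t : ℝ, 0 < t → Tendsto
      (fun s : ℝ => (b - a).arg + ((t : ℂ) + (-1 : ℝ) * s * Complex.I).arg) (𝓝[>] 0)
      (𝓝[<] (b - a).arg) := by
    refine fun t ht => tendsto_nhdsWithin_iff.2 ⟨?_, ?_⟩
    · simpa only [add_zero] using (tendsto_arg_add_mul_ofReal_mul_I ht (-1)).const_add (b - a).arg
    · filter_upwards [self_mem_nhdsWithin] with s hs
      refine add_lt_of_neg_right _ (Complex.arg_neg_iff.2 ?_)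
      simpa using hs
  obtain ⟨t, ht, hF⟩ := exists_eventually_mem_of_polarPoint (sub_ne_zero.2 hab.symm) hside h.2
  refine ⟨t, ht, h.1, hF.mono fun s hs => ?_⟩
  convert hs using 3
  push_cast
  ring

theorem FaceCCW.exists_faceRightAt {a b : ℂ} (hab : a ≠ b) {F : Set ℂ}
    (h : M.FaceCCW b (a - b).arg F) : ∃ t ∈ Ioo (0 : ℝ) 1, M.FaceRightAt a b t F := by
  have hside : ∀ t : ℝ, 0 < t → Tendsto
      (fun s : ℝ => (a - b).arg + ((t : ℂ) + (1 : ℝ) * s * Complex.I).arg) (𝓝[>] 0)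
      (𝓝[>] (a - b).arg) := by
    refine fun t ht => tendsto_nhdsWithin_iff.2 ⟨?_, ?_⟩
    · simpa only [add_zero] using (tendsto_arg_add_mul_ofReal_mul_I ht 1).const_add (a - b).arg
    · filter_upwards [self_mem_nhdsWithin] with s (hs : 0 < s)
      have him : ((t : ℂ) + (1 : ℝ) * s * Complex.I).im = s := by simp
      have hnonneg := Complex.arg_nonneg_iff.2 (him.symm ▸ hs.le)
      refine lt_add_of_pos_right _ (hnonneg.lt_of_ne fun h0 => hs.ne' ?_)
      exact him ▸ (Complex.arg_eq_zero_iff.1 h0.symm).2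
  obtain ⟨t, ht, hF⟩ := exists_eventually_mem_of_polarPoint (sub_ne_zero.2 hab) hside h.2
  refine ⟨1 - t, ⟨by linarith [ht.2], by linarith [ht.1]⟩, h.1, hF.mono fun s hs => ?_⟩
  convert hs using 1
  push_cast
  ring

theorem FaceCW.eq_of_faceCCW {a b : ℂ} (hab : a ≠ b)
    (hregular : ∀ z ∈ openSegment ℝ a b, ∀ᶠ w in 𝓝 z, w ∈ M.graph → w ∈ segment ℝ a b)
    {F F' : Set ℂ} (h : M.FaceCW a (b - a).arg F) (h' : M.FaceCCW b (a - b).arg F') :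
    F = F' ∧ M.FaceRightAt a b (1 / 2) F := by
  obtain ⟨t, ht, hF⟩ := h.exists_faceRightAt hab
  obtain ⟨t', ht', hF'⟩ := h'.exists_faceRightAt hab
  have hmid : (1 / 2 : ℝ) ∈ Ioo (0 : ℝ) 1 := by norm_num
  have hright := hF.of_mem_Ioo hab hregular ht hmid
  exact ⟨hright.unique (hF'.of_mem_Ioo hab hregular ht' hmid), hright⟩

end PlaneMap

/-! ### Directed edges -/

theorem arg_sub_eq_of_segment_subset {S : Set ℂ} {q b : ℂ} {θ : ℝ} (hqb : q ≠ b)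
    (hS : ∀ᶠ z : ℂ in 𝓝[≠] 0, q + z ∈ S → z.arg = θ) (hsub : segment ℝ q b ⊆ S) :
    (b - q).arg = θ := by
  have hne : b - q ≠ 0 := sub_ne_zero.2 hqb.symm
  obtain ⟨t, ⟨ht0, ht1⟩, ht⟩ := (Filter.Eventually.and
    (Ioo_mem_nhdsGT one_pos) ((tendsto_ofReal_mul hne).eventually hS)).exists
  rw [← Complex.arg_real_mul _ ht0]
  refine ht (hsub ?_)
  rw [segment_eq_image']
  exact ⟨t, ⟨ht0.le, ht1.le⟩, rfl⟩

theorem arg_sub_ne_of_mem_openSegment {a b z : ℂ} (hab : a ≠ b) (hz : z ∈ openSegment ℝ a b) :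
    (a - z).arg ≠ (b - z).arg := by
  have hne : b - a ≠ 0 := sub_ne_zero.2 hab.symm
  obtain ⟨τ, ⟨hτ0, hτ1⟩, rfl⟩ := (openSegment_eq_image' ℝ a b).le hz
  have ha : a - (a + τ • (b - a)) = (τ : ℂ) * -(b - a) := by
    rw [Complex.real_smul]
    ring
  have hb : b - (a + τ • (b - a)) = ((1 - τ : ℝ) : ℂ) * (b - a) := by
    rw [Complex.real_smul]
    push_cast
    ring
  rw [ha, hb, Complex.arg_real_mul _ hτ0, Complex.arg_real_mul _ (sub_pos.2 hτ1), ne_eq,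
    Complex.arg_eq_arg_iff (neg_ne_zero.2 hne) hne, norm_neg,
    div_self (by exact_mod_cast norm_ne_zero_iff.2 hne), one_mul]
  exact fun h => hne (self_eq_neg.1 h.symm)

namespace IsPolygonalArc

variable {n : ℕ} {p : ℕ → ℂ} {e : Set ℂ}

theorem segment_subset (h : IsPolygonalArc n p e) {i : ℕ} (hi : i < n) :
    segment ℝ (p i) (p (i + 1)) ⊆ e :=
  fun _ hz => h.mem_iff.2 ⟨i, hi, hz⟩

theorem eq_start_or_eq_end (h : IsPolygonalArc n p e) {q : ℂ} (hq : q ∈ e) {θ : ℝ}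
    (hθ : ∀ᶠ z : ℂ in 𝓝[≠] 0, q + z ∈ e → z.arg = θ) : q = p 0 ∨ q = p n := by
  have hcorner : ∀ j ≤ n, q = p j → q = p 0 ∨ q = p n := by
    rintro j hj rfl
    rcases Nat.eq_zero_or_pos j with rfl | hpos
    · exact Or.inl rfl
    rcases hj.eq_or_lt with rfl | hjn
    · exact Or.inr rfl
    obtain ⟨k, rfl⟩ := Nat.exists_eq_add_of_lt hpos
    rw [zero_add] at hjn hθ
    have hback := arg_sub_eq_of_segment_subset (h.ne_succ (by omega)).symm hθ
      (segment_symm ℝ (p k) _ ▸ h.segment_subset (by omega))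
    have hforth := arg_sub_eq_of_segment_subset (h.ne_succ hjn) hθ (h.segment_subset hjn)
    exact absurd (hback.trans hforth.symm) (h.corner_arg_ne hjn)
  obtain ⟨i, hi, hqi⟩ := h.mem_iff.1 hq
  rw [← insert_endpoints_openSegment] at hqi
  rcases hqi with hstart | hend | hopen
  · exact hcorner i hi.le hstart
  · exact hcorner (i + 1) hi hend
  have hqi := openSegment_subset_segment ℝ _ _ hopen
  have hdirection : ∀ b ∈ segment ℝ (p i) (p (i + 1)), q ≠ b → (b - q).arg = θ := fun b hb hqb =>
    arg_sub_eq_of_segment_subset hqb hθ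
      (((convex_segment _ _).segment_subset hqi hb).trans (h.segment_subset hi))
  by_cases hqstart : q = p i
  · exact hcorner i hi.le hqstart
  by_cases hqend : q = p (i + 1)
  · exact hcorner (i + 1) hi hqend
  exact absurd ((hdirection _ (left_mem_segment ℝ _ _) hqstart).trans
    (hdirection _ (right_mem_segment ℝ _ _) hqend).symm)
    (arg_sub_ne_of_mem_openSegment (h.ne_succ hi) hopen)

theorem eventually_mem_iff_end (h : IsPolygonalArc n p e) :
    ∀ᶠ z : ℂ in 𝓝[≠] 0, (p n + z ∈ e ↔ z.arg = (p (n - 1) - p n).arg) := by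
  simpa using h.reverse.eventually_mem_iff_start

end IsPolygonalArc

namespace PlaneMap

variable {M : PlaneMap}

theorem eventually_mem_graph_iff_mem_edge {e : Set ℂ} (he : e ∈ M.E) {q : ℂ} (hq : q ∈ e)
    (hqV : q ∉ M.V) : ∀ᶠ z in 𝓝 q, (z ∈ M.graph ↔ z ∈ e) := by
  filter_upwards [M.eventually_mem_edge q] with z hz
  constructor
  · rintro (hv | ⟨e', he', hze⟩)
    · exact hz.1 hv ▸ hq
    · by_cases hee : e' = e
      · exact hee ▸ hze
      · exact absurd (M.edge_inter e' he' e he hee ⟨hz.2 e' he' hze, hq⟩) hqV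
  · exact fun h => edge_subset_graph he h

section Arc

variable {n : ℕ} {p : ℕ → ℂ} {e : Set ℂ}

theorem edge_inter_vertices (he : e ∈ M.E) (hp : IsPolygonalArc n p e) :
    e ∩ M.V = {p 0, p n} := by
  obtain ⟨m, q, hq, hV⟩ := M.edge_arc e he
  have hstart := hq.eq_start_or_eq_end (hp.corner_mem (Nat.zero_le n))
    (hp.eventually_mem_iff_start.mono fun _ h => h.1)
  have hend := hq.eq_start_or_eq_end (hp.corner_mem le_rfl)
    (hp.eventually_mem_iff_end.mono fun _ h => h.1)
  have hne := hp.corner_ne hp.pos le_rfl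
  rw [hV]
  rcases hstart with h₀ | h₀ <;> rcases hend with h₁ | h₁
  · exact absurd (h₀.trans h₁.symm) hne
  · rw [h₀, h₁]
  · rw [h₀, h₁, pair_comm]
  · exact absurd (h₀.trans h₁.symm) hne

theorem corner_notMem_vertices (he : e ∈ M.E) (hp : IsPolygonalArc n p e) {i : ℕ}
    (hi : i + 1 < n) : p (i + 1) ∉ M.V := by
  intro hvertex
  have hmem : p (i + 1) ∈ e ∩ M.V := ⟨hp.corner_mem hi.le, hvertex⟩
  rw [edge_inter_vertices he hp] at hmem
  rcases hmem with hstart | hend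
  · exact hp.corner_ne (Nat.succ_pos i) hi.le hstart.symm
  · exact hp.corner_ne hi le_rfl hend

theorem openSegment_notMem_vertices (he : e ∈ M.E) (hp : IsPolygonalArc n p e) {i : ℕ}
    (hi : i < n) {z : ℂ} (hz : z ∈ openSegment ℝ (p i) (p (i + 1))) : z ∉ M.V := by
  have hzi := openSegment_subset_segment ℝ _ _ hz
  have hcorner : ∀ j ≤ n, z ≠ p j := by
    rintro j hj rfl
    rcases (hp.corner_mem_segment_iff hi hj).1 hzi with rfl | rfl
    · exact hp.ne_succ hi (left_mem_openSegment_iff.1 hz)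
    · exact hp.ne_succ hi (right_mem_openSegment_iff.1 hz)
  intro hvertex
  have hmem : z ∈ e ∩ M.V := ⟨hp.segment_subset hi hzi, hvertex⟩
  rw [edge_inter_vertices he hp] at hmem
  rcases hmem with hstart | hend
  · exact hcorner 0 (Nat.zero_le _) hstart
  · exact hcorner n le_rfl hend

theorem eventually_mem_segment_of_mem_graph (he : e ∈ M.E) (hp : IsPolygonalArc n p e) {i : ℕ}
    (hi : i < n) : ∀ z ∈ openSegment ℝ (p i) (p (i + 1)),
      ∀ᶠ w in 𝓝 z, w ∈ M.graph → w ∈ segment ℝ (p i) (p (i + 1)) := by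
  intro z hz
  have hze := hp.segment_subset hi (openSegment_subset_segment ℝ _ _ hz)
  filter_upwards [hp.eventually_mem_iff z,
    eventually_mem_graph_iff_mem_edge he hze (openSegment_notMem_vertices he hp hi hz)]
    with w harc hgraph hw
  obtain ⟨k, hk, hzk, hwk⟩ := harc.1 (hgraph.1 hw)
  obtain rfl := hp.eq_of_mem_openSegment hi hk hz hzk
  exact hwk

theorem eventually_arg_mem_of_corner_add_mem_graph (he : e ∈ M.E) (hp : IsPolygonalArc n p e)
    {i : ℕ} (hi : i + 1 < n) : ∀ᶠ z : ℂ in 𝓝[≠] 0, p (i + 1) + z ∈ M.graph →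
      z.arg ∈ ({(p i - p (i + 1)).arg, (p (i + 2) - p (i + 1)).arg} : Set ℝ) := by
  have hgraph := eventually_mem_graph_iff_mem_edge he (hp.corner_mem hi.le)
    (corner_notMem_vertices he hp hi)
  filter_upwards [((tendsto_const_add_nhds_zero (p (i + 1))).eventually hgraph).filter_mono
    nhdsWithin_le_nhds, hp.eventually_mem_iff_corner hi] with z hedge harg hz
  exact harg.1 (hedge.1 hz)

theorem exists_faceCCW_faceCW_corner (he : e ∈ M.E) (hp : IsPolygonalArc n p e) {i : ℕ}
    (hi : i + 1 < n) : ∃ F, M.FaceCCW (p (i + 1)) (p i - p (i + 1)).arg F ∧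
      M.FaceCW (p (i + 1)) (p (i + 2) - p (i + 1)).arg F := by
  have hne := hp.corner_arg_ne hi
  set θ := (p i - p (i + 1)).arg
  set θ' := (p (i + 2) - p (i + 1)).arg
  have hθ : θ ∈ Ioc (-Real.pi) Real.pi := Complex.arg_mem_Ioc _
  have hfull : angularGap θ θ = 2 * Real.pi := by
    rw [angularGap_eq_ite hθ hθ, if_neg (lt_irrefl _)]
    ring
  refine exists_faceCCW_faceCW (eventually_arg_mem_of_corner_add_mem_graph he hp hi) ?_
  rintro ψ (rfl | rfl)
  · exact hfull ▸ (angularGap_mem_Ioc θ θ').2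
  · exact le_rfl

theorem faceRightAt_of_faceCW_faceCCW (he : e ∈ M.E) (hp : IsPolygonalArc n p e) {F F' : Set ℂ}
    (hstart : M.FaceCW (p 0) (p 1 - p 0).arg F)
    (hend : M.FaceCCW (p n) (p (n - 1) - p n).arg F') :
    F = F' ∧ ∀ i < n, M.FaceRightAt (p i) (p (i + 1)) (1 / 2) F := by
  have hcw : ∀ i < n, M.FaceCW (p i) (p (i + 1) - p i).arg F := by
    intro i
    induction i with
    | zero => exact fun _ => hstart
    | succ i ih =>
      intro hi
      obtain ⟨G, hccw, hcw⟩ := exists_faceCCW_faceCW_corner he hp hi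
      have hi' : i < n := by omega
      obtain ⟨rfl, _⟩ := (ih hi').eq_of_faceCCW (hp.ne_succ hi')
        (eventually_mem_segment_of_mem_graph he hp hi') hccw
      exact hcw
  obtain ⟨m, rfl⟩ : ∃ m, n = m + 1 := ⟨n - 1, by have := hp.pos; omega⟩
  rw [Nat.add_sub_cancel] at hend
  have hccw : ∀ i < m + 1, ∃ G, M.FaceCCW (p (i + 1)) (p i - p (i + 1)).arg G := by
    intro i hi
    rcases (Nat.lt_succ_iff.1 hi).lt_or_eq with hlt | rfl
    · obtain ⟨G, hG, _⟩ := exists_faceCCW_faceCW_corner he hp (i := i) (by omega)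
      exact ⟨G, hG⟩
    · exact ⟨F', hend⟩
  have hsegment {i : ℕ} (hi : i < m + 1) {G : Set ℂ}
      (hG : M.FaceCCW (p (i + 1)) (p i - p (i + 1)).arg G) :=
    (hcw i hi).eq_of_faceCCW (hp.ne_succ hi) (eventually_mem_segment_of_mem_graph he hp hi) hG
  refine ⟨(hsegment (Nat.lt_succ_self m) hend).1, fun i hi => ?_⟩
  obtain ⟨G, hG⟩ := hccw i hi
  exact (hsegment hi hG).2

end Arc

attribute [ext] DirEdge

namespace DirEdge

theorem exists_arc (d : M.DirEdge) :
    ∃ n p, IsPolygonalArc n p d.edge ∧ p 0 = d.vertex := by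
  obtain ⟨n, p, hp, hV⟩ := M.edge_arc d.edge d.edge_mem
  have hmem : d.vertex ∈ d.edge ∩ M.V := ⟨d.mem, d.vertex_mem⟩
  rw [hV] at hmem
  rcases hmem with hstart | hend
  · exact ⟨n, p, hp, hstart.symm⟩
  · exact ⟨n, _, hp.reverse, hend.symm⟩

theorem exists_angle (d : M.DirEdge) : ∃ θ ∈ Ioc (-Real.pi) Real.pi,
    ∀ᶠ z : ℂ in 𝓝[≠] 0, (d.vertex + z ∈ d.edge ↔ z.arg = θ) := by
  obtain ⟨n, p, hp, hstart⟩ := d.exists_arc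
  exact ⟨_, Complex.arg_mem_Ioc _, hstart ▸ hp.eventually_mem_iff_start⟩

/-- The direction in `(-π, π]` in which the directed edge `d` leaves its vertex. -/
def angle (d : M.DirEdge) : ℝ := d.exists_angle.choose

theorem angle_mem (d : M.DirEdge) : d.angle ∈ Ioc (-Real.pi) Real.pi :=
  d.exists_angle.choose_spec.1

theorem eventually_mem_iff (d : M.DirEdge) :
    ∀ᶠ z : ℂ in 𝓝[≠] 0, (d.vertex + z ∈ d.edge ↔ z.arg = d.angle) :=
  d.exists_angle.choose_spec.2

theorem arg_eq_angle (d : M.DirEdge) {n : ℕ} {p : ℕ → ℂ} (hp : IsPolygonalArc n p d.edge)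
    (hstart : p 0 = d.vertex) : (p 1 - p 0).arg = d.angle :=
  arg_sub_eq_of_segment_subset (hp.ne_succ hp.pos)
    (hstart ▸ d.eventually_mem_iff.mono fun _ h => h.1) (hp.segment_subset hp.pos)

end DirEdge

theorem finite_dirEdge_at (v : ℂ) : {d : M.DirEdge | d.vertex = v}.Finite := by
  refine Set.Finite.of_finite_image (f := fun d : M.DirEdge => d.edge)
    ((M.locally_finite {v} isCompact_singleton).2.subset ?_) ?_
  · rintro _ ⟨d, rfl, rfl⟩
    exact ⟨d.edge_mem, d.vertex, d.mem, rfl⟩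
  · rintro d rfl d' hd' he
    exact DirEdge.ext (Eq.symm hd') he

variable (M) in
theorem eventually_add_mem_edge (v : ℂ) :
    ∀ᶠ z in 𝓝[≠] 0, v + z ∉ M.V ∧ ∀ e ∈ M.E, v + z ∈ e → v ∈ e := by
  filter_upwards [((tendsto_const_add_nhds_zero v).eventually
    (M.eventually_mem_edge v)).filter_mono nhdsWithin_le_nhds, self_mem_nhdsWithin] with z hz hz0
  exact ⟨fun hv => hz0 (add_eq_left.1 (hz.1 hv)), hz.2⟩

theorem DirEdge.eq_of_angle_eq {d d' : M.DirEdge} (hv : d.vertex = d'.vertex)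
    (hangle : d.angle = d'.angle) : d = d' := by
  by_contra hne
  have hedge : d.edge ≠ d'.edge := fun h => hne (DirEdge.ext hv h)
  have hd' := d'.eventually_mem_iff
  rw [← hv, ← hangle] at hd'
  obtain ⟨z, harg, hmem, hmem', hz, _⟩ := ((frequently_arg_eq d.angle_mem).and_eventually
    (d.eventually_mem_iff.and (hd'.and (M.eventually_add_mem_edge d.vertex)))).exists
  exact hz (M.edge_inter _ d.edge_mem _ d'.edge_mem hedge ⟨hmem.2 harg, hmem'.2 harg⟩)

theorem eventually_arg_mem_of_vertex_add_mem_graph {v : ℂ} (hv : v ∈ M.V) :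
    ∀ᶠ z : ℂ in 𝓝[≠] 0, v + z ∈ M.graph →
      z.arg ∈ DirEdge.angle '' {d : M.DirEdge | d.vertex = v} := by
  have hangles : ∀ᶠ z : ℂ in 𝓝[≠] 0, ∀ d ∈ {d : M.DirEdge | d.vertex = v},
      (v + z ∈ d.edge ↔ z.arg = d.angle) := by
    rw [Filter.eventually_all_finite (finite_dirEdge_at v)]
    rintro d rfl
    exact d.eventually_mem_iff
  filter_upwards [hangles, M.eventually_add_mem_edge v] with z hangle hz
  rintro (hzV | ⟨e, he, hze⟩)
  · exact absurd hzV hz.1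
  · let d : M.DirEdge := ⟨v, e, hv, he, hz.2 e he hze⟩
    exact ⟨d, rfl, ((hangle d rfl).1 hze).symm⟩

theorem angles_subset (v : ℂ) :
    DirEdge.angle '' {d : M.DirEdge | d.vertex = v} ⊆ Ioc (-Real.pi) Real.pi := by
  rintro _ ⟨d, _, rfl⟩
  exact d.angle_mem

theorem DirEdge.exists_faceCW (d : M.DirEdge) : ∃ F, M.FaceCW d.vertex d.angle F :=
  PlaneMap.exists_faceCW (angles_subset _) ((finite_dirEdge_at _).image _)
    (eventually_arg_mem_of_vertex_add_mem_graph d.vertex_mem) ⟨d, rfl, rfl⟩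

theorem DirEdge.exists_faceCCW (d : M.DirEdge) : ∃ F, M.FaceCCW d.vertex d.angle F :=
  PlaneMap.exists_faceCCW ((finite_dirEdge_at _).image _) ⟨d.angle, d, rfl, rfl⟩
    (eventually_arg_mem_of_vertex_add_mem_graph d.vertex_mem) _

theorem DirEdge.exists_rev (d : M.DirEdge) :
    ∃ d', IsReverse d d' ∧ ∀ d'', IsReverse d d'' → d'' = d' := by
  obtain ⟨n, p, hp, hstart⟩ := d.exists_arc
  have hV := edge_inter_vertices d.edge_mem hp
  have hend : p n ∈ d.edge ∩ M.V := hV ▸ Or.inr rfl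
  have hne := hp.corner_ne hp.pos le_rfl
  refine ⟨⟨p n, d.edge, hend.2, d.edge_mem, hend.1⟩, ⟨rfl, hstart ▸ hne⟩, ?_⟩
  rintro d'' ⟨he, hv⟩
  have hmem : d''.vertex ∈ d.edge ∩ M.V := ⟨he ▸ d''.mem, d''.vertex_mem⟩
  rw [hV] at hmem
  rcases hmem with h₀ | h₁
  · exact absurd (h₀.trans hstart).symm hv
  · exact DirEdge.ext h₁ he.symm

/-- The directed edge `d` with its direction reversed. -/
def DirEdge.rev (d : M.DirEdge) : M.DirEdge := d.exists_rev.choose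

theorem DirEdge.isReverse_rev (d : M.DirEdge) : IsReverse d d.rev := d.exists_rev.choose_spec.1

theorem IsReverse.eq_rev {d d' : M.DirEdge} (h : IsReverse d d') : d' = d.rev :=
  d.exists_rev.choose_spec.2 d' h

namespace DirEdge

theorem rev_edge (d : M.DirEdge) : d.rev.edge = d.edge := d.isReverse_rev.1.symm

theorem rev_vertex_ne (d : M.DirEdge) : d.rev.vertex ≠ d.vertex := d.isReverse_rev.2.symm

theorem rev_rev (d : M.DirEdge) : d.rev.rev = d :=
  (IsReverse.eq_rev ⟨d.rev_edge, d.rev_vertex_ne⟩ : d = d.rev.rev).symm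

theorem eq_or_eq_rev {d d' : M.DirEdge} (h : d'.edge = d.edge) : d' = d ∨ d' = d.rev := by
  by_cases hv : d.vertex = d'.vertex
  · exact Or.inl (DirEdge.ext hv.symm h)
  · exact Or.inr (IsReverse.eq_rev ⟨h.symm, hv⟩)

theorem rev_vertex_eq (d : M.DirEdge) {n : ℕ} {p : ℕ → ℂ} (hp : IsPolygonalArc n p d.edge)
    (hstart : p 0 = d.vertex) : d.rev.vertex = p n := by
  have hmem : d.rev.vertex ∈ d.edge ∩ M.V := ⟨d.rev_edge ▸ d.rev.mem, d.rev.vertex_mem⟩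
  rw [edge_inter_vertices d.edge_mem hp] at hmem
  rcases hmem with h₀ | h₁
  · exact absurd (h₀.trans hstart) d.rev_vertex_ne
  · exact h₁

theorem exists_face_right (d : M.DirEdge) : ∃ F, M.FaceCW d.vertex d.angle F ∧
    M.FaceCCW d.rev.vertex d.rev.angle F ∧ ∀ (n : ℕ) (p : ℕ → ℂ), IsPolygonalArc n p d.edge →
      p 0 = d.vertex → ∀ i < n, M.FaceRightAt (p i) (p (i + 1)) (1 / 2) F := by
  obtain ⟨F, hF⟩ := d.exists_faceCW
  obtain ⟨F', hF'⟩ := d.rev.exists_faceCCW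
  have hright : ∀ (n : ℕ) (p : ℕ → ℂ), IsPolygonalArc n p d.edge → p 0 = d.vertex →
      F = F' ∧ ∀ i < n, M.FaceRightAt (p i) (p (i + 1)) (1 / 2) F := by
    intro n p hp hstart
    have hend := d.rev_vertex_eq hp hstart
    have hrev : IsPolygonalArc n (fun i => p (n - i)) d.rev.edge := d.rev_edge ▸ hp.reverse
    have hangle := d.rev.arg_eq_angle hrev (by simpa using hend.symm)
    simp only [Nat.sub_zero] at hangle
    refine faceRightAt_of_faceCW_faceCCW d.edge_mem hp ?_ ?_
    · rwa [d.arg_eq_angle hp hstart, hstart]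
    · rwa [hangle, ← hend]
  obtain ⟨n, p, hp, hstart⟩ := d.exists_arc
  obtain rfl := (hright n p hp hstart).1
  exact ⟨F, hF, hF', fun n p hp hstart => (hright n p hp hstart).2⟩

end DirEdge

theorem midpoint_sub_mul_I (a b : ℂ) (s : ℝ) :
    (a + b) / 2 - (s : ℂ) * (Complex.I * (b - a)) =
      a + (b - a) * (((1 / 2 : ℝ) : ℂ) - s * Complex.I) := by
  push_cast
  ring

theorem onRight_iff_faceCW {d : M.DirEdge} {F : Set ℂ} :
    OnRight d F ↔ M.FaceCW d.vertex d.angle F := by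
  obtain ⟨G, hcw, _, hright⟩ := d.exists_face_right
  constructor
  · rintro ⟨hF, n, p, hp, hstart, i, hi, hmid⟩
    simp only [midpoint_sub_mul_I] at hmid
    rwa [FaceRightAt.unique ⟨hF, hmid⟩ (hright n p hp hstart i hi)]
  · intro h
    obtain ⟨n, p, hp, hstart⟩ := d.exists_arc
    obtain rfl := h.unique hcw
    refine ⟨h.1, n, p, hp, hstart, 0, hp.pos, ?_⟩
    simp only [midpoint_sub_mul_I]
    exact (hright n p hp hstart 0 hp.pos).2

theorem onRight_rev_iff_faceCCW {d : M.DirEdge} {F : Set ℂ} :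
    OnRight d.rev F ↔ M.FaceCCW d.vertex d.angle F := by
  obtain ⟨G, hcw, hccw, _⟩ := d.rev.exists_face_right
  rw [d.rev_rev] at hccw
  rw [onRight_iff_faceCW]
  exact ⟨fun h => h.unique hcw ▸ hccw, fun h => h.unique hccw ▸ hcw⟩

theorem exists_onRight (d : M.DirEdge) : ∃ F, OnRight d F := by
  obtain ⟨F, hF⟩ := d.exists_faceCW
  exact ⟨F, onRight_iff_faceCW.2 hF⟩

/-- The face on the right of a directed edge. -/
def DirEdge.right (d : M.DirEdge) : Set ℂ := (exists_onRight d).choose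

theorem DirEdge.onRight_right (d : M.DirEdge) : OnRight d d.right := (exists_onRight d).choose_spec

theorem onRight_iff {d : M.DirEdge} {F : Set ℂ} : OnRight d F ↔ d.right = F :=
  ⟨fun h => (onRight_iff_faceCW.1 d.onRight_right).unique (onRight_iff_faceCW.1 h),
    fun h => h ▸ d.onRight_right⟩

theorem DirEdge.right_mem_faces (d : M.DirEdge) : d.right ∈ M.faces := d.onRight_right.1

theorem DirEdge.faceRightAt_right (d : M.DirEdge) {n : ℕ} {p : ℕ → ℂ}
    (hp : IsPolygonalArc n p d.edge) (hstart : p 0 = d.vertex) {i : ℕ} (hi : i < n) :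
    M.FaceRightAt (p i) (p (i + 1)) (1 / 2) d.right := by
  obtain ⟨G, hcw, _, hright⟩ := d.exists_face_right
  rw [onRight_iff.1 (onRight_iff_faceCW.2 hcw)]
  exact hright n p hp hstart i hi

theorem DirEdge.exists_rot (d : M.DirEdge) : ∃ d' : M.DirEdge, d'.vertex = d.vertex ∧
    ∀ c : M.DirEdge, c.vertex = d.vertex →
      angularGap d.angle d'.angle ≤ angularGap d.angle c.angle := by
  obtain ⟨_, ⟨d', hd', rfl⟩, hmin⟩ := exists_angularGap_le
    ((finite_dirEdge_at d.vertex).image DirEdge.angle) ⟨d.angle, d, rfl, rfl⟩ d.angle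
  exact ⟨d', hd', fun c hc => hmin _ ⟨c, hc, rfl⟩⟩

/-- The next directed edge, counterclockwise around the vertex. -/
def DirEdge.rot (d : M.DirEdge) : M.DirEdge := d.exists_rot.choose

theorem DirEdge.rot_vertex (d : M.DirEdge) : d.rot.vertex = d.vertex := d.exists_rot.choose_spec.1

theorem DirEdge.angularGap_rot_le (d c : M.DirEdge) (h : c.vertex = d.vertex) :
    angularGap d.angle d.rot.angle ≤ angularGap d.angle c.angle := d.exists_rot.choose_spec.2 c h

theorem DirEdge.right_rot (d : M.DirEdge) : d.rot.right = d.rev.right := by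
  have hmin : ∀ ψ ∈ DirEdge.angle '' {c : M.DirEdge | c.vertex = d.vertex},
      angularGap d.angle d.rot.angle ≤ angularGap d.angle ψ := by
    rintro _ ⟨c, hc, rfl⟩
    exact d.angularGap_rot_le c hc
  obtain ⟨F, hccw, hcw⟩ := exists_faceCCW_faceCW
    (eventually_arg_mem_of_vertex_add_mem_graph d.vertex_mem) hmin
  rw [onRight_iff.1 (onRight_rev_iff_faceCCW.2 hccw), ← onRight_iff, onRight_iff_faceCW,
    d.rot_vertex]
  exact hcw

theorem rot_induction {P : M.DirEdge → Prop} (hrot : ∀ d, P d → P d.rot) {d c : M.DirEdge}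
    (hd : P d) (hv : c.vertex = d.vertex) : P c := by
  by_contra hc
  have hfinite : {a : M.DirEdge | a.vertex = d.vertex ∧ P a}.Finite :=
    (finite_dirEdge_at d.vertex).subset fun _ ha => ha.1
  obtain ⟨a, ⟨hav, ha⟩, hmin⟩ := Set.exists_min_image _ (fun a => angularGap a.angle c.angle)
    hfinite ⟨d, rfl, hd⟩
  have hcloser := hmin a.rot ⟨a.rot_vertex.trans hav, hrot a ha⟩
  have hnext := a.angularGap_rot_le c (hv.trans hav.symm)
  have hne : a.rot.angle ≠ c.angle := fun h =>
    hc (DirEdge.eq_of_angle_eq (a.rot_vertex.trans (hav.trans hv.symm)) h ▸ hrot a ha)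
  rw [angularGap_eq_ite a.rot.angle_mem c.angle_mem, angularGap_eq_ite a.angle_mem c.angle_mem]
    at hcloser
  rw [angularGap_eq_ite a.angle_mem a.rot.angle_mem, angularGap_eq_ite a.angle_mem c.angle_mem]
    at hnext
  obtain ⟨_, har⟩ := a.angle_mem
  obtain ⟨_, hcr⟩ := c.angle_mem
  obtain ⟨hrl, _⟩ := a.rot.angle_mem
  rcases lt_or_gt_of_ne hne with h | h <;> split_ifs at hcloser hnext <;> linarith

theorem dirEdge_induction {P : M.DirEdge → Prop} (hrot : ∀ d, P d → P d.rot)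
    (hrev : ∀ d, P d → P d.rev) {d₀ : M.DirEdge} (h₀ : P d₀) (d : M.DirEdge) : P d := by
  have hpath : ∀ v, Relation.ReflTransGen
      (fun a b : ℂ => a ∈ M.V ∧ b ∈ M.V ∧ ∃ e ∈ M.E, a ∈ e ∧ b ∈ e) d₀.vertex v →
      ∀ c : M.DirEdge, c.vertex = v → P c := by
    intro v hv
    induction hv with
    | refl => exact fun c hc => rot_induction hrot h₀ hc
    | @tail a b _ hab ih =>
      intro c hc
      obtain ⟨ha, hb, e, he, hae, hbe⟩ := hab
      by_cases heq : a = b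
      · exact ih c (hc.trans heq.symm)
      · have hreverse : (⟨b, e, hb, he, hbe⟩ : M.DirEdge) = (⟨a, e, ha, he, hae⟩ : M.DirEdge).rev :=
          IsReverse.eq_rev ⟨rfl, heq⟩
        exact rot_induction hrot (hreverse ▸ hrev _ (ih ⟨a, e, ha, he, hae⟩ rfl)) hc
  exact hpath _ (M.connected _ d₀.vertex_mem _ d.vertex_mem) d rfl

end PlaneMap

/-! ### The logarithm of an arc -/

/-- The integral of `1 / (ζ - z)` along the segment from `a` to `b`, for `z` off the segment. -/
def segLog (a b z : ℂ) : ℂ := Complex.log ((b - z) / (a - z))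

theorem div_sub_mem_slitPlane {a b z : ℂ} (h : z ∉ segment ℝ a b) :
    (b - z) / (a - z) ∈ Complex.slitPlane := by
  have ha : a - z ≠ 0 := sub_ne_zero.2 fun hz => h (hz ▸ left_mem_segment ℝ _ _)
  rw [Complex.mem_slitPlane_iff]
  by_contra! hnot
  obtain ⟨hre, him⟩ := hnot
  obtain ⟨r, hr⟩ : ∃ r, r = -((b - z) / (a - z)).re := ⟨_, rfl⟩
  have hr0 : 0 ≤ r := by linarith
  have hratio : (b - z) / (a - z) = -(r : ℂ) := by
    apply Complex.ext
    · rw [hr]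
      simp
    · simpa using him
  rw [div_eq_iff ha] at hratio
  have hsum : (1 + r : ℝ) ≠ 0 := by positivity
  have hsum' : (1 + (r : ℂ)) ≠ 0 := by exact_mod_cast hsum
  refine h ⟨r / (1 + r), 1 / (1 + r), by positivity, by positivity, by field_simp; ring, ?_⟩
  simp only [Complex.real_smul]
  push_cast
  field_simp
  linear_combination hratio

theorem hasDerivAt_segLog {a b z : ℂ} (h : z ∉ segment ℝ a b) :
    HasDerivAt (segLog a b) (1 / (a - z) - 1 / (b - z)) z := by
  have ha : a - z ≠ 0 := sub_ne_zero.2 fun hz => h (hz ▸ left_mem_segment ℝ _ _)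
  have hb : b - z ≠ 0 := sub_ne_zero.2 fun hz => h (hz ▸ right_mem_segment ℝ _ _)
  have hratio : HasDerivAt (fun z => (b - z) / (a - z))
      ((-1 * (a - z) - (b - z) * -1) / (a - z) ^ 2) z :=
    ((hasDerivAt_id z).const_sub b).div ((hasDerivAt_id z).const_sub a) ha
  refine (hratio.clog (div_sub_mem_slitPlane h)).congr_deriv ?_
  field_simp
  ring

theorem tendsto_segLog_cobounded (a b : ℂ) :
    Tendsto (segLog a b) (Bornology.cobounded ℂ) (𝓝 0) := by
  have hratio : Tendsto (fun z : ℂ => (b - z) / (a - z)) (Bornology.cobounded ℂ) (𝓝 1) := by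
    have hsub : Tendsto (fun z : ℂ => a - z) (Bornology.cobounded ℂ) (Bornology.cobounded ℂ) := by
      simp
    have hlim := ((tendsto_inv₀_cobounded.comp hsub).const_mul (b - a)).const_add 1
    rw [mul_zero, add_zero] at hlim
    refine hlim.congr' ?_
    filter_upwards [Bornology.eventually_ne_cobounded a] with z hz
    have haz : a - z ≠ 0 := sub_ne_zero.2 hz.symm
    simp only [Function.comp_apply]
    field_simp
    ring
  have hlog := (continuousAt_clog Complex.one_mem_slitPlane).tendsto.comp hratio
  rwa [Complex.log_one] at hlog

theorem segLog_add_mul {a b : ℂ} (hab : a ≠ b) (c : ℂ) :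
    segLog a b (a + (b - a) * c) = Complex.log ((1 - c) / -c) := by
  have hsub : b - a ≠ 0 := sub_ne_zero.2 hab.symm
  rw [segLog, show b - (a + (b - a) * c) = (b - a) * (1 - c) by ring,
    show a - (a + (b - a) * c) = (b - a) * -c by ring, mul_div_mul_left _ _ hsub]

/-- The ratio `(b - z) / (a - z)` for `z` just to the right of the midpoint of `[a, b]`. -/
def rightRatio (s : ℝ) : ℂ := (1 / 2 + s * Complex.I) / (-(1 / 2) + s * Complex.I)

theorem neg_half_add_mul_I_ne_zero (s : ℝ) : (-(1 / 2) + s * Complex.I : ℂ) ≠ 0 := fun h => by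
  have hre := congrArg Complex.re h
  norm_num at hre

theorem rightRatio_im_neg {s : ℝ} (hs : 0 < s) : (rightRatio s).im < 0 := by
  have hpos : 0 < Complex.normSq (-(1 / 2) + s * Complex.I) :=
    Complex.normSq_pos.2 (neg_half_add_mul_I_ne_zero s)
  have him : (rightRatio s).im = -(s / Complex.normSq (-(1 / 2) + s * Complex.I)) := by
    rw [rightRatio, Complex.div_im]
    simp
    ring
  rw [him]
  exact neg_lt_zero.2 (div_pos hs hpos)

theorem tendsto_arg_rightRatio :
    Tendsto (fun s => (rightRatio s).arg) (𝓝[>] 0) (𝓝 (-Real.pi)) := by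
  have hcont : Continuous rightRatio :=
    Continuous.div (by fun_prop) (by fun_prop) neg_half_add_mul_I_ne_zero
  have hlim : Tendsto rightRatio (𝓝[>] 0) (𝓝[{z : ℂ | z.im < 0}] (-1)) := by
    refine tendsto_nhdsWithin_iff.2
      ⟨(hcont.tendsto' 0 (-1) (by simp [rightRatio])).mono_left nhdsWithin_le_nhds, ?_⟩
    filter_upwards [self_mem_nhdsWithin] with s hs
    exact rightRatio_im_neg hs
  exact (Complex.tendsto_arg_nhdsWithin_im_neg_of_re_neg_of_im_zero (by simp) (by simp)).comp hlim

theorem tendsto_segLog_jump {a b : ℂ} (hab : a ≠ b) :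
    Tendsto (fun s : ℝ => segLog a b (a + (b - a) * (((1 / 2 : ℝ) : ℂ) + s * Complex.I)) -
      segLog a b (a + (b - a) * (((1 / 2 : ℝ) : ℂ) - s * Complex.I))) (𝓝[>] 0)
      (𝓝 (2 * Real.pi * Complex.I)) := by
  have hright (s : ℝ) : segLog a b (a + (b - a) * (((1 / 2 : ℝ) : ℂ) - s * Complex.I)) =
      Complex.log (rightRatio s) := by
    rw [segLog_add_mul hab, rightRatio]
    congr 2 <;> push_cast <;> ring
  have hleft (s : ℝ) : segLog a b (a + (b - a) * (((1 / 2 : ℝ) : ℂ) + s * Complex.I)) =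
      Complex.log (starRingEnd ℂ (rightRatio s)) := by
    rw [segLog_add_mul hab, rightRatio]
    simp only [map_div₀, map_add, map_mul, map_neg, map_one, map_ofNat, Complex.conj_ofReal,
      Complex.conj_I]
    congr 2 <;> push_cast <;> ring
  have hlim := ((Complex.continuous_ofReal.tendsto _).comp tendsto_arg_rightRatio).const_mul
    (-2 * Complex.I)
  rw [show -2 * Complex.I * ((-Real.pi : ℝ) : ℂ) = 2 * Real.pi * Complex.I by push_cast; ring]
    at hlim
  refine hlim.congr' ?_
  filter_upwards [self_mem_nhdsWithin] with s hs
  have harg : (rightRatio s).arg ≠ Real.pi := fun h =>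
    (rightRatio_im_neg hs).ne (Complex.arg_eq_pi_iff.1 h).2
  rw [hright, hleft, Complex.log_conj _ harg, ← neg_sub, Complex.sub_conj, Complex.log_im,
    Function.comp_apply]
  push_cast
  ring

/-- The integral of `1 / (ζ - z)` along the polygonal arc with corners `p 0, …, p n`. -/
def arcLog (n : ℕ) (p : ℕ → ℂ) (z : ℂ) : ℂ :=
  ∑ i ∈ Finset.range n, segLog (p i) (p (i + 1)) z

theorem tendsto_arcLog_cobounded (n : ℕ) (p : ℕ → ℂ) :
    Tendsto (arcLog n p) (Bornology.cobounded ℂ) (𝓝 0) := by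
  have hsum := tendsto_finsetSum (Finset.range n) fun i _ =>
    tendsto_segLog_cobounded (p i) (p (i + 1))
  rw [Finset.sum_const_zero] at hsum
  exact hsum

namespace IsPolygonalArc

variable {n : ℕ} {p : ℕ → ℂ} {e : Set ℂ}

theorem hasDerivAt_arcLog (h : IsPolygonalArc n p e) {z : ℂ} (hz : z ∉ e) :
    HasDerivAt (arcLog n p) (1 / (p 0 - z) - 1 / (p n - z)) z := by
  rw [← Finset.sum_range_sub' (fun i => 1 / (p i - z)) n]
  exact HasDerivAt.fun_sum fun i hi =>
    hasDerivAt_segLog fun hzi => hz (h.segment_subset (Finset.mem_range.1 hi) hzi)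

theorem tendsto_arcLog_jump (h : IsPolygonalArc n p e) :
    Tendsto (fun s : ℝ => arcLog n p (p 0 + (p 1 - p 0) * (((1 / 2 : ℝ) : ℂ) + s * Complex.I)) -
      arcLog n p (p 0 + (p 1 - p 0) * (((1 / 2 : ℝ) : ℂ) - s * Complex.I))) (𝓝[>] 0)
      (𝓝 (2 * Real.pi * Complex.I)) := by
  have hmid : p 0 + (p 1 - p 0) * ((1 / 2 : ℝ) : ℂ) ∈ openSegment ℝ (p 0) (p (0 + 1)) := by
    rw [openSegment_eq_image']
    exact ⟨1 / 2, by norm_num, by simp [mul_comm]⟩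
  have hsegment : ∀ i ∈ Finset.range n, Tendsto (fun s : ℝ =>
      segLog (p i) (p (i + 1)) (p 0 + (p 1 - p 0) * (((1 / 2 : ℝ) : ℂ) + s * Complex.I)) -
      segLog (p i) (p (i + 1)) (p 0 + (p 1 - p 0) * (((1 / 2 : ℝ) : ℂ) - s * Complex.I)))
      (𝓝[>] 0) (𝓝 (if i = 0 then 2 * Real.pi * Complex.I else 0)) := by
    intro i hi
    rw [Finset.mem_range] at hi
    split_ifs with hi0
    · subst hi0
      exact tendsto_segLog_jump (h.ne_succ h.pos)
    · have hoff : p 0 + (p 1 - p 0) * ((1 / 2 : ℝ) : ℂ) ∉ segment ℝ (p i) (p (i + 1)) :=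
        fun hmem => hi0 (h.eq_of_mem_openSegment h.pos hi hmid hmem)
      have hlog := (hasDerivAt_segLog hoff).continuousAt.tendsto
      have hleft : Continuous fun s : ℝ =>
          p 0 + (p 1 - p 0) * (((1 / 2 : ℝ) : ℂ) + s * Complex.I) := by fun_prop
      have hright : Continuous fun s : ℝ =>
          p 0 + (p 1 - p 0) * (((1 / 2 : ℝ) : ℂ) - s * Complex.I) := by fun_prop
      have hdiff := ((hlog.comp (hleft.tendsto' 0 _ (by simp))).sub
        (hlog.comp (hright.tendsto' 0 _ (by simp)))).mono_left (nhdsWithin_le_nhds (s := Ioi 0))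
      rwa [sub_self] at hdiff
  have hsum := tendsto_finsetSum _ hsegment
  simp only [Finset.sum_sub_distrib] at hsum
  rw [Finset.sum_ite_eq' (Finset.range n) 0, if_pos (Finset.mem_range.2 h.pos)] at hsum
  exact hsum

end IsPolygonalArc

/-! ### Potentials and summation by parts -/

theorem exists_potential {ι X : Type*} (s t : ι → X) (w : ι → ℝ)
    (h : ∀ c : ι →₀ ℝ, Finsupp.linearCombination ℝ
      (fun i => Finsupp.single (s i) (1 : ℝ) - Finsupp.single (t i) 1) c = 0 →
      c.sum (fun i a => a * w i) = 0) :
    ∃ f : X → ℝ, ∀ i, f (s i) - f (t i) = w i := by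
  set boundary := Finsupp.linearCombination ℝ
    (fun i => Finsupp.single (s i) (1 : ℝ) - Finsupp.single (t i) 1) with hboundary
  have hrange : Finsupp.linearCombination ℝ w ∈ LinearMap.range boundary.dualMap := by
    rw [LinearMap.range_dualMap_eq_dualAnnihilator_ker, Submodule.mem_dualAnnihilator]
    intro c hc
    rw [Finsupp.linearCombination_apply]
    exact h c hc
  obtain ⟨φ, hφ⟩ := hrange
  refine ⟨fun x => φ (Finsupp.single x 1), fun i => ?_⟩
  have hi := LinearMap.congr_fun hφ (Finsupp.single i 1)
  rwa [LinearMap.dualMap_apply, hboundary, Finsupp.linearCombination_single,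
    Finsupp.linearCombination_single, one_smul, one_smul, map_sub] at hi

open Classical in
theorem sum_smul_comp_eq_zero {ι X A : Type*} [AddCommGroup A] [Module ℝ A] (D : Finset ι)
    (w : ι → ℝ) (π : ι → X) (k : X → A)
    (hfiber : ∀ i₀, k (π i₀) ≠ 0 → (∀ i, π i = π i₀ → i ∈ D) ∧
      ∑ᶠ i ∈ {i | π i = π i₀}, w i = 0) :
    ∑ i ∈ D, w i • k (π i) = 0 := by
  rw [← Finset.sum_fiberwise_of_maps_to (t := D.image π)
    fun i hi => Finset.mem_image_of_mem π hi]
  refine Finset.sum_eq_zero fun x hx => ?_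
  obtain ⟨i₀, -, rfl⟩ := Finset.mem_image.1 hx
  have hconst : ∑ i ∈ D with π i = π i₀, w i • k (π i) =
      (∑ i ∈ D with π i = π i₀, w i) • k (π i₀) := by
    rw [Finset.sum_smul]
    refine Finset.sum_congr rfl fun i hi => ?_
    rw [(Finset.mem_filter.1 hi).2]
  rw [hconst]
  by_cases hzero : k (π i₀) = 0
  · rw [hzero, smul_zero]
  · obtain ⟨hsub, hsum⟩ := hfiber i₀ hzero
    have hcoe : {i | π i = π i₀} = ((D.filter fun i => π i = π i₀ : Finset ι) : Set ι) := by
      ext i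
      simp only [mem_ofPred_eq, Finset.coe_filter]
      exact ⟨fun hi => ⟨hsub i hi, hi⟩, fun hi => hi.2⟩
    rw [hcoe, finsum_mem_coe_finset] at hsum
    rw [hsum, zero_smul]

namespace PlaneMap

variable {M : PlaneMap}

/-! ### The logarithm of an edge -/

theorem exists_orient (e : M.E) : ∃ (d : M.DirEdge) (n : ℕ) (p : ℕ → ℂ), d.edge = e ∧
    IsPolygonalArc n p d.edge ∧ p 0 = d.vertex ∧ p n = d.rev.vertex := by
  obtain ⟨n, p, hp, hV⟩ := M.edge_arc e e.2
  have hstart : p 0 ∈ (e : Set ℂ) ∩ M.V := hV ▸ Or.inl rfl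
  let d : M.DirEdge := ⟨p 0, e, hstart.2, e.2, hstart.1⟩
  exact ⟨d, n, p, rfl, hp, rfl, (d.rev_vertex_eq hp rfl).symm⟩

/-- A choice of a direction of the edge `e`. -/
def orient (e : M.E) : M.DirEdge := (exists_orient e).choose

/-- The number of segments of the edge `e`. -/
def arcLength (e : M.E) : ℕ := (exists_orient e).choose_spec.choose

/-- The corners of the edge `e`, in the order given by `orient e`. -/
def arcCorner (e : M.E) : ℕ → ℂ := (exists_orient e).choose_spec.choose_spec.choose

theorem orient_edge (e : M.E) : (orient e).edge = e :=
  (exists_orient e).choose_spec.choose_spec.choose_spec.1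

theorem isPolygonalArc_orient (e : M.E) :
    IsPolygonalArc (arcLength e) (arcCorner e) (orient e).edge :=
  (exists_orient e).choose_spec.choose_spec.choose_spec.2.1

theorem arcCorner_zero (e : M.E) : arcCorner e 0 = (orient e).vertex :=
  (exists_orient e).choose_spec.choose_spec.choose_spec.2.2.1

theorem arcCorner_arcLength (e : M.E) : arcCorner e (arcLength e) = (orient e).rev.vertex :=
  (exists_orient e).choose_spec.choose_spec.choose_spec.2.2.2

/-- The edge underlying a directed edge, as an element of the subtype `M.E`. -/
def DirEdge.toEdge (d : M.DirEdge) : M.E := ⟨d.edge, d.edge_mem⟩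

theorem toEdge_orient (e : M.E) : (orient e).toEdge = e := Subtype.ext (orient_edge e)

theorem DirEdge.toEdge_rev (d : M.DirEdge) : d.rev.toEdge = d.toEdge := Subtype.ext d.rev_edge

theorem DirEdge.eq_orient_or_eq_rev_orient (d : M.DirEdge) :
    d = orient d.toEdge ∨ d = (orient d.toEdge).rev :=
  DirEdge.eq_or_eq_rev (orient_edge d.toEdge).symm

/-- The logarithm of the arc of the edge `e`: a holomorphic function off `e` whose values on the
two sides of `e` differ by `2πi`. -/
def edgeLog (e : M.E) : ℂ → ℂ := arcLog (arcLength e) (arcCorner e)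

theorem hasDerivAt_edgeLog (e : M.E) {z : ℂ} (hz : z ∉ (e : Set ℂ)) : HasDerivAt (edgeLog e)
    (1 / ((orient e).vertex - z) - 1 / ((orient e).rev.vertex - z)) z := by
  rw [← arcCorner_zero, ← arcCorner_arcLength]
  exact (isPolygonalArc_orient e).hasDerivAt_arcLog (by rwa [orient_edge])

/-- The points `edgeNormal e 0` and `edgeNormal e s`, for `0 < s`, are the midpoint of the first
segment of `orient e` and a point on the left of it. -/
def edgeNormal (e : M.E) (s : ℝ) : ℂ :=
  arcCorner e 0 + (arcCorner e 1 - arcCorner e 0) * (((1 / 2 : ℝ) : ℂ) + s * Complex.I)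

theorem tendsto_edgeNormal (e : M.E) : Tendsto (edgeNormal e) (𝓝[>] 0) (𝓝 (edgeNormal e 0)) := by
  have hcont : Continuous (edgeNormal e) := by
    unfold edgeNormal
    fun_prop
  exact hcont.continuousAt.tendsto.mono_left nhdsWithin_le_nhds

theorem tendsto_edgeNormal_neg (e : M.E) :
    Tendsto (fun s => edgeNormal e (-s)) (𝓝[>] 0) (𝓝 (edgeNormal e 0)) := by
  have hcont : Continuous fun s => edgeNormal e (-s) := by
    unfold edgeNormal
    fun_prop
  exact (hcont.tendsto' 0 _ (by rw [neg_zero])).mono_left nhdsWithin_le_nhds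

theorem edgeNormal_zero_mem_openSegment (e : M.E) :
    edgeNormal e 0 ∈ openSegment ℝ (arcCorner e 0) (arcCorner e (0 + 1)) := by
  rw [openSegment_eq_image']
  exact ⟨1 / 2, by norm_num, by simp [edgeNormal, mul_comm]⟩

theorem edgeNormal_zero_mem (e : M.E) : edgeNormal e 0 ∈ (e : Set ℂ) := by
  have hp := isPolygonalArc_orient e
  rw [← orient_edge e]
  exact hp.segment_subset hp.pos
    (openSegment_subset_segment ℝ _ _ (edgeNormal_zero_mem_openSegment e))

theorem edgeNormal_zero_notMem_of_ne {e e₀ : M.E} (he : e ≠ e₀) :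
    edgeNormal e₀ 0 ∉ (e : Set ℂ) := fun h =>
  openSegment_notMem_vertices (orient e₀).edge_mem (isPolygonalArc_orient e₀)
    (isPolygonalArc_orient e₀).pos (edgeNormal_zero_mem_openSegment e₀)
    (M.edge_inter e e.2 e₀ e₀.2 (fun h => he (Subtype.ext h)) ⟨h, edgeNormal_zero_mem e₀⟩)

theorem eventually_edgeNormal_neg_mem_right (e : M.E) :
    ∀ᶠ s : ℝ in 𝓝[>] 0, edgeNormal e (-s) ∈ (orient e).right := by
  filter_upwards [((orient e).faceRightAt_right (isPolygonalArc_orient e) (arcCorner_zero e)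
    (isPolygonalArc_orient e).pos).2] with s hs
  rwa [edgeNormal, Complex.ofReal_neg, neg_mul, ← sub_eq_add_neg]

theorem eventually_edgeNormal_mem_right_rev (e : M.E) :
    ∀ᶠ s : ℝ in 𝓝[>] 0, edgeNormal e s ∈ (orient e).rev.right := by
  have hp := isPolygonalArc_orient e
  have hpos := hp.pos
  have hrev : IsPolygonalArc (arcLength e) (fun i => arcCorner e (arcLength e - i))
      (orient e).rev.edge := (orient e).rev_edge ▸ hp.reverse
  have hright := ((orient e).rev.faceRightAt_right hrev (by simpa using arcCorner_arcLength e)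
    (i := arcLength e - 1) (by omega)).2
  filter_upwards [hright] with s hs
  rw [show arcLength e - (arcLength e - 1) = 1 by omega,
    show arcLength e - (arcLength e - 1 + 1) = 0 by omega] at hs
  convert hs using 1
  rw [edgeNormal]
  push_cast
  ring

theorem tendsto_edgeLog_jump (e : M.E) :
    Tendsto (fun s => edgeLog e (edgeNormal e s) - edgeLog e (edgeNormal e (-s))) (𝓝[>] 0)
      (𝓝 (2 * Real.pi * Complex.I)) := by
  refine (isPolygonalArc_orient e).tendsto_arcLog_jump.congr fun s => ?_
  simp only [edgeNormal, edgeLog, Complex.ofReal_neg, neg_mul, sub_eq_add_neg]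

theorem tendsto_edgeNormal_sub_of_continuousAt {g : ℂ → ℂ} {e : M.E}
    (hg : ContinuousAt g (edgeNormal e 0)) :
    Tendsto (fun s => g (edgeNormal e s) - g (edgeNormal e (-s))) (𝓝[>] 0) (𝓝 0) := by
  have hdiff := (hg.tendsto.comp (tendsto_edgeNormal e)).sub
    (hg.tendsto.comp (tendsto_edgeNormal_neg e))
  rwa [sub_self] at hdiff

theorem left_sub_right_of_sum_edgeLog_eq (S : Finset M.E) (c : M.E → ℝ) (g : ℂ → ℂ) (e₀ : M.E)
    (hg : ContinuousAt g (edgeNormal e₀ 0)) {right left : ℂ}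
    (hright : ∀ z ∈ (orient e₀).right, ∑ e ∈ S, (c e : ℂ) * edgeLog e z + g z = right)
    (hleft : ∀ z ∈ (orient e₀).rev.right, ∑ e ∈ S, (c e : ℂ) * edgeLog e z + g z = left) :
    left - right = if e₀ ∈ S then (c e₀ : ℂ) * (2 * Real.pi * Complex.I) else 0 := by
  have hedge : ∀ e ∈ S, Tendsto (fun s =>
      (c e : ℂ) * (edgeLog e (edgeNormal e₀ s) - edgeLog e (edgeNormal e₀ (-s)))) (𝓝[>] 0)
      (𝓝 (if e = e₀ then (c e₀ : ℂ) * (2 * Real.pi * Complex.I) else 0)) := by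
    intro e _
    split_ifs with he
    · subst he
      exact (tendsto_edgeLog_jump e).const_mul _
    · rw [← mul_zero (c e : ℂ)]
      exact (tendsto_edgeNormal_sub_of_continuousAt
        (hasDerivAt_edgeLog e (edgeNormal_zero_notMem_of_ne he)).continuousAt).const_mul _
  have hjump := (tendsto_finsetSum S hedge).add (tendsto_edgeNormal_sub_of_continuousAt hg)
  rw [add_zero, Finset.sum_ite_eq'] at hjump
  refine tendsto_nhds_unique (Tendsto.congr' ?_ tendsto_const_nhds) hjump
  filter_upwards [eventually_edgeNormal_neg_mem_right e₀,
    eventually_edgeNormal_mem_right_rev e₀] with s hsR hsL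
  rw [← hright _ hsR, ← hleft _ hsL]
  simp only [mul_sub, Finset.sum_sub_distrib]
  ring

/-! ### Sums over directed edges -/

theorem edge_inter_closure_right (d : M.DirEdge) : (d.edge ∩ closure d.right).Nonempty := by
  refine ⟨edgeNormal d.toEdge 0, edgeNormal_zero_mem d.toEdge, ?_⟩
  generalize he : d.toEdge = e
  rcases he ▸ d.eq_orient_or_eq_rev_orient with hd | hd
  · rw [hd]
    exact mem_closure_of_tendsto (tendsto_edgeNormal_neg e) (eventually_edgeNormal_neg_mem_right e)
  · rw [hd]
    exact mem_closure_of_tendsto (tendsto_edgeNormal e) (eventually_edgeNormal_mem_right_rev e)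

theorem finite_dirEdge_of_edge {S : Set (Set ℂ)} (hS : S.Finite) :
    {d : M.DirEdge | d.edge ∈ S}.Finite := by
  refine hS.preimage' fun e _ => ?_
  rcases (DirEdge.edge ⁻¹' {e} : Set M.DirEdge).eq_empty_or_nonempty with h | ⟨d, rfl⟩
  · rw [h]
    exact Set.finite_empty
  · exact (Set.toFinite {d, d.rev}).subset fun d' hd' => DirEdge.eq_or_eq_rev hd'

theorem finite_dirEdge_right {F : Set ℂ} (hF : F ∈ M.faces) :
    {d : M.DirEdge | d.right = F}.Finite := by
  refine (finite_dirEdge_of_edge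
    (M.locally_finite _ (M.face_bounded F hF).isCompact_closure).2).subset ?_
  rintro d rfl
  exact ⟨d.edge_mem, edge_inter_closure_right d⟩

theorem setOf_onRight (F : Set ℂ) : {d : M.DirEdge | OnRight d F} = {d | d.right = F} :=
  Set.ext fun _ => onRight_iff

theorem DirEdge.rev_ne (d : M.DirEdge) : d.rev ≠ d := fun h =>
  d.rev_vertex_ne (congrArg DirEdge.vertex h)

theorem IsHarmonic.rev {w : M.DirEdge → ℝ} (hw : IsHarmonic w) (d : M.DirEdge) :
    w d.rev = -w d := by
  have hsum := hw.2.1 d.edge d.edge_mem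
  have hpair : {d' : M.DirEdge | d'.edge = d.edge} = {d, d.rev} := by
    ext d'
    constructor
    · exact fun h => DirEdge.eq_or_eq_rev h
    · rintro (rfl | rfl)
      · rfl
      · exact d.rev_edge
  rw [hpair, finsum_mem_pair d.rev_ne.symm] at hsum
  linarith

open Classical in
/-- The directed edges whose underlying edge is in `S`. -/
def dirEdgesOf (S : Finset M.E) : Finset M.DirEdge :=
  S.biUnion fun e => {orient e, (orient e).rev}

theorem mem_dirEdgesOf {S : Finset M.E} {d : M.DirEdge} : d ∈ dirEdgesOf S ↔ d.toEdge ∈ S := by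
  simp only [dirEdgesOf, Finset.mem_biUnion, Finset.mem_insert, Finset.mem_singleton]
  constructor
  · rintro ⟨e, he, rfl | rfl⟩
    · rwa [toEdge_orient]
    · rwa [DirEdge.toEdge_rev, toEdge_orient]
  · exact fun h => ⟨_, h, d.eq_orient_or_eq_rev_orient⟩

theorem sum_dirEdgesOf {A : Type*} [AddCommMonoid A] (S : Finset M.E) (f : M.DirEdge → A) :
    ∑ d ∈ dirEdgesOf S, f d = ∑ e ∈ S, (f (orient e) + f (orient e).rev) := by
  classical
  rw [dirEdgesOf, Finset.sum_biUnion]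
  · exact Finset.sum_congr rfl fun e _ => Finset.sum_pair (orient e).rev_ne.symm
  · intro e _ e' _ hne
    have htoEdge {e : M.E} {d : M.DirEdge} (h : d ∈ ({orient e, (orient e).rev} : Finset _)) :
        d.toEdge = e := by
      rcases Finset.mem_insert.1 h with rfl | h
      · exact toEdge_orient e
      · rw [Finset.mem_singleton.1 h, DirEdge.toEdge_rev, toEdge_orient]
    exact Finset.disjoint_left.2 fun d hd hd' => hne ((htoEdge hd).symm.trans (htoEdge hd'))

theorem sum_coboundary_eq_zero {A X : Type*} [AddCommGroup A] [Module ℝ A] (S : Finset M.E)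
    {w : M.DirEdge → ℝ} (hw : ∀ d, w d.rev = -w d) (π : M.DirEdge → X) (k : X → A)
    (hk : ∀ d₀, k (π d₀) ≠ 0 → (∀ d, π d = π d₀ → d.toEdge ∈ S) ∧
      ∑ᶠ d ∈ {d | π d = π d₀}, w d = 0) :
    ∑ e ∈ S, w (orient e) • (k (π (orient e)) - k (π (orient e).rev)) = 0 := by
  have hzero := sum_smul_comp_eq_zero (dirEdgesOf S) w π k fun d₀ h =>
    ⟨fun d hd => mem_dirEdgesOf.2 ((hk d₀ h).1 d hd), (hk d₀ h).2⟩
  rw [sum_dirEdgesOf] at hzero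
  rw [← hzero]
  refine Finset.sum_congr rfl fun e _ => ?_
  rw [hw, smul_sub, neg_smul, sub_eq_add_neg]

end PlaneMap

/-! ### Existence of the tiling -/

theorem eq_zero_of_hasDerivAt_zero_of_tendsto_cobounded {N : ℂ → ℂ} {R : ℝ} (hR : 0 ≤ R)
    (hN : ∀ z, R < ‖z‖ → HasDerivAt N 0 z) (hlim : Tendsto N (Bornology.cobounded ℂ) (𝓝 0))
    {z : ℂ} (hz : R < ‖z‖) : N z = 0 := by
  have hray (t : ℝ) (ht : 1 ≤ t) : HasDerivAt (fun t : ℝ => N (t * z)) 0 t := by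
    have hfar : R < ‖(t : ℂ) * z‖ := by
      rw [norm_mul, Complex.norm_real, Real.norm_eq_abs, abs_of_pos (by linarith)]
      nlinarith
    have hcomp := (hN _ hfar).comp t ((Complex.ofRealCLM.hasDerivAt (x := t)).mul_const z)
    rwa [zero_mul] at hcomp
  have hconst (t : ℝ) (ht : 1 ≤ t) : N (t * z) = N z := by
    have h := constant_of_has_deriv_right_zero (f := fun t : ℝ => N (t * z)) (a := 1) (b := t)
      (fun s hs => (hray s hs.1).continuousAt.continuousWithinAt)
      (fun s hs => (hray s hs.1).hasDerivWithinAt) t ⟨ht, le_rfl⟩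
    rwa [Complex.ofReal_one, one_mul] at h
  have hescape : Tendsto (fun t : ℝ => (t : ℂ) * z) atTop (Bornology.cobounded ℂ) := by
    rw [← tendsto_norm_atTop_iff_cobounded]
    refine (tendsto_id.atTop_mul_const (hR.trans_lt hz)).congr' ?_
    filter_upwards [eventually_ge_atTop 0] with t ht
    rw [norm_mul, Complex.norm_real, Real.norm_eq_abs, abs_of_nonneg ht, id]
  refine tendsto_nhds_unique (Tendsto.congr' ?_ tendsto_const_nhds) (hlim.comp hescape)
  filter_upwards [eventually_ge_atTop 1] with t ht
  exact (hconst t ht).symm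

theorem sum_smul_sub_eq_zero_of_linearCombination_eq_zero {ι X A : Type*} [AddCommGroup A]
    [Module ℝ A] (s t : ι → X) (k : X → A) {c : ι →₀ ℝ} (h : Finsupp.linearCombination ℝ
      (fun i => Finsupp.single (s i) (1 : ℝ) - Finsupp.single (t i) 1) c = 0) :
    ∑ i ∈ c.support, c i • (k (s i) - k (t i)) = 0 := by
  have hmap := congrArg (Finsupp.linearCombination ℝ k) h
  rw [map_zero, Finsupp.linearCombination_apply ℝ c, Finsupp.sum, map_sum] at hmap
  rw [← hmap]
  refine Finset.sum_congr rfl fun i _ => ?_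
  rw [map_smul, map_sub, Finsupp.linearCombination_single, Finsupp.linearCombination_single,
    one_smul, one_smul]

open Classical in
/-- The value on the set `F`, divided by `2πi`, of a function that is constant on `F` (and `0` if
`F` is empty). -/
def faceValue (N : ℂ → ℂ) (F : Set ℂ) : ℝ :=
  if h : F.Nonempty then (N h.some).im / (2 * Real.pi) else 0

theorem faceValue_eq {N : ℂ → ℂ} {F : Set ℂ} {z : ℂ} (hz : z ∈ F) {k : ℂ}
    (hk : ∀ z ∈ F, N z = k) : faceValue N F = k.im / (2 * Real.pi) := by
  rw [faceValue, dif_pos ⟨z, hz⟩, hk _ (Set.Nonempty.some_mem ⟨z, hz⟩)]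

/-- A primitive of `- 1 / (v - z)` in the disc of radius `R`, if `v` lies outside. -/
def outerLog (R : ℝ) (v z : ℂ) : ℂ := if ‖v‖ < R then 0 else Complex.log (1 - z / v)

theorem hasDerivAt_outerLog {R : ℝ} (v : ℂ) {z : ℂ} (hz : ‖z‖ < R) :
    HasDerivAt (outerLog R v) (if ‖v‖ < R then 0 else -(1 / (v - z))) z := by
  unfold outerLog
  split_ifs with h
  · exact hasDerivAt_const z 0
  · have hlt : ‖z‖ < ‖v‖ := by linarith
    have hnorm : 0 < ‖v‖ := (norm_nonneg z).trans_lt hlt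
    have hv : v ≠ 0 := norm_pos_iff.1 hnorm
    have hslit : 1 - z / v ∈ Complex.slitPlane := by
      rw [sub_eq_add_neg]
      apply Complex.mem_slitPlane_of_norm_lt_one
      rwa [norm_neg, norm_div, div_lt_one hnorm]
    have hlog := (((hasDerivAt_id z).div_const v).const_sub 1).clog hslit
    refine hlog.congr_deriv ?_
    have hvz : v - z ≠ 0 := sub_ne_zero.2 fun h => hlt.ne (congrArg norm h).symm
    rw [id_eq]
    field_simp

namespace PlaneMap

variable {M : PlaneMap}

theorem exists_eq_of_hasDerivAt_zero {N : ℂ → ℂ} {F : Set ℂ} (hF : F ∈ M.faces)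
    (hN : ∀ z ∈ F, HasDerivAt N 0 z) : ∃ k, ∀ z ∈ F, N z = k := by
  obtain ⟨z₀, hz₀⟩ := face_nonempty hF
  exact ⟨N z₀, fun z hz => (isOpen_face hF).is_const_of_deriv_eq_zero (isPreconnected_face hF)
    (fun x hx => (hN x hx).differentiableAt.differentiableWithinAt) (fun x hx => (hN x hx).deriv)
    hz hz₀⟩

theorem faceValue_rev_sub_faceValue (S : Finset M.E) (c : M.E → ℝ) (g : ℂ → ℂ) (e : M.E)
    (he : c e ≠ 0 → e ∈ S) (hg : ContinuousAt g (edgeNormal e 0))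
    (hright : ∀ z ∈ (orient e).right,
      HasDerivAt (fun z => ∑ e ∈ S, (c e : ℂ) * edgeLog e z + g z) 0 z)
    (hleft : ∀ z ∈ (orient e).rev.right,
      HasDerivAt (fun z => ∑ e ∈ S, (c e : ℂ) * edgeLog e z + g z) 0 z) :
    faceValue (fun z => ∑ e ∈ S, (c e : ℂ) * edgeLog e z + g z) (orient e).rev.right -
      faceValue (fun z => ∑ e ∈ S, (c e : ℂ) * edgeLog e z + g z) (orient e).right = c e := by
  obtain ⟨right, hright⟩ := exists_eq_of_hasDerivAt_zero (orient e).right_mem_faces hright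
  obtain ⟨left, hleft⟩ := exists_eq_of_hasDerivAt_zero (orient e).rev.right_mem_faces hleft
  rw [faceValue_eq (face_nonempty (orient e).rev.right_mem_faces).some_mem hleft,
    faceValue_eq (face_nonempty (orient e).right_mem_faces).some_mem hright,
    ← sub_div, ← Complex.sub_im, left_sub_right_of_sum_edgeLog_eq S c g e hg hright hleft]
  split_ifs with h
  · have him : ((c e : ℂ) * (2 * Real.pi * Complex.I)).im = c e * (2 * Real.pi) := by simp
    rw [him, mul_div_cancel_right₀ _ Real.two_pi_pos.ne']
  · rw [not_imp_comm.1 he h, Complex.zero_im, zero_div]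

theorem hasDerivAt_sum_edgeLog (S : Finset M.E) (c : M.E → ℝ) {z : ℂ}
    (hz : ∀ e ∈ S, z ∉ (e : Set ℂ)) :
    HasDerivAt (fun z => ∑ e ∈ S, (c e : ℂ) * edgeLog e z) (∑ e ∈ S, (c e : ℂ) *
      (1 / ((orient e).vertex - z) - 1 / ((orient e).rev.vertex - z))) z :=
  HasDerivAt.fun_sum fun e he => (hasDerivAt_edgeLog e (hz e he)).const_mul _

/-- The edges that meet the closed disc of radius `R`. -/
def edgesNear (M : PlaneMap) (R : ℝ) : Finset M.E :=
  ((M.locally_finite _ (isCompact_closedBall (0 : ℂ) R)).2.preimage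
    (Subtype.val_injective.injOn (s := (Subtype.val : M.E → Set ℂ) ⁻¹' _))).toFinset

theorem mem_edgesNear {R : ℝ} {e : M.E} :
    e ∈ edgesNear M R ↔ ((e : Set ℂ) ∩ Metric.closedBall 0 R).Nonempty := by
  simp [edgesNear]

theorem toEdge_mem_edgesNear_of_right_subset {R : ℝ} {d : M.DirEdge}
    (h : d.right ⊆ Metric.closedBall 0 R) : d.toEdge ∈ edgesNear M R := by
  obtain ⟨z, hz, hzc⟩ := edge_inter_closure_right d
  exact mem_edgesNear.2 ⟨z, hz, closure_minimal h Metric.isClosed_closedBall hzc⟩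

theorem exists_potential_of_rev_eq_neg {X : Type*} (π : M.DirEdge → X) {w : M.DirEdge → ℝ}
    (hrev : ∀ d, w d.rev = -w d)
    (h : ∀ c : M.E →₀ ℝ, Finsupp.linearCombination ℝ
      (fun e => Finsupp.single (π (orient e)) (1 : ℝ) - Finsupp.single (π (orient e).rev) 1) c = 0 →
      c.sum (fun e a => a * w (orient e)) = 0) :
    ∃ f : X → ℝ, ∀ d, f (π d) - f (π d.rev) = w d := by
  obtain ⟨f, hf⟩ := exists_potential _ _ _ h
  refine ⟨f, fun d => ?_⟩
  generalize he : d.toEdge = e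
  rcases he ▸ d.eq_orient_or_eq_rev_orient with rfl | rfl
  · exact hf e
  · rw [DirEdge.rev_rev, hrev, ← hf e, neg_sub]

/-- The chain `c` of edges, each edge being directed by `orient`, has zero boundary. -/
def IsCycle (c : M.E →₀ ℝ) : Prop :=
  Finsupp.linearCombination ℝ (fun e : M.E =>
    Finsupp.single (orient e).vertex (1 : ℝ) - Finsupp.single (orient e).rev.vertex 1) c = 0

theorem IsCycle.hasDerivAt_sum_edgeLog {c : M.E →₀ ℝ} (hc : IsCycle c) {z : ℂ}
    (hz : ∀ e ∈ c.support, z ∉ (e : Set ℂ)) :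
    HasDerivAt (fun z => ∑ e ∈ c.support, (c e : ℂ) * edgeLog e z) 0 z := by
  refine (PlaneMap.hasDerivAt_sum_edgeLog c.support c hz).congr_deriv ?_
  simpa only [Complex.real_smul] using
    sum_smul_sub_eq_zero_of_linearCombination_eq_zero _ _ (fun v : ℂ => 1 / (v - z)) hc

theorem IsCycle.exists_sum_edgeLog_eq_zero {c : M.E →₀ ℝ} (hc : IsCycle c) :
    ∃ R, ∀ z, R < ‖z‖ → ∑ e ∈ c.support, (c e : ℂ) * edgeLog e z = 0 := by
  have hbounded : Bornology.IsBounded (⋃ e ∈ c.support, (e : Set ℂ)) :=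
    (Bornology.isBounded_biUnion_finset _).2 fun e _ => (isCompact_edge e.2).isBounded
  obtain ⟨R, hR, hsub⟩ := hbounded.subset_closedBall_lt 0 0
  refine ⟨R, fun z hz => eq_zero_of_hasDerivAt_zero_of_tendsto_cobounded hR.le
    (fun z hz => hc.hasDerivAt_sum_edgeLog fun e he hze => ?_) ?_ hz⟩
  · exact hz.not_ge (mem_closedBall_zero_iff.1 (hsub (mem_biUnion he hze)))
  · have hsum := tendsto_finsetSum c.support fun e _ =>
      (tendsto_arcLog_cobounded (arcLength e) (arcCorner e)).const_mul (c e : ℂ)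
    simpa only [edgeLog, mul_zero, Finset.sum_const_zero] using hsum

theorem IsCycle.exists_face_potential {c : M.E →₀ ℝ} (hc : IsCycle c) :
    ∃ k : Set ℂ → ℝ, (∀ e, k (orient e).rev.right - k (orient e).right = c e) ∧
      ∃ R, ∀ F ∈ M.faces, k F ≠ 0 → F ⊆ Metric.closedBall 0 R := by
  have hderiv (F : Set ℂ) (hF : F ∈ M.faces) (z : ℂ) (hz : z ∈ F) :
      HasDerivAt (fun z => ∑ e ∈ c.support, (c e : ℂ) * edgeLog e z + 0) 0 z := by
    simp only [add_zero]
    exact hc.hasDerivAt_sum_edgeLog fun e _ hze =>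
      face_subset_compl_graph hF hz (edge_subset_graph e.2 hze)
  refine ⟨faceValue fun z => ∑ e ∈ c.support, (c e : ℂ) * edgeLog e z + 0, fun e => ?_, ?_⟩
  · exact faceValue_rev_sub_faceValue c.support c (fun _ => 0) e
      (fun h => Finsupp.mem_support_iff.2 h) continuousAt_const
      (hderiv _ (orient e).right_mem_faces) (hderiv _ (orient e).rev.right_mem_faces)
  · obtain ⟨R, hR⟩ := hc.exists_sum_edgeLog_eq_zero
    refine ⟨R, fun F hF hne z hz => ?_⟩
    rw [mem_closedBall_zero_iff]
    by_contra! hfar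
    obtain ⟨k, hk⟩ := exists_eq_of_hasDerivAt_zero hF (hderiv F hF)
    refine hne ?_
    rw [faceValue_eq hz hk, ← hk z hz, hR z hfar, add_zero, Complex.zero_im, zero_div]

theorem IsHarmonic.sum_eq_zero_of_isCycle {w : M.DirEdge → ℝ} (hw : IsHarmonic w)
    {c : M.E →₀ ℝ} (hc : IsCycle c) : c.sum (fun e a => a * w (orient e)) = 0 := by
  obtain ⟨k, hk, R, hR⟩ := hc.exists_face_potential
  have hnear (d : M.DirEdge) (hd : k d.right ≠ 0) : d.toEdge ∈ edgesNear M R :=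
    toEdge_mem_edgesNear_of_right_subset (hR _ d.right_mem_faces hd)
  have hsum := sum_coboundary_eq_zero (edgesNear M R) hw.rev DirEdge.right k fun d₀ hd₀ =>
    ⟨fun d hd => hnear d (hd ▸ hd₀), setOf_onRight d₀.right ▸ hw.2.2 _ d₀.right_mem_faces⟩
  have hsupport : c.support ⊆ edgesNear M R := by
    intro e he
    rw [Finsupp.mem_support_iff, ← hk e] at he
    by_cases hright : k (orient e).right = 0
    · rw [← toEdge_orient e, ← DirEdge.toEdge_rev]
      exact hnear _ fun hleft => he (by rw [hleft, hright, sub_zero])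
    · rw [← toEdge_orient e]
      exact hnear _ hright
  rw [Finsupp.sum_of_support_subset c hsupport (fun e a => a * w (orient e)) fun e _ => zero_mul _,
    ← neg_eq_zero, ← hsum,
    ← Finset.sum_neg_distrib]
  refine Finset.sum_congr rfl fun e _ => ?_
  rw [← hk e, smul_eq_mul]
  ring

theorem IsHarmonic.exists_height {w : M.DirEdge → ℝ} (hw : IsHarmonic w) :
    ∃ y : ℂ → ℝ, ∀ d : M.DirEdge, y d.vertex - y d.rev.vertex = w d :=
  exists_potential_of_rev_eq_neg DirEdge.vertex hw.rev fun _ => hw.sum_eq_zero_of_isCycle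

/-- The terms `log (1 - z / v)` that correct `∑ w e * edgeLog e`, over the edges `e` near the disc
of radius `R`, to a function with zero derivative in this disc off the edges. -/
def outerCorrection (w : M.DirEdge → ℝ) (R : ℝ) (z : ℂ) : ℂ :=
  ∑ e ∈ edgesNear M R, (w (orient e) : ℂ) *
    (outerLog R (orient e).vertex z - outerLog R (orient e).rev.vertex z)

theorem hasDerivAt_outerCorrection (w : M.DirEdge → ℝ) {R : ℝ} {z : ℂ} (hz : ‖z‖ < R) :
    HasDerivAt (outerCorrection w R) (∑ e ∈ edgesNear M R, (w (orient e) : ℂ) *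
      ((if ‖(orient e).vertex‖ < R then 0 else -(1 / ((orient e).vertex - z))) -
      (if ‖(orient e).rev.vertex‖ < R then 0 else -(1 / ((orient e).rev.vertex - z))))) z :=
  HasDerivAt.fun_sum fun _ _ =>
    ((hasDerivAt_outerLog _ hz).sub (hasDerivAt_outerLog _ hz)).const_mul _

theorem IsHarmonic.sum_inner_eq_zero {w : M.DirEdge → ℝ} (hw : IsHarmonic w) (R : ℝ) (z : ℂ) :
    ∑ e ∈ edgesNear M R, (w (orient e) : ℂ) *
      ((if ‖(orient e).vertex‖ < R then 1 / ((orient e).vertex - z) else 0) -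
      (if ‖(orient e).rev.vertex‖ < R then 1 / ((orient e).rev.vertex - z) else 0)) = 0 := by
  simp only [← Complex.real_smul]
  refine sum_coboundary_eq_zero (edgesNear M R) hw.rev DirEdge.vertex
    (fun v : ℂ => if ‖v‖ < R then 1 / (v - z) else 0) fun d₀ hd₀ =>
      ⟨fun d hd => mem_edgesNear.2 ⟨d.vertex, d.mem, ?_⟩, hw.1 _ d₀.vertex_mem⟩
  rw [hd, mem_closedBall_zero_iff]
  by_contra! hlt
  exact hd₀ (if_neg hlt.not_gt)

theorem IsHarmonic.hasDerivAt_sum_edgeLog {w : M.DirEdge → ℝ} (hw : IsHarmonic w) {R : ℝ} {z : ℂ}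
    (hz : ‖z‖ < R) (hgraph : z ∉ M.graph) :
    HasDerivAt (fun z => ∑ e ∈ edgesNear M R, (w (orient e) : ℂ) * edgeLog e z +
      outerCorrection w R z) 0 z := by
  refine ((PlaneMap.hasDerivAt_sum_edgeLog _ (fun e => w (orient e)) fun e _ hze =>
    hgraph (edge_subset_graph e.2 hze)).add (hasDerivAt_outerCorrection w hz)).congr_deriv ?_
  rw [← Finset.sum_add_distrib]
  refine Eq.trans (Finset.sum_congr rfl fun e _ => ?_) (hw.sum_inner_eq_zero R z)
  split_ifs <;> ring

theorem IsHarmonic.exists_local_abscissa {w : M.DirEdge → ℝ} (hw : IsHarmonic w) (R : ℝ) :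
    ∃ k : Set ℂ → ℝ, ∀ e : M.E, (e : Set ℂ) ⊆ Metric.ball 0 R →
      (orient e).right ⊆ Metric.ball 0 R → (orient e).rev.right ⊆ Metric.ball 0 R →
      k (orient e).rev.right - k (orient e).right = w (orient e) := by
  refine ⟨faceValue fun z => ∑ e ∈ edgesNear M R, (w (orient e) : ℂ) * edgeLog e z +
    outerCorrection w R z, fun e he hright hleft => ?_⟩
  have hmid := he (edgeNormal_zero_mem e)
  have hderiv (F : Set ℂ) (hF : F ∈ M.faces) (hsub : F ⊆ Metric.ball 0 R) (z : ℂ) (hz : z ∈ F) :=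
    hw.hasDerivAt_sum_edgeLog (mem_ball_zero_iff.1 (hsub hz)) (face_subset_compl_graph hF hz)
  exact faceValue_rev_sub_faceValue _ (fun e => w (orient e)) _ e
    (fun _ => mem_edgesNear.2 ⟨_, edgeNormal_zero_mem e, Metric.ball_subset_closedBall hmid⟩)
    (hasDerivAt_outerCorrection w (mem_ball_zero_iff.1 hmid)).continuousAt
    (hderiv _ (orient e).right_mem_faces hright) (hderiv _ (orient e).rev.right_mem_faces hleft)

theorem exists_subset_ball (S : Finset M.E) : ∃ R, ∀ e ∈ S, (e : Set ℂ) ⊆ Metric.ball 0 R ∧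
    (orient e).right ⊆ Metric.ball 0 R ∧ (orient e).rev.right ⊆ Metric.ball 0 R := by
  have hbounded : Bornology.IsBounded
      (⋃ e ∈ S, ((e : Set ℂ) ∪ ((orient e).right ∪ (orient e).rev.right))) :=
    (Bornology.isBounded_biUnion_finset _).2 fun e _ => (isCompact_edge e.2).isBounded.union
      ((M.face_bounded _ (orient e).right_mem_faces).union
        (M.face_bounded _ (orient e).rev.right_mem_faces))
  obtain ⟨R, hR⟩ := hbounded.subset_ball 0
  refine ⟨R, fun e he => ?_⟩
  simpa only [union_subset_iff] using (subset_biUnion_of_mem (u := fun e : M.E =>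
    ((e : Set ℂ) ∪ ((orient e).right ∪ (orient e).rev.right))) he).trans hR

theorem IsHarmonic.exists_abscissa {w : M.DirEdge → ℝ} (hw : IsHarmonic w) :
    ∃ x : Set ℂ → ℝ, ∀ d : M.DirEdge, x d.rev.right - x d.right = w d := by
  obtain ⟨f, hf⟩ := exists_potential_of_rev_eq_neg DirEdge.right hw.rev fun c hc => by
    obtain ⟨R, hR⟩ := exists_subset_ball c.support
    obtain ⟨k, hk⟩ := hw.exists_local_abscissa R
    rw [Finsupp.sum, ← neg_eq_zero, ← Finset.sum_neg_distrib,
      ← sum_smul_sub_eq_zero_of_linearCombination_eq_zero _ _ k hc]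
    refine Finset.sum_congr rfl fun e he => ?_
    obtain ⟨hedge, hright, hleft⟩ := hR e he
    rw [← hk e hedge hright hleft, smul_eq_mul]
    ring
  refine ⟨-f, fun d => ?_⟩
  rw [← hf d, Pi.neg_apply, Pi.neg_apply]
  ring

theorem nonempty_squareTiling {w : M.DirEdge → ℝ} (hw : IsHarmonic w) :
    Nonempty (M.SquareTiling w) := by
  obtain ⟨y, hy⟩ := hw.exists_height
  obtain ⟨x, hx⟩ := hw.exists_abscissa
  refine ⟨⟨y, x, fun d d' h => ?_, fun d d' F F' h hF hF' => ?_⟩⟩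
  · rw [h.eq_rev]
    exact hy d
  · rw [h.eq_rev, onRight_iff] at hF'
    rw [onRight_iff] at hF
    rw [← hF, ← hF']
    exact hx d

end PlaneMap

/-! ### Symmetries of the map and the tiling -/

/-- `f` is an orientation-preserving isometry. -/
def IsDirect (f : ℂ ≃ᵢ ℂ) : Prop := ∃ a b : ℂ, ‖a‖ = 1 ∧ ∀ z, f z = a * z + b

/-- `f` is an orientation-reversing isometry. -/
def IsOpposite (f : ℂ ≃ᵢ ℂ) : Prop :=
  ∃ a b : ℂ, ‖a‖ = 1 ∧ ∀ z, f z = a * (starRingEnd ℂ) z + b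

theorem isDirect_or_isOpposite (f : ℂ ≃ᵢ ℂ) : IsDirect f ∨ IsOpposite f := by
  have hf (z : ℂ) : f z = f.toRealLinearIsometryEquiv z + f 0 := by
    rw [IsometryEquiv.toRealLinearIsometryEquiv_apply, sub_add_cancel]
  obtain ⟨a, ha | ha⟩ := linear_isometry_complex f.toRealLinearIsometryEquiv
  · refine Or.inl ⟨a, f 0, Circle.norm_coe a, fun z => ?_⟩
    rw [hf, ha, rotation_apply]
  · refine Or.inr ⟨a, f 0, Circle.norm_coe a, fun z => ?_⟩
    rw [hf, ha, LinearIsometryEquiv.trans_apply, rotation_apply, Complex.conjLIE_apply]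

theorem image_segment_isometryEquiv (f : ℂ ≃ᵢ ℂ) (a b : ℂ) :
    f '' segment ℝ a b = segment ℝ (f a) (f b) := by
  simpa using image_segment ℝ f.toRealAffineIsometryEquiv.toAffineEquiv.toAffineMap a b

theorem IsPolygonalArc.image {n : ℕ} {p : ℕ → ℂ} {e : Set ℂ} (h : IsPolygonalArc n p e)
    (f : ℂ ≃ᵢ ℂ) : IsPolygonalArc n (fun i => f (p i)) (f '' e) := by
  refine ⟨h.1, fun i hi => f.injective.ne (h.2.1 i hi), fun i j hij hj => ?_, ?_⟩
  · rw [← image_segment_isometryEquiv, ← image_segment_isometryEquiv, ← image_inter f.injective,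
      h.2.2.1 i j hij hj, apply_ite (f '' ·), image_singleton, image_empty]
  · rw [h.2.2.2, image_iUnion₂]
    simp only [image_segment_isometryEquiv]

theorem image_eq_of_mem_iff {g : ℂ ≃ᵢ ℂ} {A B : Set ℂ} (h : ∀ z, g z ∈ B ↔ z ∈ A) :
    g '' A = B := by
  rw [← image_preimage_eq B g.surjective]
  exact congrArg _ (Set.ext fun z => (h z).symm)

namespace PlaneMap

variable {M : PlaneMap}

theorem mapDir_rev (f : M.symmetryGroup) (d : M.DirEdge) :
    mapDir f d.rev = (mapDir f d).rev := by
  apply IsReverse.eq_rev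
  refine ⟨?_, fun h => d.rev_vertex_ne (f.1.injective h).symm⟩
  change f.1 '' d.edge = f.1 '' d.rev.edge
  rw [d.rev_edge]

theorem mapDir_inv_mapDir (f : M.symmetryGroup) (d : M.DirEdge) : mapDir f⁻¹ (mapDir f d) = d :=
  DirEdge.ext (f.1.symm_apply_apply d.vertex) (f.1.toEquiv.symm_image_image d.edge)

theorem mapDir_mapDir_inv (f : M.symmetryGroup) (d : M.DirEdge) : mapDir f (mapDir f⁻¹ d) = d :=
  DirEdge.ext (f.1.apply_symm_apply d.vertex) (f.1.toEquiv.image_symm_image d.edge)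

theorem pushforward_eq_iff (f : M.symmetryGroup) (w w' : M.DirEdge → ℝ) :
    pushforward f w = w' ↔ ∀ d, w' (mapDir f d) = w d := by
  constructor
  · rintro rfl d
    rw [pushforward, mapDir_inv_mapDir]
  · intro h
    funext d
    rw [pushforward, ← h, mapDir_mapDir_inv]

theorem apply_mem_graph_iff (f : M.symmetryGroup) {z : ℂ} : f.1 z ∈ M.graph ↔ z ∈ M.graph := by
  have hmap (g : M.symmetryGroup) {z : ℂ} (hz : z ∈ M.graph) : g.1 z ∈ M.graph := by
    rcases hz with hz | ⟨e, he, hz⟩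
    · exact Or.inl (symm_vertex g.2 hz)
    · exact Or.inr ⟨_, symm_edge g.2 he, mem_image_of_mem _ hz⟩
  refine ⟨fun hz => ?_, hmap f⟩
  rw [← f.1.symm_apply_apply z]
  exact hmap f⁻¹ hz

theorem image_compl_graph (f : M.symmetryGroup) : f.1 '' M.graphᶜ = M.graphᶜ :=
  image_eq_of_mem_iff fun _ => not_congr (apply_mem_graph_iff f)

theorem image_mem_faces (f : M.symmetryGroup) {F : Set ℂ} (hF : F ∈ M.faces) :
    f.1 '' F ∈ M.faces := by
  obtain ⟨z, hz, rfl⟩ := hF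
  refine ⟨f.1 z, mt (apply_mem_graph_iff f).1 hz, ?_⟩
  have himage := f.1.toHomeomorph.image_connectedComponentIn hz
  change f.1 '' connectedComponentIn M.graphᶜ z =
    connectedComponentIn (f.1 '' M.graphᶜ) (f.1 z) at himage
  rwa [image_compl_graph] at himage

theorem right_mapDir_of_isDirect {f : M.symmetryGroup} (hf : IsDirect f.1) (d : M.DirEdge) :
    (mapDir f d).right = f.1 '' d.right := by
  obtain ⟨a, b, -, hab⟩ := hf
  obtain ⟨n, p, hp, hstart⟩ := d.exists_arc
  rw [← onRight_iff]
  refine ⟨image_mem_faces f d.right_mem_faces, n, _, hp.image f.1, congrArg f.1 hstart, 0,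
    hp.pos, ?_⟩
  filter_upwards [(d.faceRightAt_right hp hstart hp.pos).2] with s hs
  rw [midpoint_sub_mul_I]
  refine ⟨_, hs, ?_⟩
  simp only [hab]
  ring

theorem right_rev_mapDir_of_isOpposite {f : M.symmetryGroup} (hf : IsOpposite f.1)
    (d : M.DirEdge) : (mapDir f d).rev.right = f.1 '' d.right := by
  obtain ⟨a, b, -, hab⟩ := hf
  obtain ⟨n, p, hp, hstart⟩ := d.exists_arc
  have hpos := hp.pos
  have harc : IsPolygonalArc n (fun i => f.1 (p (n - i))) (mapDir f d).rev.edge := by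
    rw [DirEdge.rev_edge]
    exact hp.reverse.image f.1
  rw [← onRight_iff]
  refine ⟨image_mem_faces f d.right_mem_faces, n, _, harc, ?_, n - 1, by omega, ?_⟩
  · rw [← mapDir_rev, Nat.sub_zero, ← d.rev_vertex_eq hp hstart]
    rfl
  filter_upwards [(d.faceRightAt_right hp hstart hpos).2] with s hs
  rw [midpoint_sub_mul_I, show n - (n - 1) = 1 by omega, show n - (n - 1 + 1) = 0 by omega]
  refine ⟨_, hs, ?_⟩
  simp only [hab, map_add, map_mul, map_sub, Complex.conj_ofReal, Complex.conj_I]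
  push_cast
  ring

theorem right_mapDir_of_isOpposite {f : M.symmetryGroup} (hf : IsOpposite f.1) (d : M.DirEdge) :
    (mapDir f d).right = f.1 '' d.rev.right := by
  rw [← right_rev_mapDir_of_isOpposite hf, mapDir_rev, DirEdge.rev_rev]

theorem exists_forall_eq_of_rot_of_rev {X : Type*} [Nonempty X] (φ : M.DirEdge → X)
    (hrot : ∀ d : M.DirEdge, φ d.rot = φ d) (hrev : ∀ d : M.DirEdge, φ d.rev = φ d) :
    ∃ c, ∀ d, φ d = c := by
  rcases isEmpty_or_nonempty M.DirEdge with hempty | ⟨⟨d₀⟩⟩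
  · exact ⟨Classical.arbitrary X, fun d => hempty.elim d⟩
  · exact ⟨φ d₀, fun d => dirEdge_induction (P := fun d => φ d = φ d₀)
      (fun d hd => (hrot d).trans hd) (fun d hd => (hrev d).trans hd) (d₀ := d₀) rfl d⟩

namespace SquareTiling

variable {w w' : M.DirEdge → ℝ}

theorem height_sub_rev (T : M.SquareTiling w) (d : M.DirEdge) :
    T.height d.vertex - T.height d.rev.vertex = w d := T.height_sub d _ d.isReverse_rev

theorem abscissa_rev_sub (T : M.SquareTiling w) (d : M.DirEdge) :
    T.abscissa d.rev.right - T.abscissa d.right = w d :=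
  T.abscissa_sub d _ _ _ d.isReverse_rev d.onRight_right d.rev.onRight_right

theorem weight_rev (T : M.SquareTiling w) (d : M.DirEdge) : w d.rev = -w d := by
  rw [← T.height_sub_rev, ← T.height_sub_rev, d.rev_rev]
  ring

theorem exists_height_shift (T : M.SquareTiling w) (T' : M.SquareTiling w') (f : M.symmetryGroup)
    (ε : ℝ) (h : ∀ d, w' (mapDir f d) = ε * w d) :
    ∃ c, ∀ d : M.DirEdge, T'.height (f.1 d.vertex) = ε * T.height d.vertex + c := by
  obtain ⟨c, hc⟩ := exists_forall_eq_of_rot_of_rev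
    (fun d : M.DirEdge => T'.height (f.1 d.vertex) - ε * T.height d.vertex)
    (fun d => by rw [d.rot_vertex]) fun d => by
      have hsub := T'.height_sub_rev (mapDir f d)
      rw [h, ← mapDir_rev, ← T.height_sub_rev] at hsub
      change T'.height (f.1 d.vertex) - T'.height (f.1 d.rev.vertex) = _ at hsub
      linarith
  exact ⟨c, fun d => by rw [← hc d]; ring⟩

theorem exists_abscissa_shift (T : M.SquareTiling w) (T' : M.SquareTiling w')
    (f : M.symmetryGroup) (ε : ℝ)
    (h : ∀ d : M.DirEdge, T'.abscissa (f.1 '' d.rev.right) - T'.abscissa (f.1 '' d.right) =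
      ε * w d) :
    ∃ c, ∀ d : M.DirEdge, T'.abscissa (f.1 '' d.right) = ε * T.abscissa d.right + c := by
  have hrev (d : M.DirEdge) : T'.abscissa (f.1 '' d.rev.right) - ε * T.abscissa d.rev.right =
      T'.abscissa (f.1 '' d.right) - ε * T.abscissa d.right := by
    have hsub := h d
    rw [← T.abscissa_rev_sub] at hsub
    linarith
  obtain ⟨c, hc⟩ := exists_forall_eq_of_rot_of_rev
    (fun d : M.DirEdge => T'.abscissa (f.1 '' d.right) - ε * T.abscissa d.right)
    (fun d => by rw [d.right_rot, hrev]) hrev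
  exact ⟨c, fun d => by rw [← hc d]; ring⟩

theorem exists_abscissa_shift_of_isDirect (T : M.SquareTiling w) (T' : M.SquareTiling w')
    {f : M.symmetryGroup} (hf : IsDirect f.1) (ε : ℝ) (h : ∀ d, w' (mapDir f d) = ε * w d) :
    ∃ c, ∀ d : M.DirEdge, T'.abscissa (f.1 '' d.right) = ε * T.abscissa d.right + c := by
  refine T.exists_abscissa_shift T' f ε fun d => ?_
  rw [← right_mapDir_of_isDirect hf, ← right_mapDir_of_isDirect hf, ← h, mapDir_rev]
  exact T'.abscissa_rev_sub _

theorem exists_abscissa_shift_of_isOpposite (T : M.SquareTiling w) (T' : M.SquareTiling w')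
    {f : M.symmetryGroup} (hf : IsOpposite f.1) (ε : ℝ) (h : ∀ d, w' (mapDir f d) = ε * w d) :
    ∃ c, ∀ d : M.DirEdge, T'.abscissa (f.1 '' d.right) = -ε * T.abscissa d.right + c := by
  refine T.exists_abscissa_shift T' f (-ε) fun d => ?_
  rw [← right_rev_mapDir_of_isOpposite hf d, ← right_mapDir_of_isOpposite hf, neg_mul, ← h,
    ← T'.abscissa_rev_sub, neg_sub]

theorem mem_rectangle_iff (T : M.SquareTiling w) {d : M.DirEdge} (hd : 0 < w d) (z : ℂ) :
    (z.re ∈ Icc (T.abscissa d.right) (T.abscissa d.right + w d) ∧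
      z.im ∈ Icc (T.height d.vertex - w d) (T.height d.vertex)) ↔
    (z.re ∈ uIcc (T.abscissa d.right) (T.abscissa d.rev.right) ∧
      z.im ∈ uIcc (T.height d.vertex) (T.height d.rev.vertex)) := by
  have habscissa := T.abscissa_rev_sub d
  have hheight := T.height_sub_rev d
  rw [uIcc_of_le (by linarith), uIcc_of_ge (by linarith),
    show T.abscissa d.right + w d = T.abscissa d.rev.right by linarith,
    show T.height d.vertex - w d = T.height d.rev.vertex by linarith]

theorem mem_square_iff (T : M.SquareTiling w) (d : M.DirEdge) (z : ℂ) :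
    z ∈ T.square d.edge ↔ w d ≠ 0 ∧ z.re ∈ uIcc (T.abscissa d.right) (T.abscissa d.rev.right) ∧
      z.im ∈ uIcc (T.height d.vertex) (T.height d.rev.vertex) := by
  constructor
  · rintro ⟨c, F, hc, hw, hF, hz⟩
    obtain rfl := onRight_iff.1 hF
    rw [T.mem_rectangle_iff hw] at hz
    rcases DirEdge.eq_or_eq_rev hc with rfl | rfl
    · exact ⟨hw.ne', hz⟩
    · rw [T.weight_rev] at hw
      rw [DirEdge.rev_rev, uIcc_comm, uIcc_comm (T.height _)] at hz
      exact ⟨(neg_pos.1 hw).ne, hz⟩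
  · rintro ⟨hw, hz⟩
    rcases lt_or_gt_of_ne hw with hneg | hpos
    · have hrev : 0 < w d.rev := by
        rw [T.weight_rev]
        exact neg_pos.2 hneg
      refine ⟨d.rev, _, d.rev_edge, hrev, d.rev.onRight_right, (T.mem_rectangle_iff hrev z).2 ?_⟩
      rw [DirEdge.rev_rev, uIcc_comm, uIcc_comm (T.height _)]
      exact hz
    · exact ⟨d, _, rfl, hpos, d.onRight_right, (T.mem_rectangle_iff hpos z).2 hz⟩

theorem square_nonempty_iff (T : M.SquareTiling w) (d : M.DirEdge) :
    (T.square d.edge).Nonempty ↔ w d ≠ 0 := by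
  constructor
  · rintro ⟨z, hz⟩
    exact ((T.mem_square_iff d z).1 hz).1
  · intro h
    exact ⟨⟨T.abscissa d.right, T.height d.vertex⟩,
      (T.mem_square_iff d _).2 ⟨h, left_mem_uIcc, left_mem_uIcc⟩⟩

end SquareTiling

end PlaneMap

/-! ### Induced symmetries -/

theorem exists_isometryEquiv_eq_mul_add {s : ℝ} (hs : s = 1 ∨ s = -1) (c : ℝ) :
    ∃ φ : ℝ ≃ᵢ ℝ, ∀ x, φ x = s * x + c := by
  rcases hs with rfl | rfl
  · exact ⟨IsometryEquiv.addRight c, fun x => by rw [IsometryEquiv.addRight_apply, one_mul]⟩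
  · exact ⟨IsometryEquiv.subLeft c, fun x => by rw [IsometryEquiv.subLeft_apply]; ring⟩

theorem apply_mem_uIcc_iff (φ : ℝ ≃ᵢ ℝ) {a b x : ℝ} : φ x ∈ uIcc (φ a) (φ b) ↔ x ∈ uIcc a b := by
  have himage : φ '' uIcc a b = uIcc (φ a) (φ b) := by
    simpa [segment_eq_uIcc] using
      image_segment ℝ φ.toRealAffineIsometryEquiv.toAffineEquiv.toAffineMap a b
  rw [← himage, φ.injective.mem_set_image]

/-- The isometry of the plane that acts on the abscissas by `φ` and on the heights by `ψ`. -/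
def axisIsometry (φ ψ : ℝ ≃ᵢ ℝ) : ℂ ≃ᵢ ℂ :=
  IsometryEquiv.mk' (fun z => ⟨φ z.re, ψ z.im⟩) (fun z => ⟨φ.symm z.re, ψ.symm z.im⟩)
    (fun z => by simp) <| Isometry.of_dist_eq fun x y => by
      simp only [Complex.dist_eq_re_im, ← sq_abs (_ - _ : ℝ), ← Real.dist_eq, φ.dist_eq, ψ.dist_eq]

namespace PlaneMap

variable {M : PlaneMap}

theorem exists_sides_mapDir (f : M.symmetryGroup) (d : M.DirEdge) :
    ∃ c : M.DirEdge, c.edge = f.1 '' d.edge ∧ c.right = f.1 '' d.right := by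
  rcases isDirect_or_isOpposite f.1 with hf | hf
  · exact ⟨mapDir f d, rfl, right_mapDir_of_isDirect hf d⟩
  · exact ⟨(mapDir f d).rev, (mapDir f d).rev_edge, right_rev_mapDir_of_isOpposite hf d⟩

theorem exists_image_sides_eq (f : M.symmetryGroup) (c : M.DirEdge) :
    ∃ d : M.DirEdge, f.1 '' d.edge = c.edge ∧ f.1 '' d.right = c.right := by
  obtain ⟨d, hedge, hright⟩ := exists_sides_mapDir f⁻¹ c
  exact ⟨d, hedge ▸ f.1.toEquiv.image_symm_image c.edge,
    hright ▸ f.1.toEquiv.image_symm_image c.right⟩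

namespace SquareTiling

variable {w : M.DirEdge → ℝ} {T : M.SquareTiling w} {f : M.symmetryGroup}

/-- The symmetry `f` of the map acts on the abscissas of the faces by the isometry `φ` of the line,
on the heights of the vertices by `ψ`, and preserves the edges that have an empty square. -/
structure ActsBy (T : M.SquareTiling w) (f : M.symmetryGroup) (φ ψ : ℝ ≃ᵢ ℝ) : Prop where
  weight_eq_zero_iff : ∀ d, w (mapDir f d) = 0 ↔ w d = 0
  abscissa : ∀ d : M.DirEdge, T.abscissa (f.1 '' d.right) = φ (T.abscissa d.right)
  height : ∀ d : M.DirEdge, T.height (f.1 d.vertex) = ψ (T.height d.vertex)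

namespace ActsBy

variable {φ ψ : ℝ ≃ᵢ ℝ}

theorem uIcc_abscissa_mapDir (h : T.ActsBy f φ ψ) (d : M.DirEdge) :
    uIcc (T.abscissa (mapDir f d).right) (T.abscissa (mapDir f d).rev.right) =
      uIcc (φ (T.abscissa d.right)) (φ (T.abscissa d.rev.right)) := by
  rcases isDirect_or_isOpposite f.1 with hf | hf
  · rw [← mapDir_rev, right_mapDir_of_isDirect hf, right_mapDir_of_isDirect hf, h.abscissa,
      h.abscissa]
  · rw [right_mapDir_of_isOpposite hf, right_rev_mapDir_of_isOpposite hf, h.abscissa, h.abscissa,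
      uIcc_comm]

theorem apply_mem_square_iff (h : T.ActsBy f φ ψ) (d : M.DirEdge) (z : ℂ) :
    axisIsometry φ ψ z ∈ T.square (f.1 '' d.edge) ↔ z ∈ T.square d.edge := by
  have hheight (d : M.DirEdge) : T.height (mapDir f d).vertex = ψ (T.height d.vertex) := h.height d
  change _ ∈ T.square (mapDir f d).edge ↔ _
  rw [T.mem_square_iff, T.mem_square_iff, h.uIcc_abscissa_mapDir, ← mapDir_rev, hheight, hheight]
  exact and_congr (not_congr (h.weight_eq_zero_iff d))
    (and_congr (apply_mem_uIcc_iff φ) (apply_mem_uIcc_iff ψ))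

theorem image_square (h : T.ActsBy f φ ψ) {e : Set ℂ} (he : e ∈ M.E) :
    axisIsometry φ ψ '' T.square e = T.square (f.1 '' e) := by
  have hedge : (orient ⟨e, he⟩).edge = e := orient_edge ⟨e, he⟩
  rw [← hedge]
  exact image_eq_of_mem_iff (h.apply_mem_square_iff _)

theorem axisIsometry_mem_symmetryGroup (h : T.ActsBy f φ ψ) :
    axisIsometry φ ψ ∈ T.symmetryGroup := by
  change (fun S : Set ℂ => axisIsometry φ ψ '' S) '' T.tiles = T.tiles
  apply Subset.antisymm
  · rintro _ ⟨_, ⟨e, he, rfl, hnonempty⟩, rfl⟩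
    exact ⟨f.1 '' e, symm_edge f.2 he, h.image_square he, hnonempty.image _⟩
  · rintro _ ⟨e, he, rfl, hnonempty⟩
    have hpre : f.1.symm '' e ∈ M.E := symm_edge (f⁻¹).2 he
    have himage : axisIsometry φ ψ '' T.square (f.1.symm '' e) = T.square e :=
      (h.image_square hpre).trans (congrArg _ (f.1.toEquiv.image_symm_image e))
    exact ⟨_, ⟨_, hpre, rfl, (himage ▸ hnonempty).of_image⟩, himage⟩

theorem image_horizontalFace (h : T.ActsBy f φ ψ) (v : ℂ) :
    axisIsometry φ ψ '' T.horizontalFace v = T.horizontalFace (f.1 v) := by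
  refine image_eq_of_mem_iff fun z => ?_
  constructor
  · rintro ⟨him, c, hc, hz⟩
    obtain ⟨d, rfl⟩ : ∃ d, c = mapDir f d := ⟨_, (mapDir_mapDir_inv f c).symm⟩
    obtain rfl : d.vertex = v := f.1.injective hc
    exact ⟨ψ.injective (him.trans (h.height d)), d, rfl, (h.apply_mem_square_iff d z).1 hz⟩
  · rintro ⟨him, d, rfl, hz⟩
    exact ⟨(congrArg ψ him).trans (h.height d).symm, mapDir f d, rfl,
      (h.apply_mem_square_iff d z).2 hz⟩

theorem image_verticalFace (h : T.ActsBy f φ ψ) (F : Set ℂ) :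
    axisIsometry φ ψ '' T.verticalFace F = T.verticalFace (f.1 '' F) := by
  refine image_eq_of_mem_iff fun z => ?_
  constructor
  · rintro ⟨hre, c, hc, hz⟩
    obtain ⟨d, hedge, hright⟩ := exists_image_sides_eq f c
    obtain rfl : d.right = F := f.1.injective.image_injective (hright.trans (onRight_iff.1 hc))
    exact ⟨φ.injective (hre.trans (h.abscissa d)), d, d.onRight_right,
      (h.apply_mem_square_iff d z).1 (hedge ▸ hz)⟩
  · rintro ⟨hre, d, hd, hz⟩
    obtain rfl := onRight_iff.1 hd
    obtain ⟨c, hedge, hright⟩ := exists_sides_mapDir f d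
    exact ⟨(congrArg φ hre).trans (h.abscissa d).symm, c, onRight_iff.2 hright,
      hedge ▸ (h.apply_mem_square_iff d z).2 hz⟩

theorem induces (h : T.ActsBy f φ ψ) : T.Induces f :=
  ⟨axisIsometry φ ψ, h.axisIsometry_mem_symmetryGroup, fun _ he => h.image_square he,
    fun v _ => h.image_horizontalFace v, fun F _ => h.image_verticalFace F⟩

end ActsBy

theorem induces_of_weight_mapDir {ε : ℝ} (hε : ε = 1 ∨ ε = -1)
    (h : ∀ d, w (mapDir f d) = ε * w d) : T.Induces f := by
  have hε0 : ε ≠ 0 := by rcases hε with rfl | rfl <;> norm_num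
  obtain ⟨s, hs, c, hc⟩ : ∃ s : ℝ, (s = 1 ∨ s = -1) ∧
      ∃ c, ∀ d : M.DirEdge, T.abscissa (f.1 '' d.right) = s * T.abscissa d.right + c := by
    rcases isDirect_or_isOpposite f.1 with hf | hf
    · exact ⟨ε, hε, T.exists_abscissa_shift_of_isDirect T hf ε h⟩
    · exact ⟨-ε, hε.symm.imp neg_eq_iff_eq_neg.2 neg_inj.2,
        T.exists_abscissa_shift_of_isOpposite T hf ε h⟩
  obtain ⟨k, hk⟩ := T.exists_height_shift T f ε h
  obtain ⟨φ, hφ⟩ := exists_isometryEquiv_eq_mul_add hs c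
  obtain ⟨ψ, hψ⟩ := exists_isometryEquiv_eq_mul_add hε k
  have hacts : T.ActsBy f φ ψ :=
    { weight_eq_zero_iff := fun d => by rw [h, mul_eq_zero, or_iff_right hε0]
      abscissa := fun d => by rw [hc, hφ]
      height := fun d => by rw [hk, hψ] }
  exact hacts.induces

end SquareTiling

end PlaneMap

theorem exists_im_apply_eq {g : ℂ ≃ᵢ ℂ} {z₁ z₂ : ℂ} (hre : z₁.re ≠ z₂.re) (him : z₁.im = z₂.im)
    (hg : (g z₁).im = (g z₂).im) : ∃ ε k : ℝ, (ε = 1 ∨ ε = -1) ∧ ∀ z, (g z).im = ε * z.im + k := by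
  have eq_one_or {a : ℂ} (hnorm : ‖a‖ = 1) (hzero : a.im * (z₁.re - z₂.re) = 0) :
      a.im = 0 ∧ (a.re = 1 ∨ a.re = -1) := by
    have hreal : a.im = 0 := (mul_eq_zero.1 hzero).resolve_right (sub_ne_zero.2 hre)
    have hsq := Complex.sq_norm a
    rw [hnorm, Complex.normSq_apply, hreal] at hsq
    exact ⟨hreal, mul_self_eq_one_iff.1 (by linarith)⟩
  rcases isDirect_or_isOpposite g with ⟨a, b, ha, hab⟩ | ⟨a, b, ha, hab⟩
  · simp only [hab, Complex.add_im, Complex.mul_im, him] at hg ⊢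
    obtain ⟨hreal, hsign⟩ := eq_one_or ha (by linarith)
    exact ⟨a.re, b.im, hsign, fun z => by rw [hreal]; ring⟩
  · simp only [hab, Complex.add_im, Complex.mul_im, Complex.conj_re, Complex.conj_im, him] at hg ⊢
    obtain ⟨hreal, hsign⟩ := eq_one_or ha (by linarith)
    exact ⟨-a.re, b.im, hsign.symm.imp neg_eq_iff_eq_neg.2 neg_inj.2,
      fun z => by rw [hreal]; ring⟩

namespace PlaneMap

namespace SquareTiling

variable {M : PlaneMap} {w : M.DirEdge → ℝ} {T : M.SquareTiling w} {f : M.symmetryGroup}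

theorem right_corner_mem_horizontalFace {d : M.DirEdge} (hd : w d ≠ 0) :
    (⟨T.abscissa d.right, T.height d.vertex⟩ : ℂ) ∈ T.horizontalFace d.vertex :=
  ⟨rfl, d, rfl, (T.mem_square_iff d _).2 ⟨hd, left_mem_uIcc, left_mem_uIcc⟩⟩

theorem left_corner_mem_horizontalFace {d : M.DirEdge} (hd : w d ≠ 0) :
    (⟨T.abscissa d.rev.right, T.height d.vertex⟩ : ℂ) ∈ T.horizontalFace d.vertex :=
  ⟨rfl, d, rfl, (T.mem_square_iff d _).2 ⟨hd, right_mem_uIcc, left_mem_uIcc⟩⟩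

theorem exists_weight_mapDir_of_induces (hw : w ≠ 0) (h : T.Induces f) :
    ∃ ε : ℝ, (ε = 1 ∨ ε = -1) ∧ ∀ d, w (mapDir f d) = ε * w d := by
  obtain ⟨g, -, hsquare, hface, -⟩ := h
  have him_face {d : M.DirEdge} {z : ℂ} (hz : z ∈ T.horizontalFace d.vertex) :
      (g z).im = T.height (f.1 d.vertex) :=
    (hface _ d.vertex_mem ▸ mem_image_of_mem g hz).1
  obtain ⟨d₀, hd₀⟩ := Function.ne_iff.1 hw
  have hwidth : T.abscissa d₀.right ≠ T.abscissa d₀.rev.right := fun heq =>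
    hd₀ (by rw [← T.abscissa_rev_sub, heq, sub_self, Pi.zero_apply])
  obtain ⟨ε, k, hε, him⟩ := exists_im_apply_eq (g := g)
    (z₁ := ⟨T.abscissa d₀.right, T.height d₀.vertex⟩)
    (z₂ := ⟨T.abscissa d₀.rev.right, T.height d₀.vertex⟩) hwidth rfl
    ((him_face (right_corner_mem_horizontalFace hd₀)).trans
      (him_face (left_corner_mem_horizontalFace hd₀)).symm)
  have height_apply {d : M.DirEdge} (hd : w d ≠ 0) :
      T.height (f.1 d.vertex) = ε * T.height d.vertex + k :=
    (him_face (right_corner_mem_horizontalFace hd)).symm.trans (him _)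
  refine ⟨ε, hε, fun d => ?_⟩
  by_cases hd : w d = 0
  · rw [hd, mul_zero]
    by_contra hne
    have hnonempty : (T.square (f.1 '' d.edge)).Nonempty :=
      (T.square_nonempty_iff (mapDir f d)).2 hne
    rw [← hsquare d.edge d.edge_mem] at hnonempty
    exact (T.square_nonempty_iff d).1 hnonempty.of_image hd
  · have hrev : w d.rev ≠ 0 := T.weight_rev d ▸ neg_ne_zero.2 hd
    have hsub : T.height (f.1 d.vertex) - T.height (f.1 d.rev.vertex) = w (mapDir f d) := by
      rw [← T.height_sub_rev, ← mapDir_rev]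
      rfl
    rw [← hsub, height_apply hd, height_apply hrev, ← T.height_sub_rev]
    ring

theorem induces_iff (hw : w ≠ 0) :
    T.Induces f ↔ (pushforward f w = w ∨ pushforward f w = -w) := by
  simp only [pushforward_eq_iff, Pi.neg_apply]
  constructor
  · intro h
    obtain ⟨ε, rfl | rfl, hε⟩ := exists_weight_mapDir_of_induces hw h
    · exact Or.inl fun d => by rw [hε, one_mul]
    · exact Or.inr fun d => by rw [hε, neg_one_mul, neg_neg]
  · rintro (h | h)
    · exact induces_of_weight_mapDir (Or.inl rfl) fun d => by rw [h, one_mul]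
    · exact induces_of_weight_mapDir (Or.inr rfl) fun d => by rw [← h d, neg_one_mul, neg_neg]

end SquareTiling

end PlaneMap

/-! ### The maximum principle for periodic functions -/

@[simp] theorem planeTranslation_apply (t z : ℂ) : planeTranslation t z = z + t := rfl

theorem planeTranslation_add (s t : ℂ) :
    planeTranslation (s + t) = planeTranslation s * planeTranslation t := by
  ext z
  rw [IsometryEquiv.mul_apply, planeTranslation_apply, planeTranslation_apply,
    planeTranslation_apply, add_assoc, add_comm t]

/-- The plane as a group of translations, acting on itself by isometries. -/
def planeTranslationHom : Multiplicative ℂ →* (ℂ ≃ᵢ ℂ) :=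
  MonoidHom.mk' (fun s => planeTranslation s.toAdd)
    fun s t => planeTranslation_add s.toAdd t.toAdd

theorem planeTranslation_zpow (t : ℂ) (n : ℤ) :
    planeTranslation t ^ n = planeTranslation (n * t) := by
  rw [← zsmul_eq_mul]
  exact (map_zpow planeTranslationHom (Multiplicative.ofAdd t) n).symm

theorem exists_eq_mul_add_mul {t₁ t₂ : ℂ} (h : LinearIndependent ℝ ![t₁, t₂]) (z : ℂ) :
    ∃ a b : ℝ, z = a * t₁ + b * t₂ := by
  have hspan := h.span_eq_top_of_card_eq_finrank (by simp [Complex.finrank_real_complex])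
  have hz : z ∈ Submodule.span ℝ (Set.range ![t₁, t₂]) := hspan ▸ Submodule.mem_top
  rw [Matrix.range_cons_cons_empty, Submodule.mem_span_pair] at hz
  obtain ⟨a, b, rfl⟩ := hz
  exact ⟨a, b, by rw [Complex.real_smul, Complex.real_smul]⟩

theorem exists_isCompact_forall_add_mem {t₁ t₂ : ℂ} (h : LinearIndependent ℝ ![t₁, t₂]) :
    ∃ K : Set ℂ, IsCompact K ∧ ∀ z, ∃ m n : ℤ, z + (m * t₁ + n * t₂) ∈ K := by
  let f : ℝ × ℝ → ℂ := fun x => x.1 * t₁ + x.2 * t₂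
  have hf : Continuous f := by fun_prop
  refine ⟨f '' (Icc 0 1 ×ˢ Icc 0 1), (isCompact_Icc.prod isCompact_Icc).image hf, fun z => ?_⟩
  obtain ⟨a, b, rfl⟩ := exists_eq_mul_add_mul h z
  refine ⟨-⌊a⌋, -⌊b⌋, (Int.fract a, Int.fract b), ⟨⟨Int.fract_nonneg a, (Int.fract_lt_one a).le⟩,
    Int.fract_nonneg b, (Int.fract_lt_one b).le⟩, ?_⟩
  simp only [f, Int.fract]
  push_cast
  ring

theorem eq_zero_of_finsum_mem_eq_zero {ι : Type*} {s : Set ι} (hs : s.Finite) {w : ι → ℝ}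
    (hsum : ∑ᶠ i ∈ s, w i = 0) {γ : ℝ} (hγ : γ ≠ 0) (hnonneg : ∀ i ∈ s, 0 ≤ γ * w i) {i : ι}
    (hi : i ∈ s) : w i = 0 := by
  rw [finsum_mem_eq_finite_toFinset_sum _ hs] at hsum
  have hzero : ∑ i ∈ hs.toFinset, γ * w i = 0 := by rw [← Finset.mul_sum, hsum, mul_zero]
  rw [Finset.sum_eq_zero_iff_of_nonneg fun i hi => hnonneg i (hs.mem_toFinset.1 hi)] at hzero
  exact (mul_eq_zero.1 (hzero i (hs.mem_toFinset.2 hi))).resolve_left hγ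

namespace PlaneMap

variable {M : PlaneMap}

theorem mapDir_mul (f g : M.symmetryGroup) (d : M.DirEdge) :
    mapDir (f * g) d = mapDir f (mapDir g d) :=
  DirEdge.ext rfl (image_comp f.1 g.1 d.edge)

theorem mapDir_one (d : M.DirEdge) : mapDir 1 d = d := DirEdge.ext rfl (image_id d.edge)

/-- The group of the symmetries of `M` that leave the function `u` of directed edges invariant. -/
def invarianceGroup (u : M.DirEdge → ℝ) : Subgroup M.symmetryGroup where
  carrier := {f | ∀ d, u (mapDir f d) = u d}
  one_mem' d := by rw [mapDir_one]
  mul_mem' {f g} hf hg d := by rw [mapDir_mul, hf, hg]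
  inv_mem' {f} hf d := by rw [← hf, mapDir_mapDir_inv]

theorem finite_dirEdge_vertex_mem {K : Set ℂ} (hK : IsCompact K) :
    {d : M.DirEdge | d.vertex ∈ K}.Finite := by
  refine ((M.locally_finite K hK).1.biUnion (t := fun v => {d : M.DirEdge | d.vertex = v})
    fun v _ => finite_dirEdge_at v).subset fun d hd => ?_
  exact mem_biUnion (show d.vertex ∈ M.V ∩ K from ⟨d.vertex_mem, hd⟩) rfl

/-- The symmetries `f₁` and `f₂` of `M` are the translations by the vectors `t₁` and `t₂`, which
are linearly independent. -/
structure IsTranslationPair (f₁ f₂ : M.symmetryGroup) (t₁ t₂ : ℂ) : Prop where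
  fst_eq : f₁.1 = planeTranslation t₁
  snd_eq : f₂.1 = planeTranslation t₂
  linearIndependent : LinearIndependent ℝ ![t₁, t₂]

namespace IsTranslationPair

variable {f₁ f₂ : M.symmetryGroup} {t₁ t₂ : ℂ}

theorem zpow_mul_zpow_apply (hf : IsTranslationPair f₁ f₂ t₁ t₂) (m n : ℤ) (z : ℂ) :
    (f₁ ^ m * f₂ ^ n).1 z = z + (m * t₁ + n * t₂) := by
  rw [Subgroup.coe_mul, Subgroup.coe_zpow, Subgroup.coe_zpow, hf.fst_eq, hf.snd_eq,
    planeTranslation_zpow, planeTranslation_zpow, ← planeTranslation_add, planeTranslation_apply]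

theorem exists_finite_forall_mapDir_mem (hf : IsTranslationPair f₁ f₂ t₁ t₂) :
    ∃ D : Set M.DirEdge, D.Finite ∧ ∀ d, ∃ m n : ℤ, mapDir (f₁ ^ m * f₂ ^ n) d ∈ D := by
  obtain ⟨K, hK, hcover⟩ := exists_isCompact_forall_add_mem hf.linearIndependent
  refine ⟨_, finite_dirEdge_vertex_mem hK, fun d => ?_⟩
  obtain ⟨m, n, hmn⟩ := hcover d.vertex
  refine ⟨m, n, ?_⟩
  change (f₁ ^ m * f₂ ^ n).1 d.vertex ∈ K
  rwa [hf.zpow_mul_zpow_apply]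

theorem exists_forall_le [Nonempty M.DirEdge] (hf : IsTranslationPair f₁ f₂ t₁ t₂)
    {u : M.DirEdge → ℝ} (hu₁ : ∀ d, u (mapDir f₁ d) = u d) (hu₂ : ∀ d, u (mapDir f₂ d) = u d) :
    ∃ d₀, ∀ d, u d ≤ u d₀ := by
  obtain ⟨D, hD, hmem⟩ := hf.exists_finite_forall_mapDir_mem
  have hinvariant (m n : ℤ) : ∀ d, u (mapDir (f₁ ^ m * f₂ ^ n) d) = u d :=
    (invarianceGroup u).mul_mem ((invarianceGroup u).zpow_mem (x := f₁) hu₁ m)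
      ((invarianceGroup u).zpow_mem (x := f₂) hu₂ n)
  obtain ⟨m₁, n₁, hd₁⟩ := hmem (Classical.arbitrary _)
  obtain ⟨d₀, -, hmax⟩ := Set.exists_max_image D u hD ⟨_, hd₁⟩
  refine ⟨d₀, fun d => ?_⟩
  obtain ⟨m, n, hd⟩ := hmem d
  rw [← hinvariant m n d]
  exact hmax _ hd

end IsTranslationPair

/-- The maximum principle for functions of the vertices that are discretely harmonic. -/
theorem IsTranslationPair.apply_vertex_eq_apply_rev_vertex {f₁ f₂ : M.symmetryGroup} {t₁ t₂ : ℂ}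
    (hf : IsTranslationPair f₁ f₂ t₁ t₂) {y : ℂ → ℝ}
    (hy₁ : ∀ d : M.DirEdge, y (f₁.1 d.vertex) = y d.vertex)
    (hy₂ : ∀ d : M.DirEdge, y (f₂.1 d.vertex) = y d.vertex)
    (hsum : ∀ v ∈ M.V, ∑ᶠ d ∈ {d : M.DirEdge | d.vertex = v}, (y d.vertex - y d.rev.vertex) = 0)
    (d : M.DirEdge) : y d.vertex = y d.rev.vertex := by
  have : Nonempty M.DirEdge := ⟨d⟩
  obtain ⟨d₀, hmax⟩ := hf.exists_forall_le (u := fun d => y d.vertex) hy₁ hy₂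
  have hrev (d : M.DirEdge) (hd : y d.vertex = y d₀.vertex) : y d.rev.vertex = y d₀.vertex := by
    have hnonneg : ∀ c ∈ {c : M.DirEdge | c.vertex = d.vertex},
        0 ≤ 1 * (y c.vertex - y c.rev.vertex) := by
      intro c (hc : c.vertex = d.vertex)
      rw [one_mul, hc, hd]
      exact sub_nonneg.2 (hmax c.rev)
    have hzero := eq_zero_of_finsum_mem_eq_zero (finite_dirEdge_at d.vertex) (hsum _ d.vertex_mem)
      one_ne_zero hnonneg (i := d) rfl
    linarith
  have hconst (d : M.DirEdge) : y d.vertex = y d₀.vertex :=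
    dirEdge_induction (P := fun d => y d.vertex = y d₀.vertex)
      (fun d hd => by rw [d.rot_vertex, hd]) hrev rfl d
  exact (hconst d).trans (hconst d.rev).symm

theorem IsHarmonic.finsum_mapDir_eq_zero {w : M.DirEdge → ℝ} (hw : IsHarmonic w)
    (f : M.symmetryGroup) {v : ℂ} (hv : v ∈ M.V) :
    ∑ᶠ d ∈ {d : M.DirEdge | d.vertex = v}, w (mapDir f d) = 0 := by
  rw [← hw.1 (f.1 v) (symm_vertex f.2 hv)]
  refine finsum_mem_eq_of_bijOn (mapDir f) ⟨?_, ?_, ?_⟩ fun d _ => rfl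
  · rintro d rfl
    rfl
  · exact (Function.LeftInverse.injective (mapDir_inv_mapDir f)).injOn
  · intro d (hd : d.vertex = f.1 v)
    refine ⟨mapDir f⁻¹ d, ?_, mapDir_mapDir_inv f d⟩
    change f.1.symm d.vertex = v
    rw [hd, f.1.symm_apply_apply]

theorem SquareTiling.weight_mapDir {w : M.DirEdge → ℝ} (T : M.SquareTiling w) (hw : IsHarmonic w)
    {f₁ f₂ : M.symmetryGroup} {t₁ t₂ : ℂ} (hf : IsTranslationPair f₁ f₂ t₁ t₂)
    (f : M.symmetryGroup) (ε : ℝ)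
    (hy₁ : ∀ d : M.DirEdge, T.height (f.1 (f₁.1 d.vertex)) - ε * T.height (f₁.1 d.vertex) =
      T.height (f.1 d.vertex) - ε * T.height d.vertex)
    (hy₂ : ∀ d : M.DirEdge, T.height (f.1 (f₂.1 d.vertex)) - ε * T.height (f₂.1 d.vertex) =
      T.height (f.1 d.vertex) - ε * T.height d.vertex)
    (d : M.DirEdge) : w (mapDir f d) = ε * w d := by
  have hsub (d : M.DirEdge) : (T.height (f.1 d.vertex) - ε * T.height d.vertex) -
      (T.height (f.1 d.rev.vertex) - ε * T.height d.rev.vertex) = w (mapDir f d) - ε * w d := by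
    have himage : T.height (f.1 d.vertex) - T.height (f.1 d.rev.vertex) = w (mapDir f d) := by
      rw [← T.height_sub_rev, ← mapDir_rev]
      rfl
    rw [← himage, ← T.height_sub_rev]
    ring
  have hsum (v : ℂ) (hv : v ∈ M.V) :
      ∑ᶠ d ∈ {d : M.DirEdge | d.vertex = v}, (w (mapDir f d) - ε * w d) = 0 := by
    rw [finsum_mem_sub_distrib _ _ (finite_dirEdge_at v), hw.finsum_mapDir_eq_zero f hv,
      ← mul_finsum_mem, hw.1 v hv, mul_zero, sub_zero]
  have hconst := hf.apply_vertex_eq_apply_rev_vertex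
    (y := fun v => T.height (f.1 v) - ε * T.height v) hy₁ hy₂ (by simpa only [hsub] using hsum) d
  exact sub_eq_zero.1 ((hsub d).symm.trans (sub_eq_zero.2 hconst))

end PlaneMap

/-! ### Periods of the tiling -/

theorem isDirect_planeTranslation (t : ℂ) : IsDirect (planeTranslation t) :=
  ⟨1, t, norm_one, fun z => by rw [planeTranslation_apply, one_mul]⟩

theorem exists_annihilator {p q : ℂ} (h : ¬ LinearIndependent ℝ ![p, q]) :
    ∃ α β : ℝ, (α ≠ 0 ∨ β ≠ 0) ∧ α * p.im + β * p.re = 0 ∧ α * q.im + β * q.re = 0 := by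
  have hdet : (!![p.im, p.re; q.im, q.re] : Matrix (Fin 2) (Fin 2) ℝ).det = 0 := by
    by_contra hdet
    rw [Matrix.det_fin_two_of] at hdet
    refine h (LinearIndependent.pair_iff.2 fun a b hab => ?_)
    have hre : a * p.re + b * q.re = 0 := by simpa using congrArg Complex.re hab
    have him : a * p.im + b * q.im = 0 := by simpa using congrArg Complex.im hab
    exact ⟨(mul_eq_zero.1 (by linear_combination q.re * him - q.im * hre)).resolve_right hdet,
      (mul_eq_zero.1 (by linear_combination p.im * hre - p.re * him)).resolve_right hdet⟩
  obtain ⟨v, hv, hzero⟩ := Matrix.exists_mulVec_eq_zero_iff.2 hdet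
  have hp := congrFun hzero 0
  have hq := congrFun hzero 1
  simp only [Matrix.mulVec, dotProduct, Fin.sum_univ_two, Matrix.of_apply, Matrix.cons_val',
    Matrix.cons_val_zero, Matrix.cons_val_one, Pi.zero_apply] at hp hq
  refine ⟨v 0, v 1, ?_, by linarith, by linarith⟩
  contrapose! hv
  exact funext (Fin.forall_fin_two.2 hv)

namespace PlaneMap

variable {M : PlaneMap}

theorem rot_backward_induction {P : M.DirEdge → Prop} (hback : ∀ d : M.DirEdge, P d.rot → P d)
    {d c : M.DirEdge} (hd : P d) (hv : c.vertex = d.vertex) : P c := by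
  by_contra hc
  exact rot_induction (P := fun d => ¬ P d) (fun d => mt (hback d)) hc hv.symm hd

namespace SquareTiling

variable {w : M.DirEdge → ℝ} (T : M.SquareTiling w)

/-- The pairs of a translation vector of `M` and the translation vector of the tiling that it
induces. -/
def periodGroup : AddSubgroup (ℂ × ℂ) where
  carrier := {x | ∃ f : M.symmetryGroup, f.1 = planeTranslation x.1 ∧ ∀ d : M.DirEdge,
    T.height (mapDir f d).vertex = T.height d.vertex + x.2.im ∧
    T.abscissa (mapDir f d).right = T.abscissa d.right + x.2.re}
  zero_mem' := by
    refine ⟨1, ?_, fun d => ?_⟩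
    · ext z
      simp
    · rw [mapDir_one]
      simp
  add_mem' := by
    rintro x y ⟨f, hf, hfx⟩ ⟨g, hg, hgy⟩
    refine ⟨f * g, ?_, fun d => ?_⟩
    · rw [Subgroup.coe_mul, hf, hg, ← planeTranslation_add, Prod.fst_add]
    · rw [mapDir_mul, (hfx _).1, (hgy _).1, (hfx _).2, (hgy _).2]
      simp only [Prod.snd_add, Complex.add_im, Complex.add_re]
      constructor <;> ring
  neg_mem' := by
    rintro x ⟨f, hf, hfx⟩
    refine ⟨f⁻¹, ?_, fun d => ?_⟩
    · ext z
      change f.1.symm z = _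
      rw [IsometryEquiv.symm_apply_eq, hf]
      simp
    · have h := hfx (mapDir f⁻¹ d)
      rw [mapDir_mapDir_inv] at h
      simp only [Prod.snd_neg, Complex.neg_im, Complex.neg_re]
      constructor <;> linarith [h.1, h.2]

theorem exists_mem_periodGroup {f : M.symmetryGroup} {t : ℂ} (hf : f.1 = planeTranslation t)
    (hw : ∀ d, w (mapDir f d) = w d) : ∃ p, (t, p) ∈ T.periodGroup := by
  have hdirect : IsDirect f.1 := hf ▸ isDirect_planeTranslation t
  obtain ⟨k, hk⟩ := T.exists_height_shift T f 1 (fun d => by rw [hw, one_mul])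
  obtain ⟨c, hc⟩ := T.exists_abscissa_shift_of_isDirect T hdirect 1
    (fun d => by rw [hw, one_mul])
  simp only [one_mul] at hk hc
  exact ⟨⟨c, k⟩, f, hf, fun d => ⟨hk d, by rw [right_mapDir_of_isDirect hdirect, hc]⟩⟩

variable {T}

theorem exists_actsBy_of_mem_periodGroup {x : ℂ × ℂ} (hx : x ∈ T.periodGroup) :
    ∃ f : M.symmetryGroup, f.1 = planeTranslation x.1 ∧
      T.ActsBy f (IsometryEquiv.addRight x.2.re) (IsometryEquiv.addRight x.2.im) := by
  obtain ⟨f, hf, hshift⟩ := hx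
  have hdirect : IsDirect f.1 := hf ▸ isDirect_planeTranslation x.1
  have hw (d : M.DirEdge) : w (mapDir f d) = w d := by
    rw [← T.height_sub_rev, ← mapDir_rev, (hshift _).1, (hshift _).1, ← T.height_sub_rev]
    ring
  exact ⟨f, hf,
    { weight_eq_zero_iff := fun d => by rw [hw]
      abscissa := fun d => right_mapDir_of_isDirect hdirect d ▸ (hshift d).2
      height := fun d => (hshift d).1 }⟩

theorem planeTranslation_mem_symmetryGroup {x : ℂ × ℂ} (hx : x ∈ T.periodGroup) :
    planeTranslation x.2 ∈ T.symmetryGroup := by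
  obtain ⟨f, -, hacts⟩ := exists_actsBy_of_mem_periodGroup hx
  exact hacts.axisIsometry_mem_symmetryGroup

/-- A linear function of the height of the vertex and the abscissa of the right side of a directed
edge; the maximum principle for it shows that the periods of the tiling span the plane. -/
def cornerForm (T : M.SquareTiling w) (α β : ℝ) (d : M.DirEdge) : ℝ :=
  α * T.height d.vertex + β * T.abscissa d.right

section CornerForm

variable {α β : ℝ}

theorem cornerForm_rot (d : M.DirEdge) :
    T.cornerForm α β d.rot = T.cornerForm α β d + β * w d := by
  rw [cornerForm, cornerForm, d.rot_vertex, d.right_rot, ← T.abscissa_rev_sub]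
  ring

theorem cornerForm_rev (d : M.DirEdge) :
    T.cornerForm α β d.rev = T.cornerForm α β d + (β - α) * w d := by
  have hheight := T.height_sub_rev d
  have habscissa := T.abscissa_rev_sub d
  rw [cornerForm, cornerForm]
  linear_combination β * habscissa - α * hheight

theorem cornerForm_rot_rev (d : M.DirEdge) :
    T.cornerForm α β d.rev.rot = T.cornerForm α β d - α * w d := by
  rw [cornerForm_rot, cornerForm_rev, T.weight_rev]
  ring

theorem weight_eq_zero_of_cornerForm_vertical (hw : IsHarmonic w) (hα : α ≠ 0) {d : M.DirEdge}
    (hmax : ∀ c, T.cornerForm α 0 c ≤ T.cornerForm α 0 d) : w d = 0 := by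
  refine eq_zero_of_finsum_mem_eq_zero (finite_dirEdge_at d.vertex) (hw.1 _ d.vertex_mem) hα
    (fun c (hc : c.vertex = d.vertex) => ?_) rfl
  have hequal : T.cornerForm α 0 c = T.cornerForm α 0 d := by
    rw [cornerForm, cornerForm, hc, zero_mul, zero_mul]
  have hle := hmax c.rev.rot
  rw [cornerForm_rot_rev, hequal] at hle
  linarith

theorem weight_eq_zero_of_cornerForm_horizontal (hw : IsHarmonic w) (hβ : β ≠ 0) {d : M.DirEdge}
    (hmax : ∀ c, T.cornerForm 0 β c ≤ T.cornerForm 0 β d) : w d = 0 := by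
  have hsum := hw.2.2 d.right d.right_mem_faces
  rw [setOf_onRight] at hsum
  refine eq_zero_of_finsum_mem_eq_zero (finite_dirEdge_right d.right_mem_faces) hsum
    (neg_ne_zero.2 hβ) (fun c (hc : c.right = d.right) => ?_) rfl
  have hequal : T.cornerForm 0 β c = T.cornerForm 0 β d := by
    rw [cornerForm, cornerForm, hc, zero_mul, zero_mul]
  have hle := hmax c.rot
  rw [cornerForm_rot, hequal] at hle
  linarith

theorem weight_eq_zero_of_cornerForm_pos (hαβ : 0 < α * β) {d : M.DirEdge}
    (hmax : ∀ c, T.cornerForm α β c ≤ T.cornerForm α β d) : w d = 0 := by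
  have hrot := hmax d.rot
  have hrev := hmax d.rev.rot
  rw [cornerForm_rot] at hrot
  rw [cornerForm_rot_rev] at hrev
  have hsq : α * β * (w d * w d) ≤ 0 := by
    linarith [mul_nonneg (show 0 ≤ α * w d by linarith) (show 0 ≤ -(β * w d) by linarith)]
  exact mul_self_eq_zero.1 (le_antisymm (nonpos_of_mul_nonpos_right hsq hαβ) (mul_self_nonneg _))

theorem weight_eq_zero_of_cornerForm_rot (hαβ : α * β < 0) {c : M.DirEdge}
    (hmax : ∀ b, T.cornerForm α β b ≤ T.cornerForm α β c.rot) : w c = 0 := by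
  have hle := hmax c
  have hrev := hmax c.rev
  rw [cornerForm_rot] at hle hrev
  rw [cornerForm_rev] at hrev
  have hsq : 0 ≤ α * β * (w c * w c) := by
    linarith [mul_nonneg (show 0 ≤ α * w c by linarith) (show 0 ≤ β * w c by linarith)]
  exact mul_self_eq_zero.1 (le_antisymm (by nlinarith) (mul_self_nonneg _))

theorem weight_eq_zero_of_cornerForm_neg (hαβ : α * β < 0) {d : M.DirEdge}
    (hmax : ∀ c, T.cornerForm α β c ≤ T.cornerForm α β d) : w d = 0 := by
  have hrot : ∀ c, T.cornerForm α β c ≤ T.cornerForm α β d.rot :=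
    rot_backward_induction (P := fun a => ∀ c, T.cornerForm α β c ≤ T.cornerForm α β a)
      (fun a ha c => by
        have hzero := weight_eq_zero_of_cornerForm_rot hαβ ha
        simpa only [cornerForm_rot, hzero, mul_zero, add_zero] using ha c) hmax d.rot_vertex
  exact weight_eq_zero_of_cornerForm_rot hαβ hrot

theorem weight_eq_zero_of_forall_cornerForm_le (hw : IsHarmonic w) (hαβ : α ≠ 0 ∨ β ≠ 0)
    {d : M.DirEdge} (hmax : ∀ c, T.cornerForm α β c ≤ T.cornerForm α β d) : w d = 0 := by
  rcases lt_trichotomy (α * β) 0 with hneg | hzero | hpos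
  · exact weight_eq_zero_of_cornerForm_neg hneg hmax
  · rcases mul_eq_zero.1 hzero with rfl | rfl
    · exact weight_eq_zero_of_cornerForm_horizontal hw (hαβ.resolve_left (not_not.2 rfl)) hmax
    · exact weight_eq_zero_of_cornerForm_vertical hw (hαβ.resolve_right (not_not.2 rfl)) hmax
  · exact weight_eq_zero_of_cornerForm_pos hpos hmax

theorem eq_zero_of_forall_cornerForm_le (hw : IsHarmonic w) (hαβ : α ≠ 0 ∨ β ≠ 0)
    {d₀ : M.DirEdge} (hmax : ∀ c, T.cornerForm α β c ≤ T.cornerForm α β d₀) : w = 0 := by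
  let IsMax (d : M.DirEdge) : Prop := ∀ c, T.cornerForm α β c ≤ T.cornerForm α β d
  have hzero (d : M.DirEdge) (hd : IsMax d) : w d = 0 :=
    weight_eq_zero_of_forall_cornerForm_le hw hαβ hd
  have hrot (d : M.DirEdge) (hd : IsMax d) : IsMax d.rot := fun c => by
    rw [cornerForm_rot, hzero d hd, mul_zero, add_zero]
    exact hd c
  have hrev (d : M.DirEdge) (hd : IsMax d) : IsMax d.rev := fun c => by
    rw [cornerForm_rev, hzero d hd, mul_zero, add_zero]
    exact hd c
  exact funext fun d => hzero d (dirEdge_induction hrot hrev hmax d)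

end CornerForm

theorem linearIndependent_snd_of_mem_periodGroup (hw : IsHarmonic w) (hw0 : w ≠ 0)
    {x₁ x₂ : ℂ × ℂ} (hx₁ : x₁ ∈ T.periodGroup) (hx₂ : x₂ ∈ T.periodGroup)
    (hli : LinearIndependent ℝ ![x₁.1, x₂.1]) : LinearIndependent ℝ ![x₁.2, x₂.2] := by
  by_contra hdependent
  obtain ⟨α, β, hαβ, hzero₁, hzero₂⟩ := exists_annihilator hdependent
  obtain ⟨f₁, hf₁, hshift₁⟩ := hx₁
  obtain ⟨f₂, hf₂, hshift₂⟩ := hx₂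
  have : Nonempty M.DirEdge := (Function.ne_iff.1 hw0).nonempty
  obtain ⟨d₀, hmax⟩ := IsTranslationPair.exists_forall_le ⟨hf₁, hf₂, hli⟩ (u := T.cornerForm α β)
    (fun d => by rw [cornerForm, (hshift₁ d).1, (hshift₁ d).2, cornerForm]; linarith)
    (fun d => by rw [cornerForm, (hshift₂ d).1, (hshift₂ d).2, cornerForm]; linarith)
  exact hw0 (eq_zero_of_forall_cornerForm_le hw hαβ hmax)

end SquareTiling

theorem weight_mapDir_of_mem_harmPer {w : M.DirEdge → ℝ} (hw : w ∈ M.harmPer)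
    {f : M.symmetryGroup} {ε : ℝ} (hε : ε = 1 ∨ ε = -1) {b : ℂ} (hf : ∀ z, f.1 z = ε * z + b)
    (d : M.DirEdge) : w (mapDir f d) = ε * w d := by
  obtain ⟨hharmonic, f₁, f₂, t₁, t₂, hf₁, hf₂, hli, hw₁, hw₂⟩ := hw
  obtain ⟨T⟩ := nonempty_squareTiling hharmonic
  rw [pushforward_eq_iff] at hw₁ hw₂
  have hperiodic (g : M.symmetryGroup) (t : ℂ) (hg : g.1 = planeTranslation t)
      (hwg : ∀ d, w (mapDir g d) = w d) (d : M.DirEdge) :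
      T.height (f.1 (g.1 d.vertex)) - ε * T.height (g.1 d.vertex) =
        T.height (f.1 d.vertex) - ε * T.height d.vertex := by
    obtain ⟨k, hk⟩ := T.exists_height_shift T g 1 (fun d => by rw [hwg, one_mul])
    simp only [one_mul] at hk
    rcases hε with rfl | rfl
    · have hcomm : f.1 (g.1 d.vertex) = g.1 (mapDir f d).vertex := by
        change _ = g.1 (f.1 d.vertex)
        rw [hf, hf, hg, planeTranslation_apply, planeTranslation_apply]
        push_cast
        ring
      rw [hcomm, hk, hk]
      change T.height (f.1 d.vertex) + k - _ = _
      ring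
    · have hcomm : f.1 d.vertex = g.1 (mapDir f (mapDir g d)).vertex := by
        change _ = g.1 (f.1 (g.1 d.vertex))
        rw [hf, hf, hg, planeTranslation_apply, planeTranslation_apply]
        push_cast
        ring
      rw [hcomm, hk, hk]
      change T.height (f.1 (g.1 d.vertex)) - _ = T.height (f.1 (g.1 d.vertex)) + k - _
      ring
  exact T.weight_mapDir hharmonic ⟨hf₁, hf₂, hli⟩ f ε (hperiodic f₁ t₁ hf₁ hw₁)
    (hperiodic f₂ t₂ hf₂ hw₂) d

theorem weight_mapDir_of_translation {w : M.DirEdge → ℝ} (hw : w ∈ M.harmPer)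
    {f : M.symmetryGroup} {t : ℂ} (hf : f.1 = planeTranslation t) (d : M.DirEdge) :
    w (mapDir f d) = w d := by
  rw [weight_mapDir_of_mem_harmPer hw (Or.inl rfl) (b := t) fun z => by simp [hf], one_mul]

/-- The group generated by the translations by `p` and `q` and the half-turn `z ↦ -z + b`. -/
def halfTurnGroup (p q b : ℂ) : Subgroup (ℂ ≃ᵢ ℂ) where
  carrier := {g | ∃ m n : ℤ,
    (∀ z, g z = z + (m * p + n * q)) ∨ ∀ z, g z = -z + (b + (m * p + n * q))}
  one_mem' := ⟨0, 0, Or.inl fun z => by simp⟩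
  mul_mem' := by
    rintro g h ⟨m, n, hg | hg⟩ ⟨m', n', hh | hh⟩
    · exact ⟨m + m', n + n', Or.inl fun z => by
        rw [IsometryEquiv.mul_apply, hg, hh]; push_cast; ring⟩
    · exact ⟨m + m', n + n', Or.inr fun z => by
        rw [IsometryEquiv.mul_apply, hg, hh]; push_cast; ring⟩
    · exact ⟨m - m', n - n', Or.inr fun z => by
        rw [IsometryEquiv.mul_apply, hg, hh]; push_cast; ring⟩
    · exact ⟨m - m', n - n', Or.inl fun z => by
        rw [IsometryEquiv.mul_apply, hg, hh]; push_cast; ring⟩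
  inv_mem' := by
    rintro g ⟨m, n, hg | hg⟩
    · refine ⟨-m, -n, Or.inl fun z => g.injective ?_⟩
      rw [IsometryEquiv.apply_inv_self, hg]
      push_cast
      ring
    · refine ⟨m, n, Or.inr fun z => g.injective ?_⟩
      rw [IsometryEquiv.apply_inv_self, hg]
      ring

theorem isWallpaperP_halfTurnGroup {p q : ℂ} (h : LinearIndependent ℝ ![p, q]) (b : ℂ) :
    IsWallpaperP 2 (halfTurnGroup p q b) := by
  refine ⟨⟨p, q, h, fun t => ⟨?_, ?_⟩⟩, ?_, ?_⟩
  · rintro ⟨m, n, ht | ht⟩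
    · exact ⟨m, n, by simpa using ht 0⟩
    · have hzero := ht 0
      have hone := ht 1
      simp only [planeTranslation_apply] at hzero hone
      exact absurd (show (2 : ℂ) = 0 by linear_combination hone - hzero) two_ne_zero
  · rintro ⟨m, n, rfl⟩
    exact ⟨m, n, Or.inl fun z => rfl⟩
  · rintro g ⟨m, n, hg | hg⟩
    · exact ⟨1, _, one_pow 2, fun z => by rw [hg, one_mul]⟩
    · exact ⟨-1, _, neg_one_sq, fun z => by rw [hg, neg_one_mul]⟩
  · have hturn (z : ℂ) : IsometryEquiv.subLeft b z = -z + b := by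
      rw [IsometryEquiv.subLeft_apply, sub_eq_neg_add]
    exact ⟨IsometryEquiv.subLeft b, ⟨0, 0, Or.inr fun z => by rw [hturn]; simp⟩, -1, b,
      IsPrimitiveRoot.neg_one 0 (by norm_num), fun z => by rw [hturn, neg_one_mul]⟩

theorem halfTurnGroup_le {p q b : ℂ} {G : Subgroup (ℂ ≃ᵢ ℂ)} (hp : planeTranslation p ∈ G)
    (hq : planeTranslation q ∈ G) {g : ℂ ≃ᵢ ℂ} (hg : g ∈ G) (hgb : ∀ z, g z = -z + b) :
    halfTurnGroup p q b ≤ G := by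
  have htranslation (m n : ℤ) : planeTranslation (m * p + n * q) ∈ G := by
    rw [planeTranslation_add, ← planeTranslation_zpow, ← planeTranslation_zpow]
    exact G.mul_mem (G.zpow_mem hp m) (G.zpow_mem hq n)
  rintro s ⟨m, n, hs | hs⟩
  · rw [show s = planeTranslation (m * p + n * q) from IsometryEquiv.ext hs]
    exact htranslation m n
  · have hmul : s = planeTranslation (m * p + n * q) * g := IsometryEquiv.ext fun z => by
      rw [hs, IsometryEquiv.mul_apply, planeTranslation_apply, hgb, add_assoc]
    rw [hmul]
    exact G.mul_mem (htranslation m n) hg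

theorem SquareTiling.exists_halfTurn_mem_symmetryGroup {w : M.DirEdge → ℝ} (hw : w ∈ M.harmPer)
    (T : M.SquareTiling w) {f : M.symmetryGroup} {b : ℂ} (hf : ∀ z, f.1 z = -1 * z + b) :
    ∃ g ∈ T.symmetryGroup, ∃ c : ℂ, ∀ z, g z = -z + c := by
  have hweight (d : M.DirEdge) : w (mapDir f d) = -1 * w d :=
    weight_mapDir_of_mem_harmPer hw (Or.inr rfl) (by exact_mod_cast hf) d
  obtain ⟨k, hk⟩ := T.exists_height_shift T f (-1) hweight
  obtain ⟨c, hc⟩ := T.exists_abscissa_shift_of_isDirect T ⟨-1, b, by simp, hf⟩ (-1) hweight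
  have hacts : T.ActsBy f (IsometryEquiv.subLeft c) (IsometryEquiv.subLeft k) :=
    { weight_eq_zero_iff := fun d => by rw [hweight, neg_one_mul, neg_eq_zero]
      abscissa := fun d => by rw [hc, IsometryEquiv.subLeft_apply]; ring
      height := fun d => by rw [hk, IsometryEquiv.subLeft_apply]; ring }
  refine ⟨_, hacts.axisIsometry_mem_symmetryGroup, ⟨c, k⟩, fun z => ?_⟩
  rw [← sub_eq_neg_add]
  rfl

theorem SquareTiling.containsP2_symmetryGroup (h : ContainsP2 M.symmetryGroup)
    {w : M.DirEdge → ℝ} (hw : w ∈ M.harmPer) (hw0 : w ≠ 0) (T : M.SquareTiling w) :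
    ContainsP2 T.symmetryGroup := by
  obtain ⟨H, hH, ⟨t₁, t₂, hli, ht⟩, -, f, hf, a, b, ha, hfz⟩ := h
  obtain rfl : a = -1 := ha.eq_neg_one_of_two_right
  have ht₁ : planeTranslation t₁ ∈ M.symmetryGroup := hH ((ht t₁).2 ⟨1, 0, by simp⟩)
  have ht₂ : planeTranslation t₂ ∈ M.symmetryGroup := hH ((ht t₂).2 ⟨0, 1, by simp⟩)
  obtain ⟨p, hp⟩ := T.exists_mem_periodGroup (f := ⟨_, ht₁⟩) rfl
    (weight_mapDir_of_translation hw rfl)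
  obtain ⟨q, hq⟩ := T.exists_mem_periodGroup (f := ⟨_, ht₂⟩) rfl
    (weight_mapDir_of_translation hw rfl)
  obtain ⟨g, hg, c, hgc⟩ := T.exists_halfTurn_mem_symmetryGroup hw (f := ⟨f, hH hf⟩) hfz
  exact ⟨halfTurnGroup p q c,
    halfTurnGroup_le (planeTranslation_mem_symmetryGroup hp)
      (planeTranslation_mem_symmetryGroup hq) hg hgc,
    isWallpaperP_halfTurnGroup (linearIndependent_snd_of_mem_periodGroup hw.1 hw0 hp hq hli) c⟩

end PlaneMap

/-! ### Isometries that preserve squares, lattices or generic vectors -/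

/-- The closed square with lower left corner `x + iy` and side `s`. -/
def axisSquare (x y s : ℝ) : Set ℂ := Icc x (x + s) ×ℂ Icc y (y + s)

theorem isBounded_axisSquare (x y s : ℝ) : Bornology.IsBounded (axisSquare x y s) :=
  (Metric.isBounded_Icc _ _).reProdIm (Metric.isBounded_Icc _ _)

theorem sq_re_sub_le_of_mem_axisSquare {x y s : ℝ} {u v : ℂ} (hu : u ∈ axisSquare x y s)
    (hv : v ∈ axisSquare x y s) : (v - u).re ^ 2 ≤ s ^ 2 := by
  rw [Complex.sub_re]
  exact sq_le_sq' (by linarith [hu.1.2, hv.1.1]) (by linarith [hu.1.1, hv.1.2])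

theorem sq_im_sub_le_of_mem_axisSquare {x y s : ℝ} {u v : ℂ} (hu : u ∈ axisSquare x y s)
    (hv : v ∈ axisSquare x y s) : (v - u).im ^ 2 ≤ s ^ 2 := by
  rw [Complex.sub_im]
  exact sq_le_sq' (by linarith [hu.2.2, hv.2.1]) (by linarith [hu.2.1, hv.2.2])

theorem sq_re_add_sq_im_sub (g : ℂ ≃ᵢ ℂ) (u v : ℂ) :
    (g v - g u).re ^ 2 + (g v - g u).im ^ 2 = (v - u).re ^ 2 + (v - u).im ^ 2 := by
  have hdist := g.dist_eq v u
  rw [Complex.dist_eq, Complex.dist_eq, ← sq_eq_sq₀ (norm_nonneg _) (norm_nonneg _),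
    Complex.sq_norm, Complex.sq_norm, Complex.normSq_apply, Complex.normSq_apply] at hdist
  linarith

section Diagonal

variable {g : ℂ ≃ᵢ ℂ} {x y s x' y' s' : ℝ}

theorem sq_diagonal_le_of_mapsTo (hs : 0 ≤ s)
    (h : MapsTo g (axisSquare x y s) (axisSquare x' y' s')) :
    (g ⟨x + s, y + s⟩ - g ⟨x, y⟩).re ^ 2 ≤ s' ^ 2 ∧ (g ⟨x + s, y + s⟩ - g ⟨x, y⟩).im ^ 2 ≤ s' ^ 2 ∧
      (g ⟨x + s, y + s⟩ - g ⟨x, y⟩).re ^ 2 + (g ⟨x + s, y + s⟩ - g ⟨x, y⟩).im ^ 2 = 2 * s ^ 2 := by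
  have hx : x ≤ x + s := le_add_of_nonneg_right hs
  have hy : y ≤ y + s := le_add_of_nonneg_right hs
  have hlower : g ⟨x, y⟩ ∈ axisSquare x' y' s' := h ⟨left_mem_Icc.2 hx, left_mem_Icc.2 hy⟩
  have hupper : g ⟨x + s, y + s⟩ ∈ axisSquare x' y' s' :=
    h ⟨right_mem_Icc.2 hx, right_mem_Icc.2 hy⟩
  refine ⟨sq_re_sub_le_of_mem_axisSquare hlower hupper,
    sq_im_sub_le_of_mem_axisSquare hlower hupper, ?_⟩
  rw [sq_re_add_sq_im_sub, Complex.sub_re, Complex.sub_im, add_sub_cancel_left,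
    add_sub_cancel_left, two_mul]

theorem sq_diagonal_eq_of_image_eq (hs : 0 ≤ s) (hs' : 0 ≤ s')
    (h : g '' axisSquare x y s = axisSquare x' y' s') :
    (g ⟨x + s, y + s⟩ - g ⟨x, y⟩).re ^ 2 = s ^ 2 ∧
      (g ⟨x + s, y + s⟩ - g ⟨x, y⟩).im ^ 2 = s ^ 2 := by
  have himage : MapsTo g (axisSquare x y s) (axisSquare x' y' s') := mapsTo_iff_image_subset.2 h.le
  have hpreimage : MapsTo g.symm (axisSquare x' y' s') (axisSquare x y s) := by
    rw [← h]
    rintro _ ⟨z, hz, rfl⟩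
    rwa [g.symm_apply_apply]
  obtain ⟨hre, him, hsum⟩ := sq_diagonal_le_of_mapsTo hs himage
  obtain ⟨hre', him', hsum'⟩ := sq_diagonal_le_of_mapsTo hs' hpreimage
  constructor <;> linarith

end Diagonal

theorem pow_four_eq_of_sq_eq {z : ℂ} {r : ℝ} (hre : z.re ^ 2 = r ^ 2) (him : z.im ^ 2 = r ^ 2) :
    z ^ 4 = -4 * (r : ℂ) ^ 4 := by
  have hre' : (z.re : ℂ) ^ 2 = (r : ℂ) ^ 2 := by exact_mod_cast hre
  have him' : (z.im : ℂ) ^ 2 = (r : ℂ) ^ 2 := by exact_mod_cast him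
  have hsq : z ^ 2 = 2 * z.re * z.im * Complex.I := by
    conv_lhs => rw [← Complex.re_add_im z]
    linear_combination hre' - him' + (z.im : ℂ) ^ 2 * Complex.I_sq
  calc z ^ 4 = (z ^ 2) ^ 2 := by ring
    _ = 4 * (z.re : ℂ) ^ 2 * (z.im : ℂ) ^ 2 * Complex.I ^ 2 := by rw [hsq]; ring
    _ = -4 * (r : ℂ) ^ 4 := by rw [hre', him', Complex.I_sq]; ring

/-- An isometry that maps an axis-parallel square to another has a linear part of order dividing
four, because the fourth powers of all the diagonals of a square of side `s` are `-4 * s ^ 4`. -/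
theorem pow_four_eq_one_of_image_axisSquare {g : ℂ ≃ᵢ ℂ} {x y s x' y' s' : ℝ} (hs : 0 < s)
    (hs' : 0 ≤ s') (h : g '' axisSquare x y s = axisSquare x' y' s') {a b : ℂ}
    (hg : (∀ z, g z = a * z + b) ∨ ∀ z, g z = a * (starRingEnd ℂ) z + b) : a ^ 4 = 1 := by
  have himage : (g ⟨x + s, y + s⟩ - g ⟨x, y⟩) ^ 4 = -4 * (s : ℂ) ^ 4 :=
    have hsides := sq_diagonal_eq_of_image_eq hs.le hs' h
    pow_four_eq_of_sq_eq hsides.1 hsides.2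
  let δ : ℂ := ⟨x + s, y + s⟩ - ⟨x, y⟩
  have hre : δ.re = s := add_sub_cancel_left x s
  have him : δ.im = s := add_sub_cancel_left y s
  have hdiagonal : δ ^ 4 = -4 * (s : ℂ) ^ 4 := pow_four_eq_of_sq_eq (by rw [hre]) (by rw [him])
  have hconj : (starRingEnd ℂ) δ ^ 4 = -4 * (s : ℂ) ^ 4 :=
    pow_four_eq_of_sq_eq (by rw [Complex.conj_re, hre]) (by rw [Complex.conj_im, him, neg_sq])
  have hne : -4 * (s : ℂ) ^ 4 ≠ 0 :=
    mul_ne_zero (by norm_num) (pow_ne_zero _ (Complex.ofReal_ne_zero.2 hs.ne'))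
  refine (mul_eq_right₀ hne).1 ?_
  rcases hg with hg | hg
  · calc a ^ 4 * (-4 * (s : ℂ) ^ 4) = (a * δ) ^ 4 := by rw [← hdiagonal, mul_pow]
      _ = -4 * (s : ℂ) ^ 4 := by rw [← himage, hg, hg, add_sub_add_right_eq_sub, ← mul_sub]
  · calc a ^ 4 * (-4 * (s : ℂ) ^ 4) = (a * (starRingEnd ℂ) δ) ^ 4 := by rw [← hconj, mul_pow]
      _ = -4 * (s : ℂ) ^ 4 := by
        rw [← himage, hg, hg, add_sub_add_right_eq_sub, ← mul_sub, ← map_sub]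

/-- `z ^ 4` is real exactly on the four axes of symmetry of the axis-parallel squares centred at
the origin. -/
theorem im_pow_four (z : ℂ) :
    (z ^ 4).im = 4 * (z.re * z.im * ((z.re - z.im) * (z.re + z.im))) := by
  rw [show z ^ 4 = z * z * (z * z) by ring]
  simp only [Complex.mul_im, Complex.mul_re]
  ring

theorem im_pow_four_eq_zero {a z : ℂ} (ha : a ^ 4 = 1)
    (h : (a * (starRingEnd ℂ) z) ^ 4 = z ^ 4) : (z ^ 4).im = 0 := by
  rw [mul_pow, ha, one_mul, ← map_pow] at h
  exact Complex.conj_eq_iff_im.1 h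

section AlmostEverywhere

open MeasureTheory

variable {E F : Type*} [NormedAddCommGroup E] [NormedSpace ℝ E] [MeasurableSpace E] [BorelSpace E]
  [FiniteDimensional ℝ E] [AddCommGroup F] [Module ℝ F] (μ : Measure E) [μ.IsAddHaarMeasure]

theorem ae_linearMap_ne_zero {φ : E →ₗ[ℝ] F} (hφ : φ ≠ 0) : ∀ᵐ x ∂μ, φ x ≠ 0 := by
  have hker := Measure.addHaar_submodule μ (LinearMap.ker φ) (mt LinearMap.ker_eq_top.1 hφ)
  rw [ae_iff]
  simp only [not_not]
  exact hker

theorem ae_im_pow_four_ne_zero {φ : E →ₗ[ℝ] ℂ} (hφ : Function.Surjective φ) :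
    ∀ᵐ x ∂μ, (φ x ^ 4).im ≠ 0 := by
  have hne (ℓ : ℂ →ₗ[ℝ] ℝ) (z : ℂ) (hz : ℓ z ≠ 0) : ∀ᵐ x ∂μ, ℓ (φ x) ≠ 0 := by
    refine ae_linearMap_ne_zero μ (φ := ℓ ∘ₗ φ) fun h => hz ?_
    obtain ⟨x, rfl⟩ := hφ z
    exact LinearMap.congr_fun h x
  filter_upwards [hne Complex.reLm 1 (by simp), hne Complex.imLm Complex.I (by simp),
    hne (Complex.reLm - Complex.imLm) 1 (by simp), hne (Complex.reLm + Complex.imLm) 1 (by simp)]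
    with x hre him hsub hadd
  rw [im_pow_four]
  exact mul_ne_zero four_ne_zero (mul_ne_zero (mul_ne_zero hre him) (mul_ne_zero hsub hadd))

end AlmostEverywhere

open MeasureTheory in
theorem ae_forall_im_pow_four_ne_zero {p₁ p₂ q₁ q₂ : ℂ} (h : ∀ α : ℝ × ℝ, α ≠ 0 →
      LinearIndependent ℝ ![α.1 * p₁ + α.2 * q₁, α.1 * p₂ + α.2 * q₂]) :
    ∀ᵐ α : ℝ × ℝ, ∀ m n : ℤ, (m ≠ 0 ∨ n ≠ 0) →
      ((m * (α.1 * p₁ + α.2 * q₁) + n * (α.1 * p₂ + α.2 * q₂)) ^ 4).im ≠ 0 := by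
  simp only [ae_all_iff]
  intro m n hmn
  have hli : LinearIndependent ℝ ![m * p₁ + n * p₂, m * q₁ + n * q₂] := by
    refine LinearIndependent.pair_iff.2 fun s t hst => ?_
    by_contra hne
    have hzero := LinearIndependent.pair_iff.1 (h (s, t) fun h0 => hne (Prod.mk.inj h0)) m n (by
      simp only [Complex.real_smul] at hst ⊢
      push_cast
      linear_combination hst)
    exact hmn.elim (· (by exact_mod_cast hzero.1)) (· (by exact_mod_cast hzero.2))
  let φ : ℝ × ℝ →ₗ[ℝ] ℂ := (LinearMap.fst ℝ ℝ ℝ).smulRight (m * p₁ + n * p₂ : ℂ) +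
    (LinearMap.snd ℝ ℝ ℝ).smulRight (m * q₁ + n * q₂ : ℂ)
  have hφ (α : ℝ × ℝ) : φ α = α.1 * (m * p₁ + n * p₂) + α.2 * (m * q₁ + n * q₂) := by
    simp only [φ, LinearMap.add_apply, LinearMap.smulRight_apply, LinearMap.fst_apply,
      LinearMap.snd_apply, Complex.real_smul]
  have hsurjective : Function.Surjective φ := fun z => by
    obtain ⟨a, b, rfl⟩ := exists_eq_mul_add_mul hli z
    exact ⟨(a, b), hφ _⟩
  filter_upwards [ae_im_pow_four_ne_zero volume hsurjective] with α hα
  rw [hφ] at hα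
  convert hα using 3
  ring

theorem eq_zero_of_mapsTo_add_right {E : Type*} [NormedAddCommGroup E] [NormedSpace ℝ E] {S : Set E}
    (hS : Bornology.IsBounded S) (hne : S.Nonempty) {u : E} (h : MapsTo (· + u) S S) : u = 0 := by
  obtain ⟨x, hx⟩ := hne
  have hbound (n : ℕ) : n • ‖u‖ ≤ Metric.diam S := by
    have hn : x + n • u ∈ S := by simpa only [add_right_iterate] using h.iterate n hx
    calc n • ‖u‖ = dist (x + n • u) x := by
          rw [dist_eq_norm, add_sub_cancel_left, RCLike.norm_nsmul ℝ]
      _ ≤ Metric.diam S := Metric.dist_le_diam_of_mem hS hn hx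
  by_contra hu
  obtain ⟨n, hn⟩ := Archimedean.arch (Metric.diam S + 1) (norm_pos_iff.2 hu)
  linarith [hbound n]

theorem eq_of_image_planeTranslation_eq {S : Set ℂ} (hS : Bornology.IsBounded S)
    (hne : S.Nonempty) {u v : ℂ} (h : planeTranslation u '' S = planeTranslation v '' S) :
    u = v := by
  refine sub_eq_zero.1 (eq_zero_of_mapsTo_add_right hS hne fun z hz => ?_)
  obtain ⟨z', hz', heq⟩ := h ▸ mem_image_of_mem (planeTranslation u) hz
  rw [planeTranslation_apply, planeTranslation_apply] at heq
  rwa [show (z' : ℂ) = z + (u - v) by linear_combination heq] at hz'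

theorem discreteTopology_of_forall_nsmul_mem_span {E ι : Type*} [NormedAddCommGroup E]
    [NormedSpace ℝ E] [Finite ι] (b : Module.Basis ι ℝ E) {L : Submodule ℤ E} {N : ℕ} (hN : N ≠ 0)
    (h : ∀ s ∈ L, N • s ∈ Submodule.span ℤ (Set.range b)) : DiscreteTopology L := by
  have := Fintype.ofFinite ι
  let f (s : L) : Submodule.span ℤ (Set.range b) := ⟨N • (s : E), h s s.2⟩
  refine DiscreteTopology.of_continuous_injective (f := f) (by fun_prop) fun s t hst => ?_
  have hsmul : N • (s : E) = N • (t : E) := congrArg Subtype.val hst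
  rw [← Nat.cast_smul_eq_nsmul ℝ, ← Nat.cast_smul_eq_nsmul ℝ] at hsmul
  exact Subtype.ext (smul_right_injective E (Nat.cast_ne_zero.2 hN) hsmul)

theorem exists_basis_of_isZLattice (L : Submodule ℤ ℂ) [DiscreteTopology L] [IsZLattice ℝ L] :
    ∃ t₁ t₂ : ℂ, LinearIndependent ℝ ![t₁, t₂] ∧
      ∀ t, t ∈ L ↔ ∃ m n : ℤ, t = m * t₁ + n * t₂ := by
  have := ZLattice.module_free ℝ L
  have := ZLattice.module_finite ℝ L
  have hrank : Module.finrank ℤ L = 2 := by rw [ZLattice.rank ℝ L, Complex.finrank_real_complex]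
  let c : Module.Basis (Fin 2) ℤ L := Module.finBasisOfFinrankEq ℤ L hrank
  refine ⟨c 0, c 1, ?_, fun t => ⟨fun ht => ⟨c.repr ⟨t, ht⟩ 0, c.repr ⟨t, ht⟩ 1, ?_⟩, ?_⟩⟩
  · have hbasis : ⇑(c.ofZLatticeBasis ℝ L) = ![(c 0 : ℂ), (c 1 : ℂ)] :=
      funext (Fin.forall_fin_two.2 ⟨c.ofZLatticeBasis_apply ℝ L 0, c.ofZLatticeBasis_apply ℝ L 1⟩)
    exact hbasis ▸ (c.ofZLatticeBasis ℝ L).linearIndependent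
  · have hsum := congrArg (Subtype.val : L → ℂ) (c.sum_repr ⟨t, ht⟩)
    simp only [Fin.sum_univ_two, Submodule.coe_add, Submodule.coe_smul, zsmul_eq_mul] at hsum
    exact hsum.symm
  · rintro ⟨m, n, rfl⟩
    rw [← zsmul_eq_mul, ← zsmul_eq_mul]
    exact L.add_mem (L.smul_mem m (c 0).2) (L.smul_mem n (c 1).2)

theorem exists_lattice_basis {A : AddSubgroup ℂ} {p q : ℂ} (hpq : LinearIndependent ℝ ![p, q])
    (hp : p ∈ A) (hq : q ∈ A) (hindex : (AddSubgroup.closure {p, q}).relIndex A ≠ 0) :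
    ∃ t₁ t₂ : ℂ, LinearIndependent ℝ ![t₁, t₂] ∧
      ∀ t, t ∈ A ↔ ∃ m n : ℤ, t = m * t₁ + n * t₂ := by
  let b : Module.Basis (Fin 2) ℝ ℂ := basisOfLinearIndependentOfCardEqFinrank hpq
    (by simp [Complex.finrank_real_complex])
  have hb : ⇑b = ![p, q] := coe_basisOfLinearIndependentOfCardEqFinrank _ _
  have hrange : Set.range b = {p, q} := by rw [hb, Matrix.range_cons_cons_empty]
  let L : Submodule ℤ ℂ := AddSubgroup.toIntSubmodule A
  have : DiscreteTopology L := discreteTopology_of_forall_nsmul_mem_span b hindex fun s hs => by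
    rw [hrange, ← Submodule.mem_toAddSubgroup, Submodule.span_int_eq_addSubgroupClosure]
    exact AddSubgroup.nsmul_relIndex_mem _ hs
  have : IsZLattice ℝ L := by
    refine ⟨eq_top_iff.2 ?_⟩
    rw [← b.span_eq, hrange]
    exact Submodule.span_mono (insert_subset hp (singleton_subset_iff.2 hq))
  exact exists_basis_of_isZLattice L

/-! ### The symmetry groups of generic tilings -/

/-- The vectors of the translations in `G`. -/
def translationVectors (G : Subgroup (ℂ ≃ᵢ ℂ)) : AddSubgroup ℂ :=
  Subgroup.toAddSubgroup' (G.comap planeTranslationHom)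

theorem mem_translationVectors {G : Subgroup (ℂ ≃ᵢ ℂ)} {s : ℂ} :
    s ∈ translationVectors G ↔ planeTranslation s ∈ G := Iff.rfl

theorem mul_conj_mem_translationVectors {G : Subgroup (ℂ ≃ᵢ ℂ)} {g : ℂ ≃ᵢ ℂ} (hg : g ∈ G)
    {a b : ℂ} (h : ∀ z, g z = a * (starRingEnd ℂ) z + b) {s : ℂ} (hs : s ∈ translationVectors G) :
    a * (starRingEnd ℂ) s ∈ translationVectors G := by
  have hconj : planeTranslation (a * (starRingEnd ℂ) s) = g * planeTranslation s * g⁻¹ := by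
    ext z
    obtain ⟨u, rfl⟩ := g.surjective z
    rw [IsometryEquiv.mul_apply, IsometryEquiv.mul_apply, IsometryEquiv.inv_apply_self]
    simp only [planeTranslation_apply, h, map_add]
    ring
  rw [mem_translationVectors, hconj]
  exact G.mul_mem (G.mul_mem hg hs) (G.inv_mem hg)

/-- The linear part `σ` of a reflection or glide reflection would fix `p + σ p`, and send `p` to
`-p` if this sum is zero. -/
theorem not_forall_eq_mul_conj_add {G : Subgroup (ℂ ≃ᵢ ℂ)} {p : ℂ} (hp : p ∈ translationVectors G)
    (hp0 : p ≠ 0) (hgeneric : ∀ s ∈ translationVectors G, s ≠ 0 → (s ^ 4).im ≠ 0) {g : ℂ ≃ᵢ ℂ}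
    (hg : g ∈ G) {a b : ℂ} (ha : ‖a‖ = 1) (ha4 : a ^ 4 = 1) :
    ¬ ∀ z, g z = a * (starRingEnd ℂ) z + b := by
  intro hgz
  have haa : a * (starRingEnd ℂ) a = 1 := by
    rw [Complex.mul_conj, Complex.normSq_eq_norm_sq, ha, one_pow, Complex.ofReal_one]
  have hfixed : a * (starRingEnd ℂ) (p + a * (starRingEnd ℂ) p) = p + a * (starRingEnd ℂ) p := by
    rw [map_add, map_mul, Complex.conj_conj]
    linear_combination p * haa
  have hmem : p + a * (starRingEnd ℂ) p ∈ translationVectors G :=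
    add_mem hp (mul_conj_mem_translationVectors hg hgz hp)
  have hzero : p + a * (starRingEnd ℂ) p = 0 := by
    by_contra hne
    exact hgeneric _ hmem hne (im_pow_four_eq_zero ha4 (by rw [hfixed]))
  refine hgeneric p hp hp0 (im_pow_four_eq_zero ha4 ?_)
  rw [← neg_eq_of_add_eq_zero_right hzero, Even.neg_pow ⟨2, rfl⟩]

theorem isWallpaperP_prime_pow_or_forall {ℓ k : ℕ} (hℓ : ℓ.Prime) {G : Subgroup (ℂ ≃ᵢ ℂ)}
    (hlattice : ∃ t₁ t₂ : ℂ, LinearIndependent ℝ ![t₁, t₂] ∧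
      ∀ t : ℂ, planeTranslation t ∈ G ↔ ∃ m n : ℤ, t = m * t₁ + n * t₂)
    (h : ∀ g ∈ G, ∃ a b : ℂ, a ^ ℓ ^ (k + 1) = 1 ∧ ∀ z, g z = a * z + b) :
    IsWallpaperP (ℓ ^ (k + 1)) G ∨ ∀ g ∈ G, ∃ a b : ℂ, a ^ ℓ ^ k = 1 ∧ ∀ z, g z = a * z + b := by
  have := Fact.mk hℓ
  by_contra! hcontra
  obtain ⟨hnot, g, hg, hpow⟩ := hcontra
  obtain ⟨a, b, ha, hgz⟩ := h g hg
  have hne : ¬ a ^ ℓ ^ k = 1 := fun hak => (hpow a b hak).elim fun z hz => hz (hgz z)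
  exact hnot ⟨hlattice, h, g, hg, a, b,
    IsPrimitiveRoot.iff_orderOf.2 (orderOf_eq_prime_pow hne ha), hgz⟩

theorem isWallpaperP_one_or_two_or_four {G : Subgroup (ℂ ≃ᵢ ℂ)}
    (hlattice : ∃ t₁ t₂ : ℂ, LinearIndependent ℝ ![t₁, t₂] ∧
      ∀ t : ℂ, planeTranslation t ∈ G ↔ ∃ m n : ℤ, t = m * t₁ + n * t₂)
    (h : ∀ g ∈ G, ∃ a b : ℂ, a ^ 4 = 1 ∧ ∀ z, g z = a * z + b) :
    IsWallpaperP 1 G ∨ IsWallpaperP 2 G ∨ IsWallpaperP 4 G := by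
  rcases isWallpaperP_prime_pow_or_forall (k := 1) Nat.prime_two hlattice h with h4 | h
  · exact Or.inr (Or.inr h4)
  rcases isWallpaperP_prime_pow_or_forall (k := 0) Nat.prime_two hlattice h with h2 | h
  · exact Or.inr (Or.inl h2)
  · exact Or.inl ⟨hlattice, h, 1, G.one_mem, 1, 0, IsPrimitiveRoot.one, fun z => by simp⟩

theorem relIndex_ne_zero_of_finite {A : Type*} [AddCommGroup A] {B C : AddSubgroup A} {β : Type*}
    {s : Set β} (hs : s.Finite) (φ : A → β) (hmaps : MapsTo φ C s)
    (hφ : ∀ x ∈ C, ∀ y ∈ C, φ x = φ y → x - y ∈ B) : B.relIndex C ≠ 0 := by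
  have := hs.to_subtype
  let ψ (q : C ⧸ B.addSubgroupOf C) : s := ⟨φ q.out, hmaps q.out.2⟩
  have hψ : Function.Injective ψ := fun q r hqr => by
    rw [← q.out_eq', ← r.out_eq', eq_comm, QuotientAddGroup.eq_iff_sub_mem]
    exact hφ _ r.out.2 _ q.out.2 (congrArg Subtype.val hqr).symm
  have := Finite.of_injective ψ hψ
  exact AddSubgroup.index_ne_zero_of_finite

namespace PlaneMap

variable {M : PlaneMap}

namespace SquareTiling

variable {w w₁ w₂ : M.DirEdge → ℝ} (T : M.SquareTiling w)

theorem square_eq_axisSquare {d : M.DirEdge} (hd : w d ≠ 0) : T.square d.edge =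
    axisSquare (min (T.abscissa d.right) (T.abscissa d.rev.right))
      (min (T.height d.vertex) (T.height d.rev.vertex)) |w d| := by
  have hmax {a b : ℝ} (h : |b - a| = |w d|) : min a b + |w d| = max a b := by
    rw [← h, ← max_sub_min_eq_abs, add_sub_cancel]
  ext z
  rw [T.mem_square_iff, axisSquare, hmax (by rw [T.abscissa_rev_sub]),
    hmax (by rw [abs_sub_comm, T.height_sub_rev])]
  exact and_iff_right hd

theorem mem_tiles_iff {S : Set ℂ} :
    S ∈ T.tiles ↔ ∃ d : M.DirEdge, w d ≠ 0 ∧ S = T.square d.edge := by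
  constructor
  · rintro ⟨e, he, rfl, hne⟩
    have hedge : (orient ⟨e, he⟩).edge = e := orient_edge ⟨e, he⟩
    rw [← hedge] at hne ⊢
    exact ⟨_, (T.square_nonempty_iff _).1 hne, rfl⟩
  · rintro ⟨d, hd, rfl⟩
    exact ⟨d.edge, d.edge_mem, rfl, (T.square_nonempty_iff d).2 hd⟩

theorem exists_axisSquare_of_mem_tiles {S : Set ℂ} (hS : S ∈ T.tiles) :
    ∃ x y s : ℝ, 0 < s ∧ S = axisSquare x y s := by
  obtain ⟨d, hd, rfl⟩ := T.mem_tiles_iff.1 hS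
  exact ⟨_, _, _, abs_pos.2 hd, T.square_eq_axisSquare hd⟩

theorem tiles_nonempty (hw : w ≠ 0) : T.tiles.Nonempty := by
  obtain ⟨d, hd⟩ := Function.ne_iff.1 hw
  exact ⟨_, T.mem_tiles_iff.2 ⟨d, hd, rfl⟩⟩

variable {T}

theorem image_mem_tiles {g : ℂ ≃ᵢ ℂ} (hg : g ∈ T.symmetryGroup) {S : Set ℂ} (hS : S ∈ T.tiles) :
    g '' S ∈ T.tiles := by
  have himage : (fun S : Set ℂ => g '' S) '' T.tiles = T.tiles := hg
  exact himage ▸ mem_image_of_mem _ hS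

theorem pow_four_eq_one_of_mem_symmetryGroup (hw : w ≠ 0) {g : ℂ ≃ᵢ ℂ} (hg : g ∈ T.symmetryGroup)
    {a b : ℂ} (h : (∀ z, g z = a * z + b) ∨ ∀ z, g z = a * (starRingEnd ℂ) z + b) :
    a ^ 4 = 1 := by
  obtain ⟨S, hS⟩ := T.tiles_nonempty hw
  obtain ⟨x', y', s', hs', himage⟩ := T.exists_axisSquare_of_mem_tiles (image_mem_tiles hg hS)
  obtain ⟨x, y, s, hs, rfl⟩ := T.exists_axisSquare_of_mem_tiles hS
  exact pow_four_eq_one_of_image_axisSquare hs hs'.le himage h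

theorem exists_finite_image_planeTranslation_mem {x₁ x₂ : ℂ × ℂ} (hx₁ : x₁ ∈ T.periodGroup)
    (hx₂ : x₂ ∈ T.periodGroup) (hli : LinearIndependent ℝ ![x₁.1, x₂.1]) :
    ∃ 𝒟 : Set (Set ℂ), 𝒟.Finite ∧
      ∀ S ∈ T.tiles, ∃ m n : ℤ, planeTranslation (m * x₁.2 + n * x₂.2) '' S ∈ 𝒟 := by
  obtain ⟨f₁, hf₁, -⟩ := id hx₁
  obtain ⟨f₂, hf₂, -⟩ := id hx₂
  have hpair : IsTranslationPair f₁ f₂ x₁.1 x₂.1 := ⟨hf₁, hf₂, hli⟩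
  obtain ⟨D, hD, hcover⟩ := hpair.exists_finite_forall_mapDir_mem
  refine ⟨(fun d : M.DirEdge => T.square d.edge) '' D, hD.image _, fun S hS => ?_⟩
  obtain ⟨d, -, rfl⟩ := T.mem_tiles_iff.1 hS
  obtain ⟨m, n, hmn⟩ := hcover d
  obtain ⟨f, hf, hacts⟩ := exists_actsBy_of_mem_periodGroup
    (T.periodGroup.add_mem (T.periodGroup.zsmul_mem hx₁ m) (T.periodGroup.zsmul_mem hx₂ n))
  have hfst : (m • x₁ + n • x₂).1 = m * x₁.1 + n * x₂.1 := by simp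
  have hsnd : (m • x₁ + n • x₂).2 = m * x₁.2 + n * x₂.2 := by simp
  obtain rfl : f = f₁ ^ m * f₂ ^ n := Subtype.ext <| IsometryEquiv.ext fun z => by
    rw [hpair.zpow_mul_zpow_apply, hf, planeTranslation_apply, hfst]
  refine ⟨m, n, _, hmn, ?_⟩
  rw [← hsnd]
  exact (hacts.image_square d.edge_mem).symm

/-- Modulo the translations induced by those of `M`, a translation of the tiling is determined by
the image of a fixed tile, for which there are finitely many possibilities. -/
theorem relIndex_closure_ne_zero (hw : w ≠ 0) {x₁ x₂ : ℂ × ℂ} (hx₁ : x₁ ∈ T.periodGroup)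
    (hx₂ : x₂ ∈ T.periodGroup) (hli : LinearIndependent ℝ ![x₁.1, x₂.1]) :
    (AddSubgroup.closure {x₁.2, x₂.2}).relIndex (translationVectors T.symmetryGroup) ≠ 0 := by
  obtain ⟨𝒟, hfinite, h𝒟⟩ := exists_finite_image_planeTranslation_mem hx₁ hx₂ hli
  obtain ⟨S, hS⟩ := T.tiles_nonempty hw
  have hne : S.Nonempty := hS.choose_spec.2.2
  have hbounded : Bornology.IsBounded S := by
    obtain ⟨x, y, s, -, rfl⟩ := T.exists_axisSquare_of_mem_tiles hS
    exact isBounded_axisSquare x y s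
  have htranslate (s : ℂ) : ∃ u ∈ AddSubgroup.closure {x₁.2, x₂.2},
      s ∈ translationVectors T.symmetryGroup → planeTranslation (u + s) '' S ∈ 𝒟 := by
    by_cases hs : s ∈ translationVectors T.symmetryGroup
    · obtain ⟨m, n, hmn⟩ := h𝒟 _ (image_mem_tiles hs hS)
      refine ⟨m * x₁.2 + n * x₂.2, AddSubgroup.mem_closure_pair.2 ⟨m, n, by simp⟩, fun _ => ?_⟩
      rw [planeTranslation_add, IsometryEquiv.coe_mul, image_comp]
      exact hmn
    · exact ⟨0, zero_mem _, fun h => absurd h hs⟩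
  choose u hu h𝒟u using htranslate
  refine relIndex_ne_zero_of_finite hfinite (fun s => planeTranslation (u s + s) '' S) h𝒟u
    fun s _ t _ hst => ?_
  have heq : u s + s = u t + t := eq_of_image_planeTranslation_eq hbounded hne hst
  rw [show s - t = u t - u s by linear_combination heq]
  exact sub_mem (hu t) (hu s)

theorem im_pow_four_ne_zero_of_mem_translationVectors {p q : ℂ}
    (hgeneric : ∀ m n : ℤ, (m ≠ 0 ∨ n ≠ 0) → ((m * p + n * q) ^ 4).im ≠ 0) {A : AddSubgroup ℂ}
    (hindex : (AddSubgroup.closure {p, q}).relIndex A ≠ 0) {s : ℂ} (hs : s ∈ A) (hs0 : s ≠ 0) :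
    (s ^ 4).im ≠ 0 := by
  set N := (AddSubgroup.closure {p, q}).relIndex A
  obtain ⟨m, n, hmn⟩ :=
    AddSubgroup.mem_closure_pair.1 (AddSubgroup.nsmul_relIndex_mem (.closure {p, q}) hs)
  rw [zsmul_eq_mul, zsmul_eq_mul, nsmul_eq_mul] at hmn
  have hne : m ≠ 0 ∨ n ≠ 0 := by
    by_contra! h
    obtain ⟨rfl, rfl⟩ := h
    simp only [Int.cast_zero, zero_mul, add_zero] at hmn
    exact mul_ne_zero (Nat.cast_ne_zero.2 hindex) hs0 hmn.symm
  have him := hgeneric m n hne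
  rw [hmn, mul_pow, ← Nat.cast_pow, ← nsmul_eq_mul, Complex.im_nsmul] at him
  exact right_ne_zero_of_smul him

theorem isWallpaperP_of_forall_im_pow_four_ne_zero (hharmonic : IsHarmonic w) (hw : w ≠ 0)
    {x₁ x₂ : ℂ × ℂ} (hx₁ : x₁ ∈ T.periodGroup) (hx₂ : x₂ ∈ T.periodGroup)
    (hli : LinearIndependent ℝ ![x₁.1, x₂.1])
    (hgeneric : ∀ m n : ℤ, (m ≠ 0 ∨ n ≠ 0) → ((m * x₁.2 + n * x₂.2) ^ 4).im ≠ 0) :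
    IsWallpaperP 1 T.symmetryGroup ∨ IsWallpaperP 2 T.symmetryGroup ∨
      IsWallpaperP 4 T.symmetryGroup := by
  have hp₁ : x₁.2 ∈ translationVectors T.symmetryGroup := planeTranslation_mem_symmetryGroup hx₁
  have hp₂ : x₂.2 ∈ translationVectors T.symmetryGroup := planeTranslation_mem_symmetryGroup hx₂
  have hindependent := linearIndependent_snd_of_mem_periodGroup hharmonic hw hx₁ hx₂ hli
  have hindex := relIndex_closure_ne_zero hw hx₁ hx₂ hli
  refine isWallpaperP_one_or_two_or_four (exists_lattice_basis hindependent hp₁ hp₂ hindex)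
    fun g hg => ?_
  rcases isDirect_or_isOpposite g with ⟨a, b, -, hab⟩ | ⟨a, b, ha, hab⟩
  · exact ⟨a, b, pow_four_eq_one_of_mem_symmetryGroup hw hg (Or.inl hab), hab⟩
  · exact absurd hab (not_forall_eq_mul_conj_add hp₁ (hindependent.ne_zero 0)
      (fun s => im_pow_four_ne_zero_of_mem_translationVectors hgeneric hindex) hg ha
      (pow_four_eq_one_of_mem_symmetryGroup hw hg (Or.inr hab)))

/-- The tiling of a linear combination of two vectors, built from tilings of these vectors. -/
def combination (T₁ : M.SquareTiling w₁) (T₂ : M.SquareTiling w₂) (α : ℝ × ℝ) :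
    M.SquareTiling (α.1 • w₁ + α.2 • w₂) where
  height v := α.1 * T₁.height v + α.2 * T₂.height v
  abscissa F := α.1 * T₁.abscissa F + α.2 * T₂.abscissa F
  height_sub d d' h := by
    simp only [Pi.add_apply, Pi.smul_apply, smul_eq_mul]
    rw [← T₁.height_sub d d' h, ← T₂.height_sub d d' h]
    ring
  abscissa_sub d d' F F' h hF hF' := by
    simp only [Pi.add_apply, Pi.smul_apply, smul_eq_mul]
    rw [← T₁.abscissa_sub d d' F F' h hF hF', ← T₂.abscissa_sub d d' F F' h hF hF']
    ring

theorem mem_periodGroup_combination {T₁ : M.SquareTiling w₁} {T₂ : M.SquareTiling w₂} {t p q : ℂ}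
    (hp : (t, p) ∈ T₁.periodGroup) (hq : (t, q) ∈ T₂.periodGroup) (α : ℝ × ℝ) :
    (t, α.1 * p + α.2 * q) ∈ (T₁.combination T₂ α).periodGroup := by
  obtain ⟨f, hf, hfp⟩ := hp
  obtain ⟨f', hf', hfq⟩ := hq
  obtain rfl : f' = f := Subtype.ext (hf'.trans hf.symm)
  refine ⟨f', hf, fun d => ?_⟩
  simp only [combination, hfp, hfq, Complex.add_im, Complex.add_re, Complex.re_ofReal_mul,
    Complex.im_ofReal_mul]
  constructor <;> ring

theorem periodGroup_eq (T T' : M.SquareTiling w) : T.periodGroup = T'.periodGroup := by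
  suffices h : ∀ T T' : M.SquareTiling w, T.periodGroup ≤ T'.periodGroup from
    le_antisymm (h T T') (h T' T)
  rintro T T' x ⟨f, hf, hshift⟩
  have hone (d : M.DirEdge) : w (mapDir 1 d) = 1 * w d := by rw [mapDir_one, one_mul]
  have hdirect : IsDirect (1 : M.symmetryGroup).1 := ⟨1, 0, norm_one, fun z => by simp⟩
  obtain ⟨k, hk⟩ := T.exists_height_shift T' 1 1 hone
  obtain ⟨c, hc⟩ := T.exists_abscissa_shift_of_isDirect T' hdirect 1 hone
  have hheight (d : M.DirEdge) : T'.height d.vertex = T.height d.vertex + k := by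
    rw [← one_mul (T.height _), ← hk]
    rfl
  have habscissa (d : M.DirEdge) : T'.abscissa d.right = T.abscissa d.right + c := by
    rw [← one_mul (T.abscissa _), ← hc, ← right_mapDir_of_isDirect hdirect, mapDir_one]
  refine ⟨f, hf, fun d => ?_⟩
  rw [hheight, hheight, habscissa, habscissa, (hshift d).1, (hshift d).2]
  constructor <;> ring

end SquareTiling

theorem exists_forall_mem_periodGroup {w₁ w₂ : M.DirEdge → ℝ} (hw₁ : w₁ ∈ M.harmPer)
    (hw₂ : w₂ ∈ M.harmPer) {f : M.symmetryGroup} {t : ℂ} (hf : f.1 = planeTranslation t) :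
    ∃ p q : ℂ, ∀ (α : ℝ × ℝ) (T : M.SquareTiling (α.1 • w₁ + α.2 • w₂)),
      (t, α.1 * p + α.2 * q) ∈ T.periodGroup := by
  obtain ⟨T₁⟩ := nonempty_squareTiling hw₁.1
  obtain ⟨T₂⟩ := nonempty_squareTiling hw₂.1
  obtain ⟨p, hp⟩ := T₁.exists_mem_periodGroup hf (weight_mapDir_of_translation hw₁ hf)
  obtain ⟨q, hq⟩ := T₂.exists_mem_periodGroup hf (weight_mapDir_of_translation hw₂ hf)
  refine ⟨p, q, fun α T => ?_⟩
  rw [SquareTiling.periodGroup_eq T (T₁.combination T₂ α)]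
  exact SquareTiling.mem_periodGroup_combination hp hq α

theorem ae_isWallpaperP {w₁ w₂ : M.DirEdge → ℝ} (h : M.IsHarmPerBasis w₁ w₂) :
    ∀ᵐ α : ℝ × ℝ, ∀ T : M.SquareTiling (α.1 • w₁ + α.2 • w₂),
      IsWallpaperP 1 T.symmetryGroup ∨ IsWallpaperP 2 T.symmetryGroup ∨
        IsWallpaperP 4 T.symmetryGroup := by
  obtain ⟨hindependent, hspan⟩ := h
  have hmem (α : ℝ × ℝ) : α.1 • w₁ + α.2 • w₂ ∈ M.harmPer := by
    rw [← hspan]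
    exact Submodule.mem_span_pair.2 ⟨α.1, α.2, rfl⟩
  have hne {α : ℝ × ℝ} (hα : α ≠ 0) : α.1 • w₁ + α.2 • w₂ ≠ 0 := fun h0 =>
    hα (Prod.ext_iff.2 (LinearIndependent.pair_iff.1 hindependent _ _ h0))
  have hw₁ : w₁ ∈ M.harmPer := by simpa using hmem (1, 0)
  have hw₂ : w₂ ∈ M.harmPer := by simpa using hmem (0, 1)
  obtain ⟨-, f₁, f₂, t₁, t₂, hf₁, hf₂, hli, -, -⟩ := id hw₁
  obtain ⟨p₁, q₁, hx₁⟩ := exists_forall_mem_periodGroup hw₁ hw₂ hf₁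
  obtain ⟨p₂, q₂, hx₂⟩ := exists_forall_mem_periodGroup hw₁ hw₂ hf₂
  have hindependent_snd (α : ℝ × ℝ) (hα : α ≠ 0) :
      LinearIndependent ℝ ![α.1 * p₁ + α.2 * q₁, α.1 * p₂ + α.2 * q₂] := by
    obtain ⟨T⟩ := nonempty_squareTiling (hmem α).1
    exact SquareTiling.linearIndependent_snd_of_mem_periodGroup (x₁ := (t₁, _)) (x₂ := (t₂, _))
      (hmem α).1 (hne hα) (hx₁ α T) (hx₂ α T) hli
  filter_upwards [ae_forall_im_pow_four_ne_zero hindependent_snd] with α hgeneric T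
  have hα : α ≠ 0 := by
    rintro rfl
    simpa using hgeneric 1 0 (Or.inl one_ne_zero)
  exact SquareTiling.isWallpaperP_of_forall_im_pow_four_ne_zero (x₁ := (t₁, _)) (x₂ := (t₂, _))
    (hmem α).1 (hne hα) (hx₁ α T) (hx₂ α T) hli hgeneric

end PlaneMap

end

theorem mainTheorem5_general (M : PlaneMap) :
    (∀ w : M.DirEdge → ℝ, PlaneMap.IsHarmonic w → Nonempty (M.SquareTiling w)) ∧
    (∀ w : M.DirEdge → ℝ, w ≠ 0 → ∀ (T : M.SquareTiling w) (f : M.symmetryGroup),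
      T.Induces f ↔ (PlaneMap.pushforward f w = w ∨ PlaneMap.pushforward f w = -w)) ∧
    (ContainsP2 M.symmetryGroup →
      ∀ w ∈ M.harmPer, w ≠ 0 → ∀ T : M.SquareTiling w, ContainsP2 T.symmetryGroup) ∧
    (∀ w₁ w₂ : M.DirEdge → ℝ, M.IsHarmPerBasis w₁ w₂ →
      ∀ᵐ α : ℝ × ℝ, ∀ T : M.SquareTiling (α.1 • w₁ + α.2 • w₂),
        IsWallpaperP 1 T.symmetryGroup ∨ IsWallpaperP 2 T.symmetryGroup ∨
          IsWallpaperP 4 T.symmetryGroup) :=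
  ⟨fun _ => PlaneMap.nonempty_squareTiling, fun _ hw _ _ => PlaneMap.SquareTiling.induces_iff hw,
    fun hM _ hw hw0 T => T.containsP2_symmetryGroup hM hw hw0,
    fun _ _ hbasis => PlaneMap.ae_isWallpaperP hbasis⟩

theorem mainTheorem5 (M : PlaneMap) (hM : M.IsPeriodic) :
    -- the tiling `T(M, w)` exists
    (∀ w ∈ M.harmPer, w ≠ 0 → Nonempty (M.SquareTiling w)) ∧
    -- (i)
    (∀ w ∈ M.harmPer, w ≠ 0 → ∀ (T : M.SquareTiling w) (f : M.symmetryGroup),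
      T.Induces f ↔ (PlaneMap.pushforward f w = w ∨ PlaneMap.pushforward f w = -w)) ∧
    -- (ii)
    (ContainsP2 M.symmetryGroup →
      ∀ w ∈ M.harmPer, w ≠ 0 → ∀ T : M.SquareTiling w, ContainsP2 T.symmetryGroup) ∧
    -- (iii)
    (∀ w₁ w₂ : M.DirEdge → ℝ, M.IsHarmPerBasis w₁ w₂ →
      ∀ᵐ α : ℝ × ℝ, ∀ T : M.SquareTiling (α.1 • w₁ + α.2 • w₂),
        IsWallpaperP 1 T.symmetryGroup ∨ IsWallpaperP 2 T.symmetryGroup ∨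
          IsWallpaperP 4 T.symmetryGroup) := by
  obtain ⟨hexists, hinduces, hp2, hgeneric⟩ := mainTheorem5_general M
  exact ⟨fun w hw _ => hexists w hw.1, fun w _ => hinduces w, hp2, hgeneric⟩
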